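/- Let $\bar M$ be a complex manifold of complex dimension $2m+1$ with complex structure $\bar J$ and a normal complex contact metric structure. That is, $\bar g$ is a Hermitian metric with Levi-Civita connection $\bar\nabla$, and $\bar M$ is covered by open sets $\mathcal U$ each carrying smooth $1$-forms $\bar u$, $\bar v=\bar u\circ \bar J$, vector fields $\bar U$, $\bar V=-\bar J\bar U$ with $\bar u=\bar g(\cdot,\bar U)$, $\bar u(\bar U)=1$, and $(1,1)$-tensor fields $\bar G$, $\bar H=\bar G\bar J$ such that $$\bar G^2=\bar H^2=-I+\bar u\otimes\bar U+\bar v\otimes\bar V,\quad \bar G\bar J=-\bar J\bar G,\quad \bar G\bar U=0,\quad \bar g(K,\bar GL)=-\bar g(\bar GK,L),$$ where on overlaps $\bar u'=c\bar u-d\bar v$, $\bar v'=d\bar u+c\bar v$, $\bar G'=c\bar G-d\bar H$, $\bar H'=d\bar G+c\bar H$ for functions $c,d$ with $c^2+d^2=1$. Put $\bar\sigma(K)=\bar g(\bar\nabla_K\bar U,\bar V)$. The structure is contact metric: with $d\alpha(K,L)=\frac12\big(K\alpha(L)-L\alpha(K)-\alpha([K,L])\big)$ and $(\alpha\wedge\beta)(K,L)=\frac12\big(\alpha(K)\beta(L)-\alpha(L)\beta(K)\big)$,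 $$d\bar u(K,L)=\bar g(K,\bar GL)+(\bar\sigma\wedge\bar v)(K,L),\qquad d\bar v(K,L)=\bar g(K,\bar HL)-(\bar\sigma\wedge\bar u)(K,L).$$ It is normal: with $[A,A](K,L)=(\bar\nabla_{AK}A)L-(\bar\nabla_{AL}A)K-A(\bar\nabla_KA)L+A(\bar\nabla_LA)K$ and $$\begin{aligned}S(K,L)={}&[\bar G,\bar G](K,L)+2\bar g(K,\bar GL)\bar U-2\bar g(K,\bar HL)\bar V+2(\bar v(L)\bar HK-\bar v(K)\bar HL)\\&+\bar\sigma(\bar GL)\bar HK-\bar\sigma(\bar GK)\bar HL+\bar\sigma(K)\bar G\bar HL-\bar\sigma(L)\bar G\bar HK,\\ T(K,L)={}&[\bar H,\bar H](K,L)-2\bar g(K,\bar GL)\bar U+2\bar g(K,\bar HL)\bar V+2(\bar u(L)\bar GK-\bar u(K)\bar GL)\\&+\bar\sigma(\bar HK)\bar GL-\bar\sigma(\bar HL)\bar GK+\bar\sigma(K)\bar G\bar HL-\bar\sigma(L)\bar G\bar HK,\end{aligned}$$ one has $S(K,L)=T(K,L)=0$ for all $K,L\in\mathcal H=\ker\bar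 u\cap\ker\bar v$, and $S(K,\bar U)=T(K,\bar V)=0$ for all $K$. Let $M$ be an (immersed) complex submanifold of $\bar M$ to which $\bar U,\bar V$ are tangent. For $K\in T_pM$ let $PK$ and $QK$ be the tangential and normal parts of $\bar GK$, and put $$\mathcal D_p=\{K\in T_pM\cap\mathcal H: QK=0\},\qquad \mathcal D^\perp_p=\{K\in T_pM\cap\mathcal H: PK=0\}.$$ Suppose that $M$ is semi-invariant, i.e. that $\mathcal D$ and $\mathcal D^\perp$ have constant dimension and are differentiable distributions on $M$. Let $\mathbf h(K,L)$, the normal part of $\bar\nabla_KL$, be the second fundamental form of $M$. Then the distribution $\mathcal D\oplus \mathrm{sp}\{\bar U,\bar V\}$ on $M$ is involutive (the bracket of any two local smooth sections is again a section) if and only if $$\mathbf h(K,\bar GL)=\mathbf h(\bar GK,L)$$ for all local smooth sections $K,L$ of $\mathcal D$ and each of the local tensors $\bar G$. -/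

import Mathlib

open scoped Manifold ContDiff Topology
open Bundle

set_option linter.unusedSectionVars false

noncomputable section

/-! ### Linear algebra: the isomorphism given by a positive definite form -/

section Sharp

variable {V : Type*} [AddCommGroup V] [Module ℝ V] [FiniteDimensional ℝ V]

/-- The isomorphism `V* ≃ V` attached to a positive definite bilinear form `B` on `V`:
`sharp B α` is the unique vector with `B (sharp B α) z = α z` for all `z`. -/
def sharp (B : V →ₗ[ℝ] Module.Dual ℝ V) (hB : ∀ v, v ≠ 0 → 0 < B v v) :
    Module.Dual ℝ V ≃ₗ[ℝ] V :=
  (LinearMap.linearEquivOfInjective B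
    ((injective_iff_map_eq_zero B).2 fun v hv => by
      by_contra h
      have := hB v h
      rw [hv] at this
      simp at this)
    Subspace.dual_finrank_eq.symm).symm

theorem sharp_spec (B : V →ₗ[ℝ] Module.Dual ℝ V) (hB : ∀ v, v ≠ 0 → 0 < B v v)
    (α : Module.Dual ℝ V) (z : V) : B (sharp B hB α) z = α z := by
  have h : B (sharp B hB α) = α :=
    (LinearMap.linearEquivOfInjective B _ Subspace.dual_finrank_eq.symm).apply_symm_apply α
  rw [h]

end Sharp

/-! ### Complex manifolds as real manifolds

A complex manifold is a space with holomorphic charts in a finite dimensional complex vector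
space `E`; the charts make it a smooth real manifold, whose tangent spaces `T_q` are copies of `E`
(through the preferred chart at `q`) and so carry the almost complex structure `J`. -/

section ComplexManifold

/-- A complex manifold is a smooth (indeed real analytic) real manifold. -/
instance instIsManifoldRealOfComplex {E N : Type*} [NormedAddCommGroup E] [NormedSpace ℂ E]
    [TopologicalSpace N] [ChartedSpace E N] [IsManifold 𝓘(ℂ, E) ω N] :
    IsManifold 𝓘(ℝ, E) ω N := by
  refine isManifold_of_contDiffOn 𝓘(ℝ, E) ω N fun e e' he he' => ?_
  have h := (mem_groupoid_of_pregroupoid.1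
    (HasGroupoid.compatible (G := contDiffGroupoid ω 𝓘(ℂ, E)) he he')).1
  exact ContDiffOn.restrict_scalars ℝ (𝕜' := ℂ) h

instance instFiniteDimensionalTangentSpace {E N : Type*} [NormedAddCommGroup E] [NormedSpace ℂ E]
    [FiniteDimensional ℂ E] [TopologicalSpace N] [ChartedSpace E N] (q : N) :
    FiniteDimensional ℝ (TangentSpace 𝓘(ℝ, E) q) :=
  inferInstanceAs (FiniteDimensional ℝ E)

/-- The real tangent space `T_q N` of a complex manifold. -/
abbrev Tan (E : Type*) [NormedAddCommGroup E] [NormedSpace ℂ E] {N : Type*} [TopologicalSpace N]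
    [ChartedSpace E N] (q : N) : Type _ := TangentSpace 𝓘(ℝ, E) q

variable {E : Type*} [NormedAddCommGroup E] [NormedSpace ℂ E]
  {N : Type*} [TopologicalSpace N] [ChartedSpace E N]

/-- The almost complex structure `J` of a complex manifold: multiplication by `i` in a holomorphic
chart. -/
def cplxJ (E : Type*) [NormedAddCommGroup E] [NormedSpace ℂ E] {N : Type*} [TopologicalSpace N]
    [ChartedSpace E N] (q : N) : Tan E q →L[ℝ] Tan E q :=
  (Complex.I • ContinuousLinearMap.id ℝ E : E →L[ℝ] E)

/-- `K` is a smooth vector field on the set `W`. -/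
def IsSmoothField [IsManifold 𝓘(ℂ, E) ω N] (K : ∀ q : N, Tan E q) (W : Set N) : Prop :=
  ContMDiffOn 𝓘(ℝ, E) 𝓘(ℝ, E).tangent ∞
    (fun q => (⟨q, K q⟩ : TangentBundle 𝓘(ℝ, E) N)) W

/-- `A` is a smooth `(1,1)` tensor field on the set `W`. -/
def IsSmoothEndo [IsManifold 𝓘(ℂ, E) ω N] (A : ∀ q : N, Tan E q →L[ℝ] Tan E q)
    (W : Set N) : Prop :=
  ContMDiffOn 𝓘(ℝ, E) (𝓘(ℝ, E).prod 𝓘(ℝ, E →L[ℝ] E)) ∞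
    (fun q => TotalSpace.mk' (E →L[ℝ] E)
      (E := fun q : N => Tan E q →L[ℝ] Tan E q) q (A q)) W

/-- `α` is a smooth `1`-form on the set `W`. -/
def IsSmoothForm [IsManifold 𝓘(ℂ, E) ω N] (α : ∀ q : N, Tan E q →L[ℝ] ℝ) (W : Set N) : Prop :=
  ContMDiffOn 𝓘(ℝ, E) (𝓘(ℝ, E).prod 𝓘(ℝ, E →L[ℝ] ℝ)) ∞
    (fun q => TotalSpace.mk' (E →L[ℝ] ℝ)
      (E := fun q : N => Tan E q →L[ℝ] Bundle.Trivial N ℝ q) q (α q)) W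

/-- The exterior derivative of a `1`-form, with the convention
`dα(K,L) = 1/2 (K(α(L)) - L(α(K)) - α([K,L]))`. -/
def extDer (α : ∀ q : N, Tan E q →L[ℝ] ℝ) (K L : ∀ q : N, Tan E q) (q : N) : ℝ :=
  (1 / 2) * (mvfderiv 𝓘(ℝ, E) (fun x => α x (L x)) q (K q)
    - mvfderiv 𝓘(ℝ, E) (fun x => α x (K x)) q (L q)
    - α q (VectorField.mlieBracket 𝓘(ℝ, E) K L q))

/-- The wedge product of two covectors, with the convention (matching that of `extDer`)
`(α ∧ β)(k,l) = 1/2 (α(k) β(l) - α(l) β(k))`. -/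
def wedge {V : Type*} (α β : V → ℝ) (k l : V) : ℝ := (1 / 2) * (α k * β l - α l * β k)

/-! ### Distributions -/

/-- A distribution `Δ` on a complex manifold is differentiable: every vector of `Δ` extends to a
local smooth section of `Δ`. -/
def IsSmoothDistribution [IsManifold 𝓘(ℂ, E) ω N] (Δ : ∀ p : N, Submodule ℝ (Tan E p)) : Prop :=
  ∀ p, ∀ k ∈ Δ p, ∃ (W : Set N) (K : ∀ x : N, Tan E x), IsOpen W ∧ p ∈ W ∧ IsSmoothField K W ∧
    (∀ x ∈ W, K x ∈ Δ x) ∧ K p = k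

/-- A distribution `Δ` is involutive: the bracket of two local smooth sections of `Δ` is a section
of `Δ`. -/
def IsInvolutive [IsManifold 𝓘(ℂ, E) ω N] (Δ : ∀ p : N, Submodule ℝ (Tan E p)) : Prop :=
  ∀ (W : Set N) (K L : ∀ x : N, Tan E x), IsOpen W → IsSmoothField K W → IsSmoothField L W →
    (∀ x ∈ W, K x ∈ Δ x) → (∀ x ∈ W, L x ∈ Δ x) →
    ∀ x ∈ W, VectorField.mlieBracket 𝓘(ℝ, E) K L x ∈ Δ x

end ComplexManifold

/-! ### The Levi-Civita connection -/

section LeviCivita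

/-- Riemannian metrics on the real manifold underlying a complex manifold. -/
abbrev RiemMetric (E N : Type*) [NormedAddCommGroup E] [NormedSpace ℂ E] [TopologicalSpace N]
    [ChartedSpace E N] [IsManifold 𝓘(ℂ, E) ω N] : Type _ :=
  ContMDiffRiemannianMetric 𝓘(ℝ, E) ∞ E (fun q : N => Tan E q)

variable {E : Type*} [NormedAddCommGroup E] [NormedSpace ℂ E] [FiniteDimensional ℂ E]
  {N : Type*} [TopologicalSpace N] [ChartedSpace E N] [IsManifold 𝓘(ℂ, E) ω N]

/-- The metric at a point as an algebraic bilinear form. -/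
def metricForm (g : RiemMetric E N) (q : N) : Tan E q →ₗ[ℝ] Module.Dual ℝ (Tan E q) :=
  LinearMap.mk₂ ℝ (fun v w => g.inner q v w) (by simp) (by simp) (by simp) (by simp)

theorem metricForm_pos (g : RiemMetric E N) (q : N) (v : Tan E q) (hv : v ≠ 0) :
    0 < metricForm g q v v := g.pos q v hv

/-- The Gram form of `g` in the preferred chart at `q`: for `v, w ∈ E` and `x` near `q`, the number
`g_x(e_v, e_w)`, where `e_v` is the vector field with constant coordinates `v`. -/
def coordGram (g : RiemMetric E N) (q x : N) : E →L[ℝ] E →L[ℝ] ℝ :=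
  let s := (trivializationAt E (fun q : N => Tan E q) q).symmL ℝ x
  (ContinuousLinearMap.precomp ℝ s) ∘L (g.inner x) ∘L s

/-- The derivative at `q`, in the direction `z ∈ T_q N`, of `x ↦ g_x(e_v, e_w)`, where `e_v, e_w`
are the vector fields with constant coordinates in the chart at `q` and values `v, w` at `q`. -/
def dGram (g : RiemMetric E N) (q : N) (z v w : Tan E q) : ℝ :=
  let c := (trivializationAt E (fun q : N => Tan E q) q).continuousLinearMapAt ℝ q
  mvfderiv 𝓘(ℝ, E) (coordGram g q) q z (c v) (c w)

theorem dGram_add_right (g : RiemMetric E N) (q : N) (v w y z : Tan E q) :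
    dGram g q v w (y + z) = dGram g q v w y + dGram g q v w z := by
  unfold dGram
  dsimp only
  rw [map_add]
  exact ContinuousLinearMap.map_add _ _ _

theorem dGram_smul_right (g : RiemMetric E N) (q : N) (v w : Tan E q) (a : ℝ) (z : Tan E q) :
    dGram g q v w (a • z) = a * dGram g q v w z := by
  unfold dGram
  dsimp only
  rw [map_smul]
  exact ContinuousLinearMap.map_smul _ _ _

theorem dGram_add_left (g : RiemMetric E N) (q : N) (v w y z : Tan E q) :
    dGram g q (y + z) v w = dGram g q y v w + dGram g q z v w := by
  unfold dGram
  dsimp only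
  rw [ContinuousLinearMap.map_add]
  rfl

theorem dGram_smul_left (g : RiemMetric E N) (q : N) (v w : Tan E q) (a : ℝ) (z : Tan E q) :
    dGram g q (a • z) v w = a * dGram g q z v w := by
  unfold dGram
  dsimp only
  rw [ContinuousLinearMap.map_smul]
  rfl

/-- The functional `z ↦ 1/2 (v g(w,z) + w g(v,z) - z g(v,w))` of Christoffel symbols of the first
kind at `q`. -/
def christoffelForm (g : RiemMetric E N) (q : N) (v w : Tan E q) : Module.Dual ℝ (Tan E q) where
  toFun z := (1 / 2) * (dGram g q v w z + dGram g q w v z - dGram g q z v w)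
  map_add' y z := by rw [dGram_add_left, dGram_add_right, dGram_add_right]; ring
  map_smul' a z := by
    rw [dGram_smul_left, dGram_smul_right, dGram_smul_right, RingHom.id_apply, smul_eq_mul]; ring

/-- The Christoffel symbols `Γ_q(v,w) ∈ T_q N` of the second kind in the chart at `q`. -/
def christoffel (g : RiemMetric E N) (q : N) (v w : Tan E q) : Tan E q :=
  sharp (metricForm g q) (metricForm_pos g q) (christoffelForm g q v w)

/-- The covariant derivative `∇_k W` at `p`, for the Levi-Civita connection of `g` on `N`, of a
vector field `W x ∈ T_{f x} N` along a map `f : M → N`, in the direction `k ∈ T_p M`. In the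
coordinates of `N` around `f p` it is `dW(k) + Γ(df(k), W)`. -/
def covDerivAlong {F : Type*} [NormedAddCommGroup F] [NormedSpace ℂ F]
    {M : Type*} [TopologicalSpace M] [ChartedSpace F M]
    (g : RiemMetric E N) (f : M → N) (W : ∀ x : M, Tan E (f x)) (p : M) (k : Tan F p) :
    Tan E (f p) :=
  let e := trivializationAt E (fun q : N => Tan E q) (f p)
  e.symmL ℝ (f p) (mvfderiv 𝓘(ℝ, F) (fun x => (e ⟨f x, W x⟩).2) p k)
    + christoffel g (f p) (mfderiv 𝓘(ℝ, F) 𝓘(ℝ, E) f p k) (W p)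

/-- The Levi-Civita covariant derivative `∇_k L` of a vector field `L` on `N`. -/
def covDeriv (g : RiemMetric E N) (L : ∀ q : N, Tan E q) (q : N) (k : Tan E q) : Tan E q :=
  let e := trivializationAt E (fun q : N => Tan E q) q
  e.symmL ℝ q (mvfderiv 𝓘(ℝ, E) (fun x => (e ⟨x, L x⟩).2) q k) + christoffel g q k (L q)

/-- `(∇_K A) L = ∇_K (A L) - A (∇_K L)` for a `(1,1)` tensor field `A`. -/
def covDerivEndo (g : RiemMetric E N) (A : ∀ q : N, Tan E q →L[ℝ] Tan E q)
    (K L : ∀ q : N, Tan E q) (q : N) : Tan E q :=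
  covDeriv g (fun x => A x (L x)) q (K q) - A q (covDeriv g L q (K q))

/-- The Nijenhuis torsion
`[A,A](K,L) = (∇_{AK} A)L - (∇_{AL} A)K - A(∇_K A)L + A(∇_L A)K`. -/
def nijenhuis (g : RiemMetric E N) (A : ∀ q : N, Tan E q →L[ℝ] Tan E q)
    (K L : ∀ q : N, Tan E q) (q : N) : Tan E q :=
  covDerivEndo g A (fun x => A x (K x)) L q - covDerivEndo g A (fun x => A x (L x)) K q
    - A q (covDerivEndo g A K L q) + A q (covDerivEndo g A L K q)

end LeviCivita

/-! ### Normal complex contact metric manifolds -/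

section ComplexContact

/-- A complex almost contact metric structure on a complex manifold `N`: a Hermitian metric `g`, an
open cover by sets `dom i`, and on each `dom i` tensor fields `u, v, U, V, G, H` (their values
outside `dom i` are irrelevant). -/
structure ComplexAlmostContactMetric (E N : Type*) [NormedAddCommGroup E] [NormedSpace ℂ E]
    [TopologicalSpace N] [ChartedSpace E N] [IsManifold 𝓘(ℂ, E) ω N] (ι : Type*) where
  /-- The metric. -/
  g : RiemMetric E N
  hermitian : ∀ (q : N) (k l : Tan E q),
    g.inner q (cplxJ E q k) (cplxJ E q l) = g.inner q k l
  /-- The open sets of the cover. -/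
  dom : ι → Set N
  isOpen_dom : ∀ i, IsOpen (dom i)
  cover : ∀ q, ∃ i, q ∈ dom i
  /-- The `1`-forms `u_i`. -/
  u : ι → ∀ q : N, Tan E q →L[ℝ] ℝ
  /-- The `1`-forms `v_i`. -/
  v : ι → ∀ q : N, Tan E q →L[ℝ] ℝ
  /-- The vector fields `U_i`. -/
  U : ι → ∀ q : N, Tan E q
  /-- The vector fields `V_i`. -/
  V : ι → ∀ q : N, Tan E q
  /-- The `(1,1)` tensor fields `G_i`. -/
  G : ι → ∀ q : N, Tan E q →L[ℝ] Tan E q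
  /-- The `(1,1)` tensor fields `H_i`. -/
  H : ι → ∀ q : N, Tan E q →L[ℝ] Tan E q
  smooth_u : ∀ i, IsSmoothForm (u i) (dom i)
  smooth_v : ∀ i, IsSmoothForm (v i) (dom i)
  smooth_U : ∀ i, IsSmoothField (U i) (dom i)
  smooth_V : ∀ i, IsSmoothField (V i) (dom i)
  smooth_G : ∀ i, IsSmoothEndo (G i) (dom i)
  smooth_H : ∀ i, IsSmoothEndo (H i) (dom i)
  v_eq : ∀ i, ∀ q ∈ dom i, ∀ k, v i q k = u i q (cplxJ E q k)
  V_eq : ∀ i, ∀ q ∈ dom i, V i q = -cplxJ E q (U i q)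
  H_eq : ∀ i, ∀ q ∈ dom i, ∀ k, H i q k = G i q (cplxJ E q k)
  /-- `U_i` is dual to `u_i` (then `V_i` is dual to `v_i`). -/
  u_dual : ∀ i, ∀ q ∈ dom i, ∀ k, u i q k = g.inner q k (U i q)
  u_U : ∀ i, ∀ q ∈ dom i, u i q (U i q) = 1
  G_sq : ∀ i, ∀ q ∈ dom i, ∀ k,
    G i q (G i q k) = -k + u i q k • U i q + v i q k • V i q
  H_sq : ∀ i, ∀ q ∈ dom i, ∀ k,
    H i q (H i q k) = -k + u i q k • U i q + v i q k • V i q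
  G_J : ∀ i, ∀ q ∈ dom i, ∀ k, G i q (cplxJ E q k) = -cplxJ E q (G i q k)
  G_U : ∀ i, ∀ q ∈ dom i, G i q (U i q) = 0
  G_skew : ∀ i, ∀ q ∈ dom i, ∀ k l, g.inner q k (G i q l) = -g.inner q (G i q k) l
  overlap : ∀ i j, ∀ q ∈ dom i ∩ dom j, ∃ c d : ℝ, c ^ 2 + d ^ 2 = 1 ∧
    u j q = c • u i q - d • v i q ∧ v j q = d • u i q + c • v i q ∧
    G j q = c • G i q - d • H i q ∧ H j q = d • G i q + c • H i q

namespace ComplexAlmostContactMetric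

variable {E : Type*} [NormedAddCommGroup E] [NormedSpace ℂ E] [FiniteDimensional ℂ E]
  {N : Type*} [TopologicalSpace N] [ChartedSpace E N] [IsManifold 𝓘(ℂ, E) ω N] {ι : Type*}
  (S : ComplexAlmostContactMetric E N ι)

/-- `σ_i(k) = g(∇_k U_i, V_i)`. -/
def sigma (i : ι) (q : N) (k : Tan E q) : ℝ := S.g.inner q (covDeriv S.g (S.U i) q k) (S.V i q)

/-- The structure is a complex contact metric structure: on each `dom i`
`du(K,L) = g(K,GL) + (σ ∧ v)(K,L)` and `dv(K,L) = g(K,HL) - (σ ∧ u)(K,L)`. -/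
def IsContactMetric : Prop :=
  ∀ (i : ι) (W : Set N) (K L : ∀ q : N, Tan E q), IsOpen W → W ⊆ S.dom i →
    IsSmoothField K W → IsSmoothField L W → ∀ q ∈ W,
      extDer (S.u i) K L q
          = S.g.inner q (K q) (S.G i q (L q)) + wedge (S.sigma i q) (S.v i q) (K q) (L q) ∧
      extDer (S.v i) K L q
          = S.g.inner q (K q) (S.H i q (L q)) - wedge (S.sigma i q) (S.u i q) (K q) (L q)

/-- The horizontal space `ℋ_q`, the common kernel of the forms `u_i, v_i` (which does not depend
on the index `i` with `q ∈ dom i`). -/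
def horizontal (q : N) : Submodule ℝ (Tan E q) :=
  ⨅ (i : ι) (_ : q ∈ S.dom i), (S.u i q).ker ⊓ (S.v i q).ker

/-- The vertical space `sp{U_i, V_i}` at `q` (which does not depend on the index `i` with
`q ∈ dom i`). -/
def vertical (q : N) : Submodule ℝ (Tan E q) :=
  ⨅ (i : ι) (_ : q ∈ S.dom i), Submodule.span ℝ {S.U i q, S.V i q}

/-- The tensor `S` of Ishihara and Konishi. -/
def tensorS (i : ι) (K L : ∀ q : N, Tan E q) (q : N) : Tan E q :=
  nijenhuis S.g (S.G i) K L q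
    + (2 * S.g.inner q (K q) (S.G i q (L q))) • S.U i q
    - (2 * S.g.inner q (K q) (S.H i q (L q))) • S.V i q
    + (2 : ℝ) • (S.v i q (L q) • S.H i q (K q) - S.v i q (K q) • S.H i q (L q))
    + S.sigma i q (S.G i q (L q)) • S.H i q (K q)
    - S.sigma i q (S.G i q (K q)) • S.H i q (L q)
    + S.sigma i q (K q) • S.G i q (S.H i q (L q))
    - S.sigma i q (L q) • S.G i q (S.H i q (K q))

/-- The tensor `T` of Ishihara and Konishi. -/
def tensorT (i : ι) (K L : ∀ q : N, Tan E q) (q : N) : Tan E q :=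
  nijenhuis S.g (S.H i) K L q
    - (2 * S.g.inner q (K q) (S.G i q (L q))) • S.U i q
    + (2 * S.g.inner q (K q) (S.H i q (L q))) • S.V i q
    + (2 : ℝ) • (S.u i q (L q) • S.G i q (K q) - S.u i q (K q) • S.G i q (L q))
    + S.sigma i q (S.H i q (K q)) • S.G i q (L q)
    - S.sigma i q (S.H i q (L q)) • S.G i q (K q)
    + S.sigma i q (K q) • S.G i q (S.H i q (L q))
    - S.sigma i q (L q) • S.G i q (S.H i q (K q))

/-- Normality in the sense of Korkmaz: `S(K,L) = T(K,L) = 0` for horizontal `K, L`, and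
`S(K,U) = T(K,V) = 0` for all `K`. -/
def IsNormal : Prop :=
  ∀ (i : ι) (W : Set N), IsOpen W → W ⊆ S.dom i →
    (∀ K L : ∀ q : N, Tan E q, IsSmoothField K W → IsSmoothField L W →
      (∀ q ∈ W, K q ∈ S.horizontal q) → (∀ q ∈ W, L q ∈ S.horizontal q) →
      ∀ q ∈ W, S.tensorS i K L q = 0 ∧ S.tensorT i K L q = 0) ∧
    (∀ K : ∀ q : N, Tan E q, IsSmoothField K W →
      ∀ q ∈ W, S.tensorS i K (S.U i) q = 0 ∧ S.tensorT i K (S.V i) q = 0)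

end ComplexAlmostContactMetric

end ComplexContact

/-! ### Complex submanifolds -/

section Submanifold

/-- A complex submanifold `M` of `N`, given by a holomorphic immersion `M → N`. -/
structure ComplexSubmanifold (F M E N : Type*)
    [NormedAddCommGroup F] [NormedSpace ℂ F] [TopologicalSpace M] [ChartedSpace F M]
    [NormedAddCommGroup E] [NormedSpace ℂ E] [TopologicalSpace N] [ChartedSpace E N] where
  /-- The immersion. -/
  toFun : M → N
  holomorphic : ContMDiff 𝓘(ℂ, F) 𝓘(ℂ, E) ω toFun
  injective_mfderiv : ∀ p, Function.Injective (mfderiv 𝓘(ℝ, F) 𝓘(ℝ, E) toFun p)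

namespace ComplexSubmanifold

variable {F : Type*} [NormedAddCommGroup F] [NormedSpace ℂ F] [FiniteDimensional ℂ F]
  {M : Type*} [TopologicalSpace M] [ChartedSpace F M]
  {E : Type*} [NormedAddCommGroup E] [NormedSpace ℂ E] [FiniteDimensional ℂ E]
  {N : Type*} [TopologicalSpace N] [ChartedSpace E N] [IsManifold 𝓘(ℂ, E) ω N] {ι : Type*}
  (f : ComplexSubmanifold F M E N)

/-- The differential `T_p M → T_{f p} N`, by which `T_p M` is regarded as a subspace. -/
def d (p : M) : Tan F p →L[ℝ] Tan E (f.toFun p) := mfderiv 𝓘(ℝ, F) 𝓘(ℝ, E) f.toFun p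

/-- The metric induced on `M`, at the point `p`. -/
def inducedForm (g : RiemMetric E N) (p : M) : Tan F p →ₗ[ℝ] Module.Dual ℝ (Tan F p) :=
  (metricForm g (f.toFun p)).compl₁₂ (f.d p : Tan F p →ₗ[ℝ] _) (f.d p : Tan F p →ₗ[ℝ] _)

theorem inducedForm_pos (g : RiemMetric E N) (p : M) (v : Tan F p) (hv : v ≠ 0) :
    0 < f.inducedForm g p v v :=
  g.pos _ _ fun h => hv (f.injective_mfderiv p (h.trans (map_zero (f.d p)).symm))

/-- The tangential part of `w ∈ T_{f p} N`: the unique `k ∈ T_p M` such that `w - df(k)` is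
orthogonal to `T_p M`. -/
def tangentPart (g : RiemMetric E N) (p : M) (w : Tan E (f.toFun p)) : Tan F p :=
  sharp (f.inducedForm g p) (f.inducedForm_pos g p)
    ((metricForm g (f.toFun p) w).comp (f.d p : Tan F p →ₗ[ℝ] _))

/-- The normal part of `w ∈ T_{f p} N`. -/
def normalPart (g : RiemMetric E N) (p : M) (w : Tan E (f.toFun p)) : Tan E (f.toFun p) :=
  w - f.d p (f.tangentPart g p w)

theorem normalPart_orthogonal (g : RiemMetric E N) (p : M) (w : Tan E (f.toFun p)) (z : Tan F p) :
    g.inner _ (f.normalPart g p w) (f.d p z) = 0 := by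
  have h := sharp_spec (f.inducedForm g p) (f.inducedForm_pos g p)
    ((metricForm g (f.toFun p) w).comp (f.d p : Tan F p →ₗ[ℝ] _)) z
  have h' : g.inner _ (f.d p (f.tangentPart g p w)) (f.d p z) = g.inner _ w (f.d p z) := h
  simp [normalPart, h']

/-- The second fundamental form, by the Gauss formula: for vector fields `K, L` on `M`,
`h(K,L)` is the normal part of the ambient covariant derivative of `L` along `K`. -/
def secondFundamentalForm (g : RiemMetric E N) (K L : ∀ x : M, Tan F x) (p : M) :
    Tan E (f.toFun p) :=
  f.normalPart g p (covDerivAlong g f.toFun (fun x => f.d x (L x)) p (K p))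

variable (S : ComplexAlmostContactMetric E N ι)

/-- `P k`, the tangential part of `G_i k` for `k ∈ T_p M`. -/
def P (i : ι) (p : M) (k : Tan F p) : Tan F p :=
  f.tangentPart S.g p (S.G i (f.toFun p) (f.d p k))

/-- `Q k`, the normal part of `G_i k` for `k ∈ T_p M`. -/
def Q (i : ι) (p : M) (k : Tan F p) : Tan E (f.toFun p) :=
  f.normalPart S.g p (S.G i (f.toFun p) (f.d p k))

/-- `G_i k = P k + Q k`. -/
theorem P_add_Q (i : ι) (p : M) (k : Tan F p) :
    f.d p (f.P S i p k) + f.Q S i p k = S.G i (f.toFun p) (f.d p k) := by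
  simp [P, Q, normalPart]

theorem tangentPart_add (g : RiemMetric E N) (p : M) (w w' : Tan E (f.toFun p)) :
    f.tangentPart g p (w + w') = f.tangentPart g p w + f.tangentPart g p w' := by
  simp [tangentPart, LinearMap.add_comp]

theorem tangentPart_smul (g : RiemMetric E N) (p : M) (a : ℝ) (w : Tan E (f.toFun p)) :
    f.tangentPart g p (a • w) = a • f.tangentPart g p w := by
  simp [tangentPart, LinearMap.smul_comp]

/-- The vector fields `U_i, V_i` are tangent to `M`. -/
def TangentUV : Prop :=
  ∀ (p : M) (i : ι), f.toFun p ∈ S.dom i →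
    S.U i (f.toFun p) ∈ Set.range (f.d p) ∧ S.V i (f.toFun p) ∈ Set.range (f.d p)

/-- The distribution `sp{U,V}` on `M`. -/
def spUV (p : M) : Submodule ℝ (Tan F p) :=
  (S.vertical (f.toFun p)).comap (f.d p : Tan F p →ₗ[ℝ] Tan E (f.toFun p))

/-- The orthogonal complement of `sp{U,V}` in `T_p M`, that is, `T_p M ∩ ℋ`. -/
def spUVperp (p : M) : Submodule ℝ (Tan F p) :=
  (S.horizontal (f.toFun p)).comap (f.d p : Tan F p →ₗ[ℝ] Tan E (f.toFun p))

/-- The distribution `D_p = {k ∈ sp{U,V}^⊥ : Q k = 0}`; it does not depend on the index `i`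
defining `Q`. -/
def D (p : M) : Submodule ℝ (Tan F p) where
  carrier := {k | k ∈ f.spUVperp S p ∧ ∀ i, f.toFun p ∈ S.dom i → f.Q S i p k = 0}
  zero_mem' := ⟨zero_mem _, fun i _ => by
    have := f.tangentPart_smul S.g p 0 0
    simp only [zero_smul] at this
    simp [Q, normalPart, this]⟩
  add_mem' := fun {a b} ha hb => ⟨add_mem ha.1 hb.1, fun i hi => by
    have h1 := ha.2 i hi
    have h2 := hb.2 i hi
    simp only [Q, normalPart, map_add, tangentPart_add] at h1 h2 ⊢
    rw [add_sub_add_comm, h1, h2, add_zero]⟩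
  smul_mem' := fun c a ha => ⟨Submodule.smul_mem _ c ha.1, fun i hi => by
    have h1 := ha.2 i hi
    simp only [Q, normalPart, map_smul, tangentPart_smul] at h1 ⊢
    rw [← smul_sub, h1, smul_zero]⟩

/-- The distribution `D^⊥_p = {k ∈ sp{U,V}^⊥ : P k = 0}`; it does not depend on the index `i`
defining `P`. -/
def Dperp (p : M) : Submodule ℝ (Tan F p) where
  carrier := {k | k ∈ f.spUVperp S p ∧ ∀ i, f.toFun p ∈ S.dom i → f.P S i p k = 0}
  zero_mem' := ⟨zero_mem _, fun i _ => by
    have := f.tangentPart_smul S.g p 0 0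
    simp only [zero_smul] at this
    simp [P, this]⟩
  add_mem' := fun {a b} ha hb => ⟨add_mem ha.1 hb.1, fun i hi => by
    have h1 := ha.2 i hi
    have h2 := hb.2 i hi
    simp only [P, map_add, tangentPart_add] at h1 h2 ⊢
    rw [h1, h2, add_zero]⟩
  smul_mem' := fun c a ha => ⟨Submodule.smul_mem _ c ha.1, fun i hi => by
    have h1 := ha.2 i hi
    simp only [P, map_smul, tangentPart_smul] at h1 ⊢
    rw [h1, smul_zero]⟩

/-- On `D` the operator `P` is `G_i` itself. -/
theorem d_P_of_mem_D {p : M} {k : Tan F p} (hk : k ∈ f.D S p) {i : ι}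
    (hi : f.toFun p ∈ S.dom i) : f.d p (f.P S i p k) = S.G i (f.toFun p) (f.d p k) := by
  have h := f.P_add_Q S i p k
  rwa [hk.2 i hi, add_zero] at h

/-- `M` is a semi-invariant submanifold: `U, V` are tangent to `M`, and `D`, `D^⊥` are
differentiable distributions of constant dimension. -/
structure IsSemiInvariant [IsManifold 𝓘(ℂ, F) ω M] : Prop where
  tangentUV : f.TangentUV S
  dim_D : ∃ n, ∀ p, Module.finrank ℝ (f.D S p) = n
  dim_Dperp : ∃ n, ∀ p, Module.finrank ℝ (f.Dperp S p) = n
  smooth_D : IsSmoothDistribution (f.D S)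
  smooth_Dperp : IsSmoothDistribution (f.Dperp S)

end ComplexSubmanifold

end Submanifold

end

/-! A tangent vector w of M lies in D ⊕ sp{U,V} exactly when Gw is tangent to M
(`TangentUV.mem_sup_iff`), so involutivity asks that the normal part of G[K,L] vanish for all
sections K, L. If GL is tangent, then GL = PL, and the Leibniz rule together with the Gauss formula
gives nor G(∇_K L) = h(K, PL) - nor (∇_K G)L =: B(K,L), which depends only on the values of K and L
at the point (`structForm`). Since ∇ is torsion free, nor G[K,L] = B(K,L) - B(L,K)
(`normalProj_G_mlieBracket`), and it remains to evaluate B.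

This rests on two consequences of the contact and normality conditions: ∇_x U = -Gx + σ(x)V
(`IsSemiNormal.nablaU_eq`), and (∇_x G)y = σ(x)Hy modulo U, V for y horizontal and x horizontal or
equal to U (`IsSemiNormal.inner_nablaG`, `IsSemiNormal.inner_nablaG_U_left`). Both combine the
vanishing of S with the identity d(du) = 0, which the contact equations turn into a formula for the
cyclic sum of g(y, (∇_x G)z) (`nablaG_cyclic`). What is left is pointwise linear algebra
(`nabla_characteristic_aux`, `nabla_structure_aux`).

As M is complex and H = -JG, the vector Hw is tangent exactly when Gw is. Hence the correction term
drops out on D, where B(K,L) = h(K, PL), and the symmetry of h turns B(K,L) - B(L,K) into h(K, GL) -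
h(GK, L). This settles brackets of sections of D. The vertical directions impose no condition:
B(k,U) = 0 always, B(U,k) = 0 for k in D by the formula for ∇U, and B(U,V) = 0. For V, the structure
is replaced by (v, -u, V, -U, H, -G) (`rot`): this keeps σ, turns S into T, and puts V in the place
of U. -/

noncomputable section

/-! ### Fields along a map in coordinates; metric compatibility of the Levi-Civita connection -/

section Calculus

variable {F : Type*} [NormedAddCommGroup F] [NormedSpace ℂ F]
  {M : Type*} [TopologicalSpace M] [ChartedSpace F M]
  {E : Type*} [NormedAddCommGroup E] [NormedSpace ℂ E]
  {N : Type*} [TopologicalSpace N] [ChartedSpace E N] [IsManifold 𝓘(ℂ, E) ω N]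

instance instIsManifoldRealOfLe (n : ℕ∞ω) : IsManifold 𝓘(ℝ, E) n N :=
  IsManifold.of_le (n := ω) le_top

/-- Differentiability at `p` of a vector field along a map. -/
def DiffAlong (F : Type*) [NormedAddCommGroup F] [NormedSpace ℂ F]
    {M : Type*} [TopologicalSpace M] [ChartedSpace F M] (φ : M → N) (W : ∀ x : M, Tan E (φ x)) (p : M) : Prop :=
  MDifferentiableAt 𝓘(ℝ, F) 𝓘(ℝ, E).tangent
    (fun x => (⟨φ x, W x⟩ : TangentBundle 𝓘(ℝ, E) N)) p

/-- The coordinates of a vector field along `φ` in the chart of `N` at `φ p`. -/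
def coordAlong (φ : M → N) (W : ∀ x : M, Tan E (φ x)) (p x : M) : E :=
  (trivializationAt E (fun q : N => Tan E q) (φ p) ⟨φ x, W x⟩).2

/-- The derivative at `p` of the coordinates of a vector field along `φ`. -/
def dCoord (F : Type*) [NormedAddCommGroup F] [NormedSpace ℂ F]
    {M : Type*} [TopologicalSpace M] [ChartedSpace F M] (φ : M → N) (W : ∀ x : M, Tan E (φ x)) (p : M) : Tan F p →L[ℝ] Tan E (φ p) :=
  mvfderiv 𝓘(ℝ, F) (coordAlong φ W p) p

/-- The derivative at q of the preferred chart at q is the identity. This removes the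
trivializations from every formula evaluated at the base point. -/
theorem trivAt_symmL_self (q : N) (v : E) :
    (trivializationAt E (fun q : N => Tan E q) q).symmL ℝ q v = v := by
  rw [TangentBundle.symmL_trivializationAt (mem_chart_source E q),
    mfderivWithin_range_extChartAt_symm]
  rfl

theorem trivAt_continuousLinearMapAt_self (q : N) (v : Tan E q) :
    (trivializationAt E (fun q : N => Tan E q) q).continuousLinearMapAt ℝ q v = v := by
  rw [TangentBundle.continuousLinearMapAt_trivializationAt (mem_chart_source E q),
    mfderiv_extChartAt_self]
  rfl

theorem trivAt_apply_self (q : N) (v : Tan E q) :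
    (trivializationAt E (fun q : N => Tan E q) q ⟨q, v⟩).2 = v := by
  have h := trivAt_continuousLinearMapAt_self q v
  rwa [Trivialization.continuousLinearMapAt_apply, Trivialization.linearMapAt_apply,
    if_pos (FiberBundle.mem_baseSet_trivializationAt' q)] at h

theorem coordAlong_self (φ : M → N) (W : ∀ x : M, Tan E (φ x)) (p : M) :
    coordAlong φ W p p = W p := trivAt_apply_self _ _

theorem DiffAlong.mdifferentiableAt_base {φ : M → N} {W : ∀ x : M, Tan E (φ x)} {p : M}
    (h : DiffAlong F φ W p) : MDifferentiableAt 𝓘(ℝ, F) 𝓘(ℝ, E) φ p :=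
  ((mdifferentiableAt_totalSpace _ _).1 h).1

theorem DiffAlong.mdifferentiableAt_coord {φ : M → N} {W : ∀ x : M, Tan E (φ x)} {p : M}
    (h : DiffAlong F φ W p) : MDifferentiableAt 𝓘(ℝ, F) 𝓘(ℝ, E) (coordAlong φ W p) p :=
  ((mdifferentiableAt_totalSpace _ _).1 h).2

theorem diffAlong_iff {φ : M → N} {W : ∀ x : M, Tan E (φ x)} {p : M} :
    DiffAlong F φ W p ↔ MDifferentiableAt 𝓘(ℝ, F) 𝓘(ℝ, E) φ p ∧
      MDifferentiableAt 𝓘(ℝ, F) 𝓘(ℝ, E) (coordAlong φ W p) p :=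
  mdifferentiableAt_totalSpace _ _

theorem IsSmoothField.contMDiffAt {K : ∀ q : N, Tan E q} {W : Set N} (hK : IsSmoothField K W)
    (hW : IsOpen W) {q : N} (hq : q ∈ W) : ContMDiffAt 𝓘(ℝ, E) 𝓘(ℝ, E).tangent ∞
      (fun q => (⟨q, K q⟩ : TangentBundle 𝓘(ℝ, E) N)) q :=
  ContMDiffOn.contMDiffAt hK (hW.mem_nhds hq)

theorem IsSmoothField.diffAlong {K : ∀ q : N, Tan E q} {W : Set N} (hK : IsSmoothField K W)
    (hW : IsOpen W) {q : N} (hq : q ∈ W) : DiffAlong E (fun x => x) K q :=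
  (hK.contMDiffAt hW hq).mdifferentiableAt (by simp)

theorem mvfderiv_congr {G' : Type*} [NormedAddCommGroup G'] [NormedSpace ℝ G'] {a b : M → G'}
    {p : M} (h : a =ᶠ[𝓝 p] b) : mvfderiv 𝓘(ℝ, F) a p = mvfderiv 𝓘(ℝ, F) b p := by
  unfold mvfderiv
  rw [h.mfderiv_eq, h.self_of_nhds]

theorem coordAlong_congr {φ : M → N} {W W' : ∀ x : M, Tan E (φ x)} {p : M}
    (h : ∀ᶠ x in 𝓝 p, W x = W' x) : coordAlong φ W p =ᶠ[𝓝 p] coordAlong φ W' p := by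
  filter_upwards [h] with x hx
  simp [coordAlong, hx]

theorem dCoord_congr {φ : M → N} {W W' : ∀ x : M, Tan E (φ x)} {p : M}
    (h : ∀ᶠ x in 𝓝 p, W x = W' x) : dCoord F φ W p = dCoord F φ W' p :=
  mvfderiv_congr (coordAlong_congr h)

theorem DiffAlong.congr {φ : M → N} {W W' : ∀ x : M, Tan E (φ x)} {p : M}
    (hW : DiffAlong F φ W p) (h : ∀ᶠ x in 𝓝 p, W x = W' x) : DiffAlong F φ W' p := by
  refine MDifferentiableAt.congr_of_eventuallyEq hW ?_
  filter_upwards [h] with x hx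
  rw [hx]

/-- The trivialization is linear only over its base set, so continuity of φ is needed to stay in it
near p. The lemma serves to differentiate the zero field. -/
theorem dCoord_neg (φ : M → N) (W : ∀ x : M, Tan E (φ x)) (p : M)
    (hφ : ContinuousAt φ p) :
    dCoord F φ (fun x => -W x) p = -dCoord F φ W p := by
  have : coordAlong φ (fun x => -W x) p =ᶠ[𝓝 p] -coordAlong φ W p := by
    have h1 : φ ⁻¹' (trivializationAt E (fun q : N => Tan E q) (φ p)).baseSet ∈ 𝓝 p :=
      hφ ((Trivialization.open_baseSet _).mem_nhds (FiberBundle.mem_baseSet_trivializationAt' _))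
    filter_upwards [h1] with x hx
    exact ((trivializationAt E (fun q : N => Tan E q) (φ p)).linear ℝ hx).map_neg (W x)
  unfold dCoord
  rw [mvfderiv_congr this, mvfderiv_neg]
  rfl

variable [FiniteDimensional ℂ E]

theorem christoffel_spec (g : RiemMetric E N) (q : N) (v w z : Tan E q) :
    g.inner q (christoffel g q v w) z
      = (1 / 2) * (dGram g q v w z + dGram g q w v z - dGram g q z v w) :=
  sharp_spec (metricForm g q) (metricForm_pos g q) (christoffelForm g q v w) z

theorem metric_ext (g : RiemMetric E N) {q : N} {v w : Tan E q}
    (h : ∀ z, g.inner q v z = g.inner q w z) : v = w := by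
  by_contra hne
  have h1 := g.pos q (v - w) (sub_ne_zero.2 hne)
  have h2 : g.inner q (v - w) = g.inner q v - g.inner q w := map_sub _ _ _
  have h3 : g.inner q (v - w) (v - w) = g.inner q v (v - w) - g.inner q w (v - w) := by
    rw [h2]; rfl
  rw [h3, h, sub_self] at h1
  exact lt_irrefl _ h1

theorem coordGram_symm (g : RiemMetric E N) (q x : N) (v w : E) :
    coordGram g q x v w = coordGram g q x w v := by
  simp only [coordGram, ContinuousLinearMap.comp_apply]
  exact g.symm _ _ _

theorem dGram_add_mid (g : RiemMetric E N) (q : N) (v w y z : Tan E q) :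
    dGram g q y (v + w) z = dGram g q y v z + dGram g q y w z := by
  unfold dGram
  dsimp only
  rw [map_add, map_add]
  rfl

theorem dGram_smul_mid (g : RiemMetric E N) (q : N) (y v z : Tan E q) (a : ℝ) :
    dGram g q y (a • v) z = a * dGram g q y v z := by
  unfold dGram
  dsimp only
  rw [map_smul, map_smul]
  rfl

/-- The metric in the chart at `q` is differentiable at `q`. -/
theorem mdifferentiableAt_coordGram (g : RiemMetric E N) (q : N) :
    MDifferentiableAt 𝓘(ℝ, E) 𝓘(ℝ, E →L[ℝ] E →L[ℝ] ℝ) (coordGram g q) q := by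
  have h := (g.contMDiff q).mdifferentiableAt (by simp)
  rw [mdifferentiableAt_hom_bundle] at h
  refine h.2.congr_of_eventuallyEq ?_
  have h1 : (trivializationAt E (fun q : N => Tan E q) q).baseSet ∈ 𝓝 q :=
    (Trivialization.open_baseSet _).mem_nhds (FiberBundle.mem_baseSet_trivializationAt' _)
  filter_upwards [h1] with x hx
  -- The metric read in bundle coordinates is, over the base set, the Gram form defined by hand.
  ext v w
  have := inCoordinates_apply_eq₂ (𝕜 := ℝ) (x₀ := q) (F₁ := E) (F₂ := E) (F₃ := ℝ)
    (E₁ := fun q : N => Tan E q) (E₂ := fun q : N => Tan E q) (E₃ := Bundle.Trivial N ℝ)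
    (ϕ := g.inner x) (v := v) (w := w) hx hx (by simp)
  refine Eq.trans ?_ this.symm
  simp [coordGram, Trivialization.symmL_apply (hb := hx)]

theorem _root_.MDifferentiableAt.differentiableAt_symm {G' : Type*} [NormedAddCommGroup G']
    [NormedSpace ℝ G'] {a : M → G'} {p : M} (h : MDifferentiableAt 𝓘(ℝ, F) 𝓘(ℝ, G') a p) :
    DifferentiableAt ℝ (a ∘ (extChartAt 𝓘(ℝ, F) p).symm) (extChartAt 𝓘(ℝ, F) p p) := by
  have h1 : DifferentiableWithinAt ℝ (a ∘ (extChartAt 𝓘(ℝ, F) p).symm)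
    (Set.range 𝓘(ℝ, F)) (extChartAt 𝓘(ℝ, F) p p) := h.differentiableWithinAt_writtenInExtChartAt
  rwa [ModelWithCorners.range_eq_univ, differentiableWithinAt_univ] at h1

theorem mvfderiv_eq_fderiv {G' : Type*} [NormedAddCommGroup G']
    [NormedSpace ℝ G'] {a : M → G'} {p : M} (h : MDifferentiableAt 𝓘(ℝ, F) 𝓘(ℝ, G') a p) :
    mvfderiv 𝓘(ℝ, F) a p
      = fderiv ℝ (a ∘ (extChartAt 𝓘(ℝ, F) p).symm) (extChartAt 𝓘(ℝ, F) p p) := by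
  have h1 : mvfderiv 𝓘(ℝ, F) a p = fderivWithin ℝ (a ∘ (extChartAt 𝓘(ℝ, F) p).symm)
    (Set.range 𝓘(ℝ, F)) (extChartAt 𝓘(ℝ, F) p p) := h.mvfderiv
  rwa [ModelWithCorners.range_eq_univ, fderivWithin_univ] at h1

/-- The one product rule behind the rest: the metric, a (1,1) tensor and df all become
operator-valued functions applied to coordinate vectors. -/
theorem mvfderiv_clm_apply {G' H' : Type*} [NormedAddCommGroup G'] [NormedSpace ℝ G']
    [NormedAddCommGroup H'] [NormedSpace ℝ H'] {A : M → G' →L[ℝ] H'} {b : M → G'} {p : M}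
    (hA : MDifferentiableAt 𝓘(ℝ, F) 𝓘(ℝ, G' →L[ℝ] H') A p)
    (hb : MDifferentiableAt 𝓘(ℝ, F) 𝓘(ℝ, G') b p) (k : Tan F p) :
    mvfderiv 𝓘(ℝ, F) (fun x => A x (b x)) p k
      = mvfderiv 𝓘(ℝ, F) A p k (b p) + A p (mvfderiv 𝓘(ℝ, F) b p k) := by
  rw [mvfderiv_eq_fderiv hA, mvfderiv_eq_fderiv hb, mvfderiv_eq_fderiv (hA.clm_apply hb)]
  have h1 := congrArg (fun T : F →L[ℝ] H' => T k)
    (fderiv_clm_apply hA.differentiableAt_symm hb.differentiableAt_symm)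
  refine h1.trans ((add_comm _ _).trans ?_)
  have h2 : (extChartAt 𝓘(ℝ, F) p).symm (extChartAt 𝓘(ℝ, F) p p) = p := extChartAt_to_inv p
  refine congrArg₂ (· + ·) ?_ ?_
  · exact congrArg (fun y => (fderiv ℝ (A ∘ (extChartAt 𝓘(ℝ, F) p).symm)
      (extChartAt 𝓘(ℝ, F) p p) : F →L[ℝ] G' →L[ℝ] H') k (b y)) h2
  · exact congrArg (fun y => A y ((fderiv ℝ (b ∘ (extChartAt 𝓘(ℝ, F) p).symm)
      (extChartAt 𝓘(ℝ, F) p p) : F →L[ℝ] G') k)) h2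

/-- The derivative of `g(W, Z)` along a map, in coordinates. -/
theorem mvfderiv_metric_coord (g : RiemMetric E N) {φ : M → N} {W Z : ∀ x : M, Tan E (φ x)} {p : M}
    (hW : DiffAlong F φ W p) (hZ : DiffAlong F φ Z p) (k : Tan F p) :
    mvfderiv 𝓘(ℝ, F) (fun x => g.inner (φ x) (W x) (Z x)) p k
      = dGram g (φ p) (mfderiv 𝓘(ℝ, F) 𝓘(ℝ, E) φ p k) (W p) (Z p)
        + g.inner (φ p) (dCoord F φ W p k) (Z p) + g.inner (φ p) (W p) (dCoord F φ Z p k) := by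
  have hφ := hW.mdifferentiableAt_base
  have hb : φ ⁻¹' (trivializationAt E (fun q : N => Tan E q) (φ p)).baseSet ∈ 𝓝 p :=
    hφ.continuousAt ((Trivialization.open_baseSet _).mem_nhds
      (FiberBundle.mem_baseSet_trivializationAt' _))
  have hG : MDifferentiableAt 𝓘(ℝ, F) 𝓘(ℝ, E →L[ℝ] E →L[ℝ] ℝ)
      (coordGram g (φ p) ∘ φ) p := (mdifferentiableAt_coordGram g (φ p)).comp p hφ
  have h1 : (fun x => g.inner (φ x) (W x) (Z x)) =ᶠ[𝓝 p]
      fun x => (coordGram g (φ p) ∘ φ) x (coordAlong φ W p x) (coordAlong φ Z p x) := by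
    filter_upwards [hb] with x hx
    have hs : ∀ v : Tan E (φ x), (trivializationAt E (fun q : N => Tan E q) (φ p)).symmL ℝ (φ x)
        (trivializationAt E (fun q : N => Tan E q) (φ p) ⟨φ x, v⟩).2 = v := fun v =>
      (Trivialization.symmL_apply (hb := hx) ..).trans
        ((trivializationAt E (fun q : N => Tan E q) (φ p)).symm_proj_apply ⟨φ x, v⟩ hx)
    change _ = g.inner (φ x) ((trivializationAt E (fun q : N => Tan E q) (φ p)).symmL ℝ (φ x) _)
      ((trivializationAt E (fun q : N => Tan E q) (φ p)).symmL ℝ (φ x) _)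
    rw [coordAlong, coordAlong, hs, hs]
  rw [mvfderiv_congr h1, mvfderiv_clm_apply (hG.clm_apply hW.mdifferentiableAt_coord)
    hZ.mdifferentiableAt_coord, mvfderiv_clm_apply hG hW.mdifferentiableAt_coord,
    coordAlong_self, coordAlong_self]
  -- At the base point itself the Gram form is the metric, because the chart there is the identity
  -- on vectors.
  have hself : ∀ v w : E, coordGram g (φ p) (φ p) v w = g.inner (φ p) v w := fun v w =>
    congrArg₂ (fun a b : Tan E (φ p) => g.inner (φ p) a b)
      (trivAt_symmL_self (φ p) v) (trivAt_symmL_self (φ p) w)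
  have hd : mvfderiv 𝓘(ℝ, F) (coordGram g (φ p) ∘ φ) p k (W p) (Z p)
      = dGram g (φ p) (mfderiv 𝓘(ℝ, F) 𝓘(ℝ, E) φ p k) (W p) (Z p) := by
    unfold dGram
    dsimp only
    rw [trivAt_continuousLinearMapAt_self, trivAt_continuousLinearMapAt_self]
    have := mfderiv_comp_apply p (mdifferentiableAt_coordGram g (φ p)) hφ k
    exact congrArg (fun T : E →L[ℝ] E →L[ℝ] ℝ => T (W p) (Z p)) this
  refine congrArg₂ (· + ·) (congrArg₂ (· + ·) hd ?_) ?_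
  · exact hself _ _
  · exact hself _ _

theorem dGram_symm (g : RiemMetric E N) (q : N) (z v w : Tan E q) :
    dGram g q z v w = dGram g q z w v := by
  have hG := mdifferentiableAt_coordGram g q
  have hc : ∀ v : E, MDifferentiableAt 𝓘(ℝ, E) 𝓘(ℝ, E) (fun _ : N => v) q :=
    fun v => mdifferentiableAt_const
  -- Constant vectors have zero derivative, so the derivative passes inside the evaluation, where
  -- symmetry of the Gram form applies.
  have key : ∀ v w : E, mvfderiv 𝓘(ℝ, E) (coordGram g q) q z v w
      = mvfderiv 𝓘(ℝ, E) (fun x => coordGram g q x v w) q z := by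
    intro v w
    rw [mvfderiv_clm_apply (A := fun x => coordGram g q x v) (hG.clm_apply (hc v)) (hc w),
      mvfderiv_clm_apply hG (hc v), mvfderiv_const, mvfderiv_const]
    simp
  unfold dGram
  dsimp only
  rw [trivAt_continuousLinearMapAt_self, trivAt_continuousLinearMapAt_self]
  refine (key v w).trans (Eq.trans ?_ (key w v).symm)
  simp_rw [coordGram_symm g q _ v w]

/-- Symmetry of the Christoffel symbols is half of torsion-freeness; it also carries linearity from
the first slot to the second. -/
theorem christoffel_symm (g : RiemMetric E N) (q : N) (v w : Tan E q) :
    christoffel g q v w = christoffel g q w v := by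
  refine metric_ext g fun z => ?_
  rw [christoffel_spec, christoffel_spec, dGram_symm g q z v w]
  ring

theorem christoffel_add_left (g : RiemMetric E N) (q : N) (v w y : Tan E q) :
    christoffel g q (v + w) y = christoffel g q v y + christoffel g q w y := by
  refine metric_ext g fun z => ?_
  have h : ∀ a b : Tan E q, g.inner q (a + b) z = g.inner q a z + g.inner q b z := fun a b => by
    rw [map_add]; rfl
  rw [h, christoffel_spec, christoffel_spec, christoffel_spec, dGram_add_left, dGram_add_mid,
    dGram_symm g q z (v + w), dGram_add_right, dGram_symm g q z y, dGram_symm g q z y]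
  ring

theorem christoffel_smul_left (g : RiemMetric E N) (q : N) (a : ℝ) (v y : Tan E q) :
    christoffel g q (a • v) y = a • christoffel g q v y := by
  refine metric_ext g fun z => ?_
  have h : ∀ b : Tan E q, g.inner q (a • b) z = a * g.inner q b z := fun b => by
    rw [map_smul]; rfl
  rw [h, christoffel_spec, christoffel_spec, dGram_smul_left, dGram_smul_mid,
    dGram_symm g q z (a • v), dGram_smul_right, dGram_symm g q z y]
  ring

/-- The Christoffel symbols at `q` as a bilinear map. -/
def christoffelBilin (g : RiemMetric E N) (q : N) : Tan E q →ₗ[ℝ] Tan E q →ₗ[ℝ] Tan E q :=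
  LinearMap.mk₂ ℝ (christoffel g q) (christoffel_add_left g q) (christoffel_smul_left g q)
    (fun v w y => by
      rw [christoffel_symm, christoffel_add_left, christoffel_symm g q w, christoffel_symm g q y])
    (fun a v w => by rw [christoffel_symm, christoffel_smul_left, christoffel_symm g q w])

theorem covDerivAlong_eq (g : RiemMetric E N) (φ : M → N) (W : ∀ x : M, Tan E (φ x)) (p : M)
    (k : Tan F p) : covDerivAlong g φ W p k
      = dCoord F φ W p k + christoffelBilin g (φ p) (mfderiv 𝓘(ℝ, F) 𝓘(ℝ, E) φ p k) (W p) :=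
  congrArg (· + christoffel g (φ p) (mfderiv 𝓘(ℝ, F) 𝓘(ℝ, E) φ p k) (W p))
    (trivAt_symmL_self (φ p) _)

theorem covDeriv_eq_covDerivAlong (g : RiemMetric E N) (L : ∀ q : N, Tan E q) (q : N)
    (k : Tan E q) : covDeriv g L q k = covDerivAlong g (fun x : N => x) L q k := by
  have h : mfderiv 𝓘(ℝ, E) 𝓘(ℝ, E) (fun x : N => x) q k = k := by
    have := mfderiv_id (I := 𝓘(ℝ, E)) (x := q)
    exact congrArg (fun T : Tan E q →L[ℝ] Tan E q => T k) this
  unfold covDeriv covDerivAlong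
  dsimp only
  rw [h]

theorem covDerivAlong_congr (g : RiemMetric E N) {φ : M → N} {W W' : ∀ x : M, Tan E (φ x)} {p : M}
    (h : ∀ᶠ x in 𝓝 p, W x = W' x) (k : Tan F p) :
    covDerivAlong g φ W p k = covDerivAlong g φ W' p k := by
  rw [covDerivAlong_eq, covDerivAlong_eq, dCoord_congr h, h.self_of_nhds]

/-- The Levi-Civita connection is metric. -/
theorem mvfderiv_metric (g : RiemMetric E N) {φ : M → N} {W Z : ∀ x : M, Tan E (φ x)} {p : M}
    (hW : DiffAlong F φ W p) (hZ : DiffAlong F φ Z p) (k : Tan F p) :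
    mvfderiv 𝓘(ℝ, F) (fun x => g.inner (φ x) (W x) (Z x)) p k
      = g.inner (φ p) (covDerivAlong g φ W p k) (Z p)
        + g.inner (φ p) (W p) (covDerivAlong g φ Z p k) := by
  rw [mvfderiv_metric_coord g hW hZ, covDerivAlong_eq, covDerivAlong_eq]
  have h : ∀ a b z : Tan E (φ p), g.inner (φ p) (a + b) z
      = g.inner (φ p) a z + g.inner (φ p) b z := fun a b z => by
    rw [map_add]; rfl
  -- In the sum of the two Christoffel identities the terms differentiating the metric along W and Z
  -- cancel, and only the derivative along df(k) remains.
  have h1 := christoffel_spec g (φ p) (mfderiv 𝓘(ℝ, F) 𝓘(ℝ, E) φ p k) (W p) (Z p)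
  have h2 := christoffel_spec g (φ p) (mfderiv 𝓘(ℝ, F) 𝓘(ℝ, E) φ p k) (Z p) (W p)
  rw [g.symm] at h2
  rw [dGram_symm g _ (mfderiv 𝓘(ℝ, F) 𝓘(ℝ, E) φ p k) (Z p) (W p)] at h2
  rw [h, map_add]
  change _ = g.inner (φ p) _ (Z p) + g.inner (φ p) (christoffel g (φ p) _ _) (Z p) + (_ +
    g.inner (φ p) (W p) (christoffel g (φ p) _ _))
  rw [h1, h2]
  ring

/-- The matrix at `x` of a `(1,1)` tensor field in the chart at `q`. -/
def coordEndo (A : ∀ q : N, Tan E q →L[ℝ] Tan E q) (q x : N) : E →L[ℝ] E :=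
  ContinuousLinearMap.inCoordinates E (fun q : N => Tan E q) E (fun q : N => Tan E q) q x q x (A x)

def dEndo (A : ∀ q : N, Tan E q →L[ℝ] Tan E q) (q : N) :
    Tan E q →L[ℝ] (Tan E q →L[ℝ] Tan E q) :=
  mvfderiv 𝓘(ℝ, E) (coordEndo A q) q

/-- The covariant derivative of a `(1,1)` tensor field, `covEndo g A q x y = (∇_x A) y`. -/
def covEndo (g : RiemMetric E N) (A : ∀ q : N, Tan E q →L[ℝ] Tan E q) (q : N) :
    Tan E q →ₗ[ℝ] Tan E q →ₗ[ℝ] Tan E q :=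
  LinearMap.mk₂ ℝ (fun x y => dEndo A q x y + christoffelBilin g q x (A q y)
      - A q (christoffelBilin g q x y))
    (fun x y z => by simp only [map_add, LinearMap.add_apply, add_apply]; abel)
    (fun a x y => by
      simp only [map_smul, LinearMap.smul_apply, smul_apply, smul_sub, smul_add])
    (fun x y z => by simp only [map_add]; abel)
    (fun a x y => by simp only [map_smul, smul_sub, smul_add])

end Calculus

/-! ### Leibniz rule for (1,1) tensors, holomorphic maps, torsion-freeness and the chain rule -/

section Calculus

variable {F : Type*} [NormedAddCommGroup F] [NormedSpace ℂ F]
  {M : Type*} [TopologicalSpace M] [ChartedSpace F M]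
  {E : Type*} [NormedAddCommGroup E] [NormedSpace ℂ E]
  {N : Type*} [TopologicalSpace N] [ChartedSpace E N] [IsManifold 𝓘(ℂ, E) ω N]

theorem covEndo_apply [FiniteDimensional ℂ E] (g : RiemMetric E N)
    (A : ∀ q : N, Tan E q →L[ℝ] Tan E q) (q : N)
    (x y : Tan E q) : covEndo g A q x y = dEndo A q x y + christoffelBilin g q x (A q y)
      - A q (christoffelBilin g q x y) := rfl

theorem coordEndo_self (A : ∀ q : N, Tan E q →L[ℝ] Tan E q) (q : N) (v : Tan E q) :
    coordEndo A q q v = A q v := by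
  refine (trivAt_continuousLinearMapAt_self q _).trans ?_
  exact congrArg (A q) (trivAt_symmL_self (E := E) q v)

/-- Differentiability at `q` of a `(1,1)` tensor field. -/
def DiffEndo (A : ∀ q : N, Tan E q →L[ℝ] Tan E q) (q : N) : Prop :=
  MDifferentiableAt 𝓘(ℝ, E) 𝓘(ℝ, E →L[ℝ] E) (coordEndo A q) q

theorem IsSmoothEndo.diffEndo {A : ∀ q : N, Tan E q →L[ℝ] Tan E q} {W : Set N}
    (hA : IsSmoothEndo A W) (hW : IsOpen W) {q : N} (hq : q ∈ W) : DiffEndo A q := by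
  have h := (ContMDiffOn.contMDiffAt hA (hW.mem_nhds hq)).mdifferentiableAt (by simp)
  rw [mdifferentiableAt_hom_bundle] at h
  exact h.2

theorem coordAlong_endo (A : ∀ q : N, Tan E q →L[ℝ] Tan E q) {φ : M → N}
    (W : ∀ x : M, Tan E (φ x)) {p : M} (hφ : ContinuousAt φ p) :
    coordAlong φ (fun x => A (φ x) (W x)) p =ᶠ[𝓝 p]
      fun x => coordEndo A (φ p) (φ x) (coordAlong φ W p x) := by
  have hb : φ ⁻¹' (trivializationAt E (fun q : N => Tan E q) (φ p)).baseSet ∈ 𝓝 p :=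
    hφ ((Trivialization.open_baseSet _).mem_nhds (FiberBundle.mem_baseSet_trivializationAt' _))
  filter_upwards [hb] with x hx
  have hs : (trivializationAt E (fun q : N => Tan E q) (φ p)).symmL ℝ (φ x)
      (coordAlong φ W p x) = W x :=
    (Trivialization.symmL_apply (hb := hx) ..).trans
      ((trivializationAt E (fun q : N => Tan E q) (φ p)).symm_proj_apply ⟨φ x, W x⟩ hx)
  change _ = (trivializationAt E (fun q : N => Tan E q) (φ p)).continuousLinearMapAt ℝ (φ x)
    (A (φ x) ((trivializationAt E (fun q : N => Tan E q) (φ p)).symmL ℝ (φ x)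
      (coordAlong φ W p x)))
  rw [hs, Trivialization.continuousLinearMapAt_apply, Trivialization.linearMapAt_apply]
  exact (if_pos hx).symm

theorem DiffAlong.endo {A : ∀ q : N, Tan E q →L[ℝ] Tan E q} {φ : M → N}
    {W : ∀ x : M, Tan E (φ x)} {p : M} (hA : DiffEndo A (φ p)) (hW : DiffAlong F φ W p) :
    DiffAlong F φ (fun x => A (φ x) (W x)) p := by
  have hφ := hW.mdifferentiableAt_base
  refine diffAlong_iff.2 ⟨hφ, ?_⟩
  have h1 : MDifferentiableAt 𝓘(ℝ, F) 𝓘(ℝ, E →L[ℝ] E) (coordEndo A (φ p) ∘ φ) p :=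
    MDifferentiableAt.comp p hA hφ
  exact (h1.clm_apply hW.mdifferentiableAt_coord).congr_of_eventuallyEq
    (coordAlong_endo A W hφ.continuousAt)

/-- The Leibniz rule for `A(W)`, where `W` is a vector field along a map. -/
theorem covDerivAlong_endo [FiniteDimensional ℂ E] (g : RiemMetric E N)
    {A : ∀ q : N, Tan E q →L[ℝ] Tan E q} {φ : M → N}
    {W : ∀ x : M, Tan E (φ x)} {p : M} (hA : DiffEndo A (φ p)) (hW : DiffAlong F φ W p)
    (k : Tan F p) :
    covDerivAlong g φ (fun x => A (φ x) (W x)) p k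
      = covEndo g A (φ p) (mfderiv 𝓘(ℝ, F) 𝓘(ℝ, E) φ p k) (W p)
        + A (φ p) (covDerivAlong g φ W p k) := by
  have hφ := hW.mdifferentiableAt_base
  have h1 : MDifferentiableAt 𝓘(ℝ, F) 𝓘(ℝ, E →L[ℝ] E) (coordEndo A (φ p) ∘ φ) p :=
    MDifferentiableAt.comp p hA hφ
  have h2 : dCoord F φ (fun x => A (φ x) (W x)) p k
      = dEndo A (φ p) (mfderiv 𝓘(ℝ, F) 𝓘(ℝ, E) φ p k) (W p) + A (φ p) (dCoord F φ W p k) := by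
    refine (congrArg (fun T : Tan F p →L[ℝ] E => T k)
      (mvfderiv_congr (coordAlong_endo A W hφ.continuousAt))).trans ?_
    refine (mvfderiv_clm_apply h1 hW.mdifferentiableAt_coord k).trans ?_
    refine congrArg₂ (· + ·) ?_ (coordEndo_self A (φ p) _)
    rw [coordAlong_self]
    have := mfderiv_comp_apply p hA hφ k
    exact congrArg (fun T : E →L[ℝ] E => T (W p)) this
  rw [covDerivAlong_eq, covDerivAlong_eq, h2, covEndo_apply, map_add]
  abel

theorem covDerivEndo_eq_covEndo [FiniteDimensional ℂ E] (g : RiemMetric E N)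
    {A : ∀ q : N, Tan E q →L[ℝ] Tan E q} {K L : ∀ q : N, Tan E q} {q : N}
    (hA : DiffEndo A q) (hL : DiffAlong E (fun x : N => x) L q) :
    covDerivEndo g A K L q = covEndo g A q (K q) (L q) := by
  have hm : mfderiv 𝓘(ℝ, E) 𝓘(ℝ, E) (fun x : N => x) q (K q) = K q := by
    have := mfderiv_id (I := 𝓘(ℝ, E)) (x := q)
    exact congrArg (fun T : Tan E q →L[ℝ] Tan E q => T (K q)) this
  have h := covDerivAlong_endo g (φ := fun x : N => x) hA hL (K q)
  rw [hm] at h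
  unfold covDerivEndo
  rw [covDeriv_eq_covDerivAlong, covDeriv_eq_covDerivAlong, h]
  abel

variable [IsManifold 𝓘(ℂ, F) ω M]

theorem ContMDiff.real_of_complex {f : M → N} (hf : ContMDiff 𝓘(ℂ, F) 𝓘(ℂ, E) ω f) :
    ContMDiff 𝓘(ℝ, F) 𝓘(ℝ, E) ω f := by
  intro p
  have h := hf p
  rw [contMDiffAt_iff] at h ⊢
  exact ⟨h.1, ContDiffWithinAt.restrict_scalars ℝ (𝕜' := ℂ) h.2⟩

/-- The real differential is the complex one with scalars restricted, hence commutes with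
multiplication by i. -/
theorem mfderiv_cplxJ {f : M → N} (hf : ContMDiff 𝓘(ℂ, F) 𝓘(ℂ, E) ω f) (p : M) (k : Tan F p) :
    mfderiv 𝓘(ℝ, F) 𝓘(ℝ, E) f p (cplxJ F p k)
      = cplxJ E (f p) (mfderiv 𝓘(ℝ, F) 𝓘(ℝ, E) f p k) := by
  have h1 : HasMFDerivAt 𝓘(ℂ, F) 𝓘(ℂ, E) f p (mfderiv 𝓘(ℂ, F) 𝓘(ℂ, E) f p) :=
    ((hf p).mdifferentiableAt (by simp)).hasMFDerivAt
  let T : F →L[ℂ] E := mfderiv 𝓘(ℂ, F) 𝓘(ℂ, E) f p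
  have h2 : HasMFDerivAt 𝓘(ℝ, F) 𝓘(ℝ, E) f p (T.restrictScalars ℝ : F →L[ℝ] E) := by
    refine ⟨h1.1, ?_⟩
    exact HasFDerivWithinAt.restrictScalars ℝ h1.2
  have h3 : mfderiv 𝓘(ℝ, F) 𝓘(ℝ, E) f p = (T.restrictScalars ℝ : F →L[ℝ] E) := h2.mfderiv
  rw [h3]
  exact T.map_smul Complex.I k

/-- The matrix of `df` in the charts at `p` and `f p`. -/
def coordD (F E : Type*) [NormedAddCommGroup F] [NormedSpace ℂ F] [NormedAddCommGroup E]
    [NormedSpace ℂ E] {M N : Type*} [TopologicalSpace M] [ChartedSpace F M]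
    [IsManifold 𝓘(ℂ, F) ω M] [TopologicalSpace N] [ChartedSpace E N] [IsManifold 𝓘(ℂ, E) ω N]
    (f : M → N) (p x : M) : F →L[ℝ] E :=
  inTangentCoordinates 𝓘(ℝ, F) 𝓘(ℝ, E) id f (mfderiv 𝓘(ℝ, F) 𝓘(ℝ, E) f) p x

theorem mdifferentiableAt_coordD {f : M → N} (hf : ContMDiff 𝓘(ℝ, F) 𝓘(ℝ, E) ω f) (p : M) :
    MDifferentiableAt 𝓘(ℝ, F) 𝓘(ℝ, F →L[ℝ] E) (coordD F E f p) p :=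
  ((hf p).mfderiv_const (m := 1) le_top).mdifferentiableAt (by simp)

theorem coordD_self (f : M → N) (p : M) (k : Tan F p) :
    coordD F E f p p k = mfderiv 𝓘(ℝ, F) 𝓘(ℝ, E) f p k := by
  refine (trivAt_continuousLinearMapAt_self (f p) _).trans ?_
  exact congrArg (mfderiv 𝓘(ℝ, F) 𝓘(ℝ, E) f p) (trivAt_symmL_self (E := F) p k)

theorem coordAlong_mfderiv {f : M → N} (L : ∀ x : M, Tan F x) {p : M} (hf : ContinuousAt f p) :
    coordAlong f (fun x => mfderiv 𝓘(ℝ, F) 𝓘(ℝ, E) f x (L x)) p =ᶠ[𝓝 p]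
      fun x => coordD F E f p x (coordAlong (fun x : M => x) L p x) := by
  have hb : f ⁻¹' (trivializationAt E (fun q : N => Tan E q) (f p)).baseSet ∈ 𝓝 p :=
    hf ((Trivialization.open_baseSet _).mem_nhds (FiberBundle.mem_baseSet_trivializationAt' _))
  have hb' : (trivializationAt F (fun q : M => Tan F q) p).baseSet ∈ 𝓝 p :=
    ((Trivialization.open_baseSet _).mem_nhds (FiberBundle.mem_baseSet_trivializationAt' _))
  filter_upwards [hb, hb'] with x hx hx'
  have hs : (trivializationAt F (fun q : M => Tan F q) p).symmL ℝ x
      (coordAlong (fun x : M => x) L p x) = L x :=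
    (Trivialization.symmL_apply (hb := hx') ..).trans
      ((trivializationAt F (fun q : M => Tan F q) p).symm_proj_apply ⟨x, L x⟩ hx')
  change _ = (trivializationAt E (fun q : N => Tan E q) (f p)).continuousLinearMapAt ℝ (f x)
    (mfderiv 𝓘(ℝ, F) 𝓘(ℝ, E) f x ((trivializationAt F (fun q : M => Tan F q) p).symmL ℝ x
      (coordAlong (fun x : M => x) L p x)))
  rw [hs, Trivialization.continuousLinearMapAt_apply, Trivialization.linearMapAt_apply]
  exact (if_pos hx).symm

theorem DiffAlong.map_mfderiv {f : M → N} (hf : ContMDiff 𝓘(ℝ, F) 𝓘(ℝ, E) ω f)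
    {L : ∀ x : M, Tan F x} {p : M} (hL : DiffAlong F (fun x : M => x) L p) :
    DiffAlong F f (fun x => mfderiv 𝓘(ℝ, F) 𝓘(ℝ, E) f x (L x)) p := by
  refine diffAlong_iff.2 ⟨(hf p).mdifferentiableAt (by simp), ?_⟩
  exact ((mdifferentiableAt_coordD hf p).clm_apply hL.mdifferentiableAt_coord).congr_of_eventuallyEq
    (coordAlong_mfderiv L (hf p).continuousAt)

/-- A vector field is differentiable if its image under an immersion is. -/
theorem DiffAlong.of_map_mfderiv [FiniteDimensional ℂ F] [FiniteDimensional ℂ E] {f : M → N}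
    (hf : ContMDiff 𝓘(ℝ, F) 𝓘(ℝ, E) ω f)
    {L : ∀ x : M, Tan F x} {p : M} (hinj : Function.Injective (mfderiv 𝓘(ℝ, F) 𝓘(ℝ, E) f p))
    (hL : DiffAlong F f (fun x => mfderiv 𝓘(ℝ, F) 𝓘(ℝ, E) f x (L x)) p) :
    DiffAlong F (fun x : M => x) L p := by
  have : FiniteDimensional ℝ F := FiniteDimensional.complexToReal F
  have : FiniteDimensional ℝ E := FiniteDimensional.complexToReal E
  have : CompleteSpace F := FiniteDimensional.complete ℝ F
  refine diffAlong_iff.2 ⟨mdifferentiableAt_id, ?_⟩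
  have hker : ((coordD F E f p p : F →L[ℝ] E) : F →ₗ[ℝ] E).ker = ⊥ := by
    refine LinearMap.ker_eq_bot.2 fun a b h => hinj ?_
    exact (coordD_self (E := E) f p a).symm.trans (Eq.trans h (coordD_self (E := E) f p b))
  -- A left inverse R of df at p makes B = R ∘ df the identity at p, so B is invertible nearby, and
  -- the coordinates of L are B⁻¹ R applied to those of df(L).
  obtain ⟨r, hr⟩ := LinearMap.exists_leftInverse_of_injective _ hker
  let R : E →L[ℝ] F := LinearMap.toContinuousLinearMap r
  let B : M → F →L[ℝ] F := fun x => R ∘L coordD F E f p x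
  have hB : MDifferentiableAt 𝓘(ℝ, F) 𝓘(ℝ, F →L[ℝ] F) B p :=
    MDifferentiableAt.clm_comp (mdifferentiableAt_const (c := R)) (mdifferentiableAt_coordD hf p)
  have hBp : B p = 1 := by
    ext v
    exact congrArg (fun T : F →ₗ[ℝ] F => T v) hr
  have hunit : ∀ᶠ x in 𝓝 p, IsUnit (B x) := by
    refine hB.continuousAt.eventually (Units.isOpen.mem_nhds ?_)
    rw [hBp]
    exact isUnit_one
  have hinv : MDifferentiableAt 𝓘(ℝ, F) 𝓘(ℝ, F →L[ℝ] F) (fun x => Ring.inverse (B x)) p := by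
    have h1 : DifferentiableAt ℝ (Ring.inverse : (F →L[ℝ] F) → (F →L[ℝ] F)) (B p) :=
      differentiableAt_inverse (by rw [hBp]; exact isUnit_one)
    exact h1.comp_mdifferentiableAt hB
  have hRW : MDifferentiableAt 𝓘(ℝ, F) 𝓘(ℝ, F)
      (fun x => R (coordAlong f (fun x => mfderiv 𝓘(ℝ, F) 𝓘(ℝ, E) f x (L x)) p x)) p :=
    R.differentiableAt.comp_mdifferentiableAt hL.mdifferentiableAt_coord
  refine (hinv.clm_apply hRW).congr_of_eventuallyEq ?_
  filter_upwards [hunit, coordAlong_mfderiv (E := E) L (hf p).continuousAt] with x hx hx'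
  rw [hx']
  have h2 : R (coordD F E f p x (coordAlong (fun x : M => x) L p x))
    = B x (coordAlong (fun x : M => x) L p x) := rfl
  rw [h2, ← mul_apply_eq_comp, Ring.inverse_mul_cancel _ hx]
  rfl

/-- The agreement holds on a neighbourhood, not only at p, so it can be differentiated once more;
the Hessian of f then becomes a genuine second derivative. -/
theorem coordD_comp_symm {f : M → N} (hf : ContMDiff 𝓘(ℝ, F) 𝓘(ℝ, E) ω f) (p : M) :
    coordD F E f p ∘ (extChartAt 𝓘(ℝ, F) p).symm =ᶠ[𝓝 (extChartAt 𝓘(ℝ, F) p p)]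
      fderiv ℝ (extChartAt 𝓘(ℝ, E) (f p) ∘ f ∘ (extChartAt 𝓘(ℝ, F) p).symm) := by
  have hc : ContinuousAt (extChartAt 𝓘(ℝ, F) p).symm (extChartAt 𝓘(ℝ, F) p p) :=
    continuousAt_extChartAt_symm p
  have hcf : ContinuousAt (f ∘ (extChartAt 𝓘(ℝ, F) p).symm) (extChartAt 𝓘(ℝ, F) p p) :=
    ContinuousAt.comp hf.continuous.continuousAt hc
  have h1 : ∀ᶠ y in 𝓝 (extChartAt 𝓘(ℝ, F) p p),
      f ((extChartAt 𝓘(ℝ, F) p).symm y) ∈ (chartAt E (f p)).source := by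
    refine hcf.eventually ((chartAt E (f p)).open_source.mem_nhds ?_)
    rw [Function.comp_apply, extChartAt_to_inv]
    exact mem_chart_source E (f p)
  filter_upwards [extChartAt_target_mem_nhds (I := 𝓘(ℝ, F)) p, h1] with y hy hfy
  have hx : (extChartAt 𝓘(ℝ, F) p).symm y ∈ (chartAt F p).source := by
    rw [← extChartAt_source 𝓘(ℝ, F)]
    exact (extChartAt 𝓘(ℝ, F) p).map_target hy
  have h2 := inTangentCoordinates_eq_mfderiv_comp (I := 𝓘(ℝ, F)) (I' := 𝓘(ℝ, E)) (f := id) (g := f)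
    (ϕ := mfderiv 𝓘(ℝ, F) 𝓘(ℝ, E) f) (x₀ := p) (x := (extChartAt 𝓘(ℝ, F) p).symm y) hx hfy
  refine Eq.trans h2 ?_
  have h3 : extChartAt 𝓘(ℝ, F) (id p) (id ((extChartAt 𝓘(ℝ, F) p).symm y)) = y :=
    (extChartAt 𝓘(ℝ, F) p).right_inv hy
  rw [h3, ModelWithCorners.range_eq_univ, mfderivWithin_univ]
  have hd1 : MDifferentiableAt 𝓘(ℝ, F) 𝓘(ℝ, F) (extChartAt 𝓘(ℝ, F) p).symm y := by
    have := mdifferentiableWithinAt_extChartAt_symm (I := 𝓘(ℝ, F)) hy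
    rwa [ModelWithCorners.range_eq_univ, mdifferentiableWithinAt_univ] at this
  have hd2 : MDifferentiableAt 𝓘(ℝ, F) 𝓘(ℝ, E) f ((extChartAt 𝓘(ℝ, F) p).symm y) :=
    (hf _).mdifferentiableAt (by simp)
  have hd3 := mdifferentiableAt_extChartAt (I := 𝓘(ℝ, E)) hfy
  have h4 := mfderiv_comp y hd3 (hd2.comp y hd1)
  rw [mfderiv_comp y hd2 hd1, mfderiv_eq_fderiv] at h4
  exact h4.symm

/-- The second derivative of `f` at `p`, in the charts at `p` and `f p`. -/
def hessD (F E : Type*) [NormedAddCommGroup F] [NormedSpace ℂ F] [NormedAddCommGroup E]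
    [NormedSpace ℂ E] {M N : Type*} [TopologicalSpace M] [ChartedSpace F M]
    [IsManifold 𝓘(ℂ, F) ω M] [TopologicalSpace N] [ChartedSpace E N] [IsManifold 𝓘(ℂ, E) ω N]
    (f : M → N) (p : M) (k l : Tan F p) : Tan E (f p) :=
  mvfderiv 𝓘(ℝ, F) (coordD F E f p) p k l

theorem hessD_symm {f : M → N} (hf : ContMDiff 𝓘(ℝ, F) 𝓘(ℝ, E) ω f) (p : M)
    (k l : Tan F p) :
    hessD F E f p k l = hessD F E f p l k := by
  have hs : ContDiffAt ℝ ω (extChartAt 𝓘(ℝ, E) (f p) ∘ f ∘ (extChartAt 𝓘(ℝ, F) p).symm)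
      (extChartAt 𝓘(ℝ, F) p p) := by
    have := (contMDiffAt_iff.1 (hf p)).2
    rwa [ModelWithCorners.range_eq_univ, contDiffWithinAt_univ] at this
  unfold hessD
  rw [mvfderiv_eq_fderiv (mdifferentiableAt_coordD hf p), (coordD_comp_symm hf p).fderiv_eq]
  exact (hs.isSymmSndFDerivAt (by simp)) k l

/-- The Lie bracket on a manifold is defined by pulling fields back along the inverse chart; this
pullback is just the coordinate expression used here. -/
theorem mpullbackWithin_extChartAt_symm (K : ∀ x : M, Tan F x) (p : M) :
    VectorField.mpullbackWithin 𝓘(ℝ, F) 𝓘(ℝ, F) (extChartAt 𝓘(ℝ, F) p).symm K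
        (Set.range 𝓘(ℝ, F)) =ᶠ[𝓝 (extChartAt 𝓘(ℝ, F) p p)]
      coordAlong (fun x : M => x) K p ∘ (extChartAt 𝓘(ℝ, F) p).symm := by
  filter_upwards [extChartAt_target_mem_nhds (I := 𝓘(ℝ, F)) p] with y hy
  have hx : (extChartAt 𝓘(ℝ, F) p).symm y ∈ (chartAt F p).source := by
    rw [← extChartAt_source 𝓘(ℝ, F)]
    exact (extChartAt 𝓘(ℝ, F) p).map_target hy
  have h3 : extChartAt 𝓘(ℝ, F) p ((extChartAt 𝓘(ℝ, F) p).symm y) = y :=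
    (extChartAt 𝓘(ℝ, F) p).right_inv hy
  have h1 := TangentBundle.symmL_trivializationAt (I := 𝓘(ℝ, F)) hx
  rw [h3] at h1
  rw [VectorField.mpullbackWithin_apply, ← h1]
  have h2 : ((trivializationAt F (fun q : M => Tan F q) p).symmL ℝ
      ((extChartAt 𝓘(ℝ, F) p).symm y)).inverse
      = (trivializationAt F (fun q : M => Tan F q) p).continuousLinearMapAt ℝ
        ((extChartAt 𝓘(ℝ, F) p).symm y) := by
    refine ContinuousLinearMap.inverse_eq ?_ ?_
    · ext v
      exact Trivialization.symmL_continuousLinearMapAt _ hx v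
    · ext v
      exact Trivialization.continuousLinearMapAt_symmL _ hx v
  refine (congrArg (fun T : Tan F ((extChartAt 𝓘(ℝ, F) p).symm y) →L[ℝ] F => T (K _)) h2).trans ?_
  rw [Trivialization.continuousLinearMapAt_apply, Trivialization.linearMapAt_apply]
  exact if_pos hx

theorem lieBracketWithin_univ_congr {V W V' W' : F → F} {y : F} (hV : V =ᶠ[𝓝 y] V')
    (hW : W =ᶠ[𝓝 y] W') : VectorField.lieBracketWithin ℝ V W Set.univ y
      = fderiv ℝ W' y (V' y) - fderiv ℝ V' y (W' y) := by
  rw [VectorField.lieBracketWithin_univ, VectorField.lieBracket_eq]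
  dsimp only
  rw [hV.fderiv_eq, hW.fderiv_eq, hV.self_of_nhds, hW.self_of_nhds]

theorem mlieBracket_eq_dCoord {K L : ∀ x : M, Tan F x} {p : M}
    (hK : DiffAlong F (fun x : M => x) K p) (hL : DiffAlong F (fun x : M => x) L p) :
    VectorField.mlieBracket 𝓘(ℝ, F) K L p
      = dCoord F (fun x : M => x) L p (K p) - dCoord F (fun x : M => x) K p (L p) := by
  have hK' := mpullbackWithin_extChartAt_symm K p
  have hL' := mpullbackWithin_extChartAt_symm L p
  have e : ∀ K : ∀ x : M, Tan F x, (coordAlong (fun x : M => x) K p ∘ (extChartAt 𝓘(ℝ, F) p).symm)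
      (extChartAt 𝓘(ℝ, F) p p) = K p := by
    intro K
    rw [Function.comp_apply, extChartAt_to_inv]
    exact coordAlong_self (fun x : M => x) K p
  -- The final pullback to the manifold is by the derivative of the chart at its own base point,
  -- which is the identity.
  have hinv : ∀ v : F, (mfderiv 𝓘(ℝ, F) 𝓘(ℝ, F) (extChartAt 𝓘(ℝ, F) p) p).inverse v = v := by
    intro v
    refine (congrArg (fun T : F →L[ℝ] F => T.inverse v) mfderiv_extChartAt_self).trans ?_
    exact congrArg (fun T : F →L[ℝ] F => T v) ContinuousLinearMap.inverse_id
  rw [← VectorField.mlieBracketWithin_univ, VectorField.mlieBracketWithin_apply]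
  refine (hinv _).trans ?_
  rw [Set.preimage_univ, Set.univ_inter]
  rw [ModelWithCorners.range_eq_univ] at hK' hL' ⊢
  refine (lieBracketWithin_univ_congr hK' hL').trans ?_
  rw [e, e]
  unfold dCoord
  rw [mvfderiv_eq_fderiv hK.mdifferentiableAt_coord, mvfderiv_eq_fderiv hL.mdifferentiableAt_coord]
  rfl

/-- The Levi-Civita connection is torsion free. -/
theorem covDerivAlong_mfderiv_sub [FiniteDimensional ℂ F] [FiniteDimensional ℂ E]
    (g : RiemMetric E N) {f : M → N} (hf : ContMDiff 𝓘(ℝ, F) 𝓘(ℝ, E) ω f)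
    {K L : ∀ x : M, Tan F x} {p : M} (hK : DiffAlong F (fun x : M => x) K p)
    (hL : DiffAlong F (fun x : M => x) L p) :
    covDerivAlong g f (fun x => mfderiv 𝓘(ℝ, F) 𝓘(ℝ, E) f x (L x)) p (K p)
      - covDerivAlong g f (fun x => mfderiv 𝓘(ℝ, F) 𝓘(ℝ, E) f x (K x)) p (L p)
      = mfderiv 𝓘(ℝ, F) 𝓘(ℝ, E) f p (VectorField.mlieBracket 𝓘(ℝ, F) K L p) := by
  -- The derivative of df(L) splits into a Hessian term and df of the derivative of L. The Hessian
  -- and Christoffel terms are symmetric, so only the bracket survives antisymmetrization.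
  have key : ∀ {L : ∀ x : M, Tan F x}, DiffAlong F (fun x : M => x) L p → ∀ k : Tan F p,
      dCoord F f (fun x => mfderiv 𝓘(ℝ, F) 𝓘(ℝ, E) f x (L x)) p k
        = hessD F E f p k (L p)
          + mfderiv 𝓘(ℝ, F) 𝓘(ℝ, E) f p (dCoord F (fun x : M => x) L p k) := by
    intro L hL k
    refine (congrArg (fun T : Tan F p →L[ℝ] E => T k)
      (mvfderiv_congr (coordAlong_mfderiv L (hf p).continuousAt))).trans ?_
    refine (mvfderiv_clm_apply (mdifferentiableAt_coordD hf p) hL.mdifferentiableAt_coord k).trans ?_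
    refine congrArg₂ (· + ·) ?_ (coordD_self f p _)
    rw [coordAlong_self]
    rfl
  rw [covDerivAlong_eq, covDerivAlong_eq, key hK, key hL, mlieBracket_eq_dCoord hK hL, map_sub,
    hessD_symm hf p (L p) (K p)]
  have h : ∀ v w, christoffelBilin g (f p) v w = christoffelBilin g (f p) w v :=
    christoffel_symm g (f p)
  rw [h (mfderiv 𝓘(ℝ, F) 𝓘(ℝ, E) f p (L p))]
  abel

/-- The chain rule for the Levi-Civita connection. -/
theorem covDerivAlong_comp [FiniteDimensional ℂ E] (g : RiemMetric E N) {f : M → N} {p : M}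
    (hf : MDifferentiableAt 𝓘(ℝ, F) 𝓘(ℝ, E) f p) {U : ∀ q : N, Tan E q}
    (hU : DiffAlong E (fun x : N => x) U (f p)) (k : Tan F p) :
    covDerivAlong g f (fun x => U (f x)) p k
      = covDeriv g U (f p) (mfderiv 𝓘(ℝ, F) 𝓘(ℝ, E) f p k) := by
  have hm : ∀ v : Tan E (f p), mfderiv 𝓘(ℝ, E) 𝓘(ℝ, E) (fun x : N => x) (f p) v = v := by
    have := mfderiv_id (I := 𝓘(ℝ, E)) (x := f p)
    exact fun v => congrArg (fun T : Tan E (f p) →L[ℝ] Tan E (f p) => T v) this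
  rw [covDeriv_eq_covDerivAlong, covDerivAlong_eq, covDerivAlong_eq, hm]
  refine congrArg (· + _) ?_
  exact mfderiv_comp_apply p hU.mdifferentiableAt_coord hf k

theorem DiffAlong.comp {f : M → N} {p : M}
    (hf : MDifferentiableAt 𝓘(ℝ, F) 𝓘(ℝ, E) f p) {U : ∀ q : N, Tan E q}
    (hU : DiffAlong E (fun x : N => x) U (f p)) : DiffAlong F f (fun x => U (f x)) p :=
  MDifferentiableAt.comp p hU hf

end Calculus

/-! ### Pointwise algebra for ∇U and ∇G -/

section LinearAlgebra

variable {V : Type*} [AddCommGroup V] [Module ℝ V]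

/-- The pointwise algebra behind `∇U = -G + σ ⊗ V`: here `a x = ∇_x U` and `A y = (∇_U G) y`. -/
theorem nabla_characteristic_aux (g : V →ₗ[ℝ] V →ₗ[ℝ] ℝ) (hsymm : ∀ x y, g x y = g y x)
    (hpos : ∀ x, x ≠ 0 → 0 < g x x) (U W : V) (G H : V →ₗ[ℝ] V) (a A : V → V) (σ : V → ℝ)
    (hskew : ∀ x y, g x (G y) = -g (G x) y) (hGG : ∀ x, G (G x) = -x + g x U • U + g x W • W)
    (hGU : G U = 0) (hGW : G W = 0) (hUU : g U U = 1) (hWW : g W W = 1) (hUW : g U W = 0)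
    (haU : ∀ x, g (a x) U = 0) (haW : ∀ x, g (a x) W = σ x)
    (hcontact : ∀ x y, g (a x) y - g (a y) x = 2 * g x (G y) + σ x * g y W - σ y * g x W)
    (hS : ∀ x, -G (a (G x)) + G (G (a x)) + G (A x) = σ U • G (H x))
    (hclosed : ∀ y z, g y U = 0 → g y W = 0 → g z U = 0 → g z W = 0 →
      g y (A z) - g z (G (a y)) + g y (G (a z)) = σ U * g y (H z)) (x : V) :
    a x = -G x + σ x • W := by
  -- Here b is the error in the claimed formula. Its values are orthogonal to U and W, and the
  -- contact identity makes it symmetric.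
  obtain ⟨b, hb⟩ : ∃ b : V → V, ∀ x, a x = b x - G x + σ x • W :=
    ⟨fun x => a x + G x - σ x • W, fun x => by module⟩
  have hGxU : ∀ x, g (G x) U = 0 := fun x => by
    have := hskew x U; rw [hGU, map_zero] at this; linarith
  have hGxW : ∀ x, g (G x) W = 0 := fun x => by
    have := hskew x W; rw [hGW, map_zero] at this; linarith
  have hbU : ∀ x, g (b x) U = 0 := fun x => by
    have := haU x
    rw [hb] at this
    simpa [hGxU, hsymm W U, hUW] using this
  have hbW : ∀ x, g (b x) W = 0 := fun x => by
    have := haW x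
    rw [hb] at this
    simpa [hGxW, hWW] using this
  have hbs : ∀ x y, g (b x) y = g (b y) x := fun x y => by
    have h1 := hcontact x y
    have h2 := hskew x y
    rw [hb, hb] at h1
    simp only [map_add, map_sub, map_smul, LinearMap.add_apply, LinearMap.sub_apply,
      LinearMap.smul_apply, smul_eq_mul] at h1
    rw [hsymm W x, hsymm W y, hsymm (G y) x] at h1
    linarith
  have hGG' : ∀ w y, g y U = 0 → g y W = 0 → g (G w) (G y) = g w y := fun w y h1 h2 => by
    have := hskew w (G y)
    rw [hGG, h1, h2] at this
    simp at this
    linarith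
  -- Pairing `hS` with Gy and subtracting `hclosed` eliminates A and H and leaves g(b(Gx), y) =
  -- -g(Gx, b y). As b is symmetric, both sides vanish.
  have e1 : ∀ x y, g x U = 0 → g x W = 0 → g y U = 0 → g y W = 0 → g (b (G x)) y = 0 := by
    intro x y hx1 hx2 hy1 hy2
    have h1 := congrArg (fun w => g w (G y)) (hS x)
    simp only [map_add, map_neg, map_smul, LinearMap.add_apply, LinearMap.neg_apply,
      LinearMap.smul_apply, smul_eq_mul, hGG' _ y hy1 hy2] at h1
    have h2 := hclosed y x hy1 hy2 hx1 hx2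
    rw [hb (G x), hb x] at h1
    rw [hb y, hb x] at h2
    have hyW : g W y = 0 := by rw [hsymm, hy2]
    simp only [map_add, map_sub, map_smul, LinearMap.add_apply, LinearMap.sub_apply,
      LinearMap.smul_apply, smul_eq_mul, hGW, map_zero, LinearMap.zero_apply, hyW] at h1 h2
    have h3 := hskew x (b y)
    have h4 := hbs y (G x)
    have h5 := hsymm (G x) (b y)
    have h6 := hskew x (G y)
    have h7 := hskew y (G x)
    have h8 := hsymm (G y) (G x)
    have h9 := hsymm y (A x)
    have h10 := hsymm y (G (b x))
    have h11 := hsymm y (H x)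
    rw [h9, h10, h11] at h2
    linarith
  have e2 : ∀ x y, g x U = 0 → g x W = 0 → g (b x) y = 0 := by
    -- A horizontal x is G(-Gx), and the vertical part of y does not matter because b takes values
    -- orthogonal to U and W.
    intro x y hx1 hx2
    have h1 := e1 (-G x) (y - g y U • U - g y W • W) (by simp [hGxU]) (by simp [hGxW])
      (by simp [hUU, hsymm W U, hUW]) (by simp [hWW, hUW])
    have h2 : G (-G x) = x := by rw [map_neg, hGG, hx1, hx2]; simp
    rw [h2] at h1
    simpa [hbU, hbW] using h1
  have e3 : ∀ x y, g (b x) y = 0 := by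
    -- Symmetry of b moves the restriction to horizontal vectors onto the other argument, where it
    -- can be dropped.
    intro x y
    have h1 := e2 (y - g y U • U - g y W • W) x
      (by simp [hUU, hsymm W U, hUW]) (by simp [hWW, hUW])
    rw [← hbs] at h1
    simpa [hbU, hbW] using h1
  have e4 : b x = 0 := by
    by_contra h
    have := hpos _ h
    rw [e3] at this
    exact lt_irrefl _ this
  rw [hb, e4, zero_sub]

/-- The pointwise algebra behind `(∇_x G) y = σ(x) H y` modulo `U, V`. -/
theorem nabla_structure_aux (P : V → Prop) (G : V → V) (hG : ∀ x, P x → P (G x))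
    (hsurj : ∀ x, P x → ∃ y, P y ∧ G y = x) (α : V → V → V → ℝ) (θ : V → V → ℝ) (σ : V → ℝ)
    (hskew : ∀ x y z, P x → P y → P z → α x y z = -α x z y)
    (hskew' : ∀ y z, P y → P z → θ y z = -θ z y)
    (hcyc : ∀ x y z, P x → P y → P z → α x z y + α y x z + α z y x
      = σ x * θ z y + σ y * θ x z + σ z * θ y x)
    (hS : ∀ x y z, P x → P y → P z → α (G x) y z - α (G y) x z + α x y (G z) - α y x (G z)
      + σ (G y) * θ x z - σ (G x) * θ y z - σ x * θ y (G z) + σ y * θ x (G z) = 0)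
    (x y z : V) (hx : P x) (hy : P y) (hz : P z) : α x y z = σ x * θ y z := by
  -- Write β(x; y, z) = α(x, y, z) - σ(x)θ(y, z). Adding `hS` to the cyclic identity at (x, y, Gz)
  -- gives β(Gx; y, z) + β(Gy; z, x) - β(Gz; x, y) = 0.
  have key : ∀ x y z, P x → P y → P z →
      (α (G x) y z - σ (G x) * θ y z) + (α (G y) z x - σ (G y) * θ z x)
        - (α (G z) x y - σ (G z) * θ x y) = 0 := by
    intro x y z hx hy hz
    have h1 := hS x y z hx hy hz
    have h2 := hcyc x y (G z) hx hy (hG z hz)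
    have h3 := hskew (G y) x z (hG y hy) hx hz
    have h4 := hskew x y (G z) hx hy (hG z hz)
    have h5 := hskew (G z) y x (hG z hz) hy hx
    have h6 := hskew' x z hx hz
    have h7 := hskew' y x hy hx
    have h8 := hskew' y (G z) hy (hG z hz)
    rw [h8] at h1
    rw [h3, h4] at h1
    rw [h5, h7] at h2
    rw [h6] at h1
    linear_combination h1 + h2
  -- The sum of `key` for (x', y, z) and for (z, x', y) is 2β(Gx'; y, z) = 0, and G is onto the
  -- subspace.
  obtain ⟨x', hx', rfl⟩ := hsurj x hx
  have h1 := key x' y z hx' hy hz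
  have h2 := key z x' y hz hx' hy
  linarith

end LinearAlgebra

/-! ### Calculus of vector fields on the ambient manifold -/

section AmbientCalculus

variable {E : Type*} [NormedAddCommGroup E] [NormedSpace ℂ E] [FiniteDimensional ℂ E]
  {N : Type*} [TopologicalSpace N] [ChartedSpace E N] [IsManifold 𝓘(ℂ, E) ω N]

/-- Differentiability at `q` of a vector field. -/
abbrev DiffField (K : ∀ q : N, Tan E q) (q : N) : Prop := DiffAlong E (fun x : N => x) K q

theorem mfderiv_id_apply (q : N) (k : Tan E q) :
    mfderiv 𝓘(ℝ, E) 𝓘(ℝ, E) (fun x : N => x) q k = k :=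
  congrArg (fun T : Tan E q →L[ℝ] Tan E q => T k) (mfderiv_id (I := 𝓘(ℝ, E)) (x := q))

theorem mvfderiv_metric_field (g : RiemMetric E N) {W Z : ∀ q : N, Tan E q} {q : N}
    (hW : DiffField W q) (hZ : DiffField Z q) (k : Tan E q) :
    mvfderiv 𝓘(ℝ, E) (fun x => g.inner x (W x) (Z x)) q k
      = g.inner q (covDeriv g W q k) (Z q) + g.inner q (W q) (covDeriv g Z q k) := by
  rw [covDeriv_eq_covDerivAlong, covDeriv_eq_covDerivAlong]
  exact mvfderiv_metric g hW hZ k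

theorem covDeriv_endo (g : RiemMetric E N) {A : ∀ q : N, Tan E q →L[ℝ] Tan E q}
    {W : ∀ q : N, Tan E q} {q : N} (hA : DiffEndo A q) (hW : DiffField W q) (k : Tan E q) :
    covDeriv g (fun x => A x (W x)) q k = covEndo g A q k (W q) + A q (covDeriv g W q k) := by
  have h := covDerivAlong_endo g (φ := fun x : N => x) hA hW k
  rw [mfderiv_id_apply] at h
  rw [covDeriv_eq_covDerivAlong, covDeriv_eq_covDerivAlong, h]

theorem covDeriv_congr (g : RiemMetric E N) {W W' : ∀ q : N, Tan E q} {q : N}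
    (h : ∀ᶠ x in 𝓝 q, W x = W' x) (k : Tan E q) : covDeriv g W q k = covDeriv g W' q k := by
  rw [covDeriv_eq_covDerivAlong, covDeriv_eq_covDerivAlong]
  exact covDerivAlong_congr g h k

theorem covDeriv_zero (g : RiemMetric E N) (q : N) (k : Tan E q) :
    covDeriv g (fun _ => 0) q k = 0 := by
  -- The zero field equals its own negative, so its coordinate derivative does too and must vanish.
  have h := dCoord_neg (F := E) (fun x : N => x) (fun _ => (0 : Tan E _)) q continuousAt_id
  simp only [neg_zero] at h
  have key : ∀ v : E, v = -v → v = 0 := fun v hv => by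
    have h2 : (2 : ℝ) • v = 0 := by rw [two_smul]; nth_rewrite 2 [hv]; exact add_neg_cancel v
    exact (smul_eq_zero.1 h2).resolve_left two_ne_zero
  have hk : (dCoord E (fun x : N => x) (fun _ => (0 : Tan E _)) q k : E) = 0 :=
    key _ (congrArg (fun T : Tan E q →L[ℝ] E => T k) h)
  rw [covDeriv_eq_covDerivAlong, covDerivAlong_eq, map_zero, add_zero]
  exact hk

theorem covDeriv_sub_covDeriv (g : RiemMetric E N) {K L : ∀ q : N, Tan E q} {q : N}
    (hK : DiffField K q) (hL : DiffField L q) :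
    covDeriv g L q (K q) - covDeriv g K q (L q) = VectorField.mlieBracket 𝓘(ℝ, E) K L q := by
  have h := covDerivAlong_mfderiv_sub g (f := fun x : N => x) contMDiff_id hK hL
  simp only [mfderiv_id_apply] at h
  rw [covDeriv_eq_covDerivAlong, covDeriv_eq_covDerivAlong, h]

theorem IsSmoothField.mono {K : ∀ q : N, Tan E q} {W W' : Set N} (h : IsSmoothField K W)
    (hW : W' ⊆ W) : IsSmoothField K W' := ContMDiffOn.mono h hW

theorem IsSmoothForm.contMDiffOn_apply {α : ∀ q : N, Tan E q →L[ℝ] ℝ} {K : ∀ q : N, Tan E q}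
    {W : Set N} (hα : IsSmoothForm α W) (hK : IsSmoothField K W) :
    ContMDiffOn 𝓘(ℝ, E) 𝓘(ℝ, ℝ) ∞ (fun x => α x (K x)) W := by
  intro x hx
  have h := ContMDiffWithinAt.clm_bundle_apply (hα x hx) (hK x hx)
  exact (contMDiffWithinAt_totalSpace.1 h).2

theorem IsSmoothField.sub {K L : ∀ q : N, Tan E q} {W : Set N} (hK : IsSmoothField K W)
    (hL : IsSmoothField L W) : IsSmoothField (fun q => K q - L q) W :=
  ContMDiffOn.sub_section hK hL

theorem IsSmoothField.smul {K : ∀ q : N, Tan E q} {W : Set N} {a : N → ℝ}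
    (ha : ContMDiffOn 𝓘(ℝ, E) 𝓘(ℝ, ℝ) ∞ a W) (hK : IsSmoothField K W) :
    IsSmoothField (fun q => a q • K q) W :=
  ContMDiffOn.smul_section ha hK

theorem IsSmoothField.mlieBracket {K L : ∀ q : N, Tan E q} {W : Set N} (hW : IsOpen W)
    (hK : IsSmoothField K W) (hL : IsSmoothField L W) :
    IsSmoothField (VectorField.mlieBracket 𝓘(ℝ, E) K L) W := by
  have : CompleteSpace E := FiniteDimensional.complete ℂ E
  intro x hx
  exact (ContMDiffAt.mlieBracket_vectorField (m := ⊤) (n := ⊤) (hK.contMDiffAt hW hx)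
    (hL.contMDiffAt hW hx) (by simp)).contMDiffWithinAt

/-- The contact and normality conditions are stated for fields; extending single vectors extracts
pointwise identities from them. -/
theorem exists_smoothField_extension (q : N) (x : Tan E q) :
    ∃ (W : Set N) (K : ∀ q : N, Tan E q), IsOpen W ∧ q ∈ W ∧ IsSmoothField K W ∧ K q = x := by
  obtain ⟨s, hs, hK⟩ := FiberBundle.exists_contMDiffOn_extend (k := ∞) 𝓘(ℝ, E) E (x₀ := q) x
  refine ⟨interior s, FiberBundle.extend E x, isOpen_interior, mem_interior_iff_mem_nhds.2 hs,
    ContMDiffOn.mono hK interior_subset, ?_⟩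
  exact FiberBundle.extend_apply_self E x

end AmbientCalculus

/-! ### Algebraic identities of the structure tensors and the rotated structure -/

section ContactAlgebra

variable {E : Type*} [NormedAddCommGroup E] [NormedSpace ℂ E]
  {N : Type*} [TopologicalSpace N] [ChartedSpace E N]

theorem cplxJ_cplxJ (q : N) (k : Tan E q) : cplxJ E q (cplxJ E q k) = -k := by
  have h : ∀ w : E, Complex.I • Complex.I • w = -w := fun w => by
    rw [smul_smul, Complex.I_mul_I, neg_one_smul]
  exact h k

variable [IsManifold 𝓘(ℂ, E) ω N] {ι : Type*}

namespace ComplexAlmostContactMetric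

variable (S : ComplexAlmostContactMetric E N ι) {i : ι} {q : N}

theorem inner_J (k l : Tan E q) : S.g.inner q k (cplxJ E q l) = -S.g.inner q (cplxJ E q k) l := by
  have h := S.hermitian q (cplxJ E q k) l
  rw [cplxJ_cplxJ, map_neg] at h
  rw [← h]
  change _ = - -(S.g.inner q k (cplxJ E q l))
  rw [neg_neg]

theorem J_V (hq : q ∈ S.dom i) : cplxJ E q (S.V i q) = S.U i q := by
  rw [S.V_eq i q hq, map_neg, cplxJ_cplxJ, neg_neg]

theorem J_U (hq : q ∈ S.dom i) : cplxJ E q (S.U i q) = -S.V i q := by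
  rw [S.V_eq i q hq, neg_neg]

theorem v_dual (hq : q ∈ S.dom i) (k : Tan E q) : S.v i q k = S.g.inner q k (S.V i q) := by
  rw [S.v_eq i q hq, S.u_dual i q hq, S.V_eq i q hq, map_neg, inner_J, neg_neg]

theorem v_U (hq : q ∈ S.dom i) : S.v i q (S.U i q) = 0 := by
  have h := S.inner_J (S.U i q) (S.U i q)
  rw [S.g.symm q (cplxJ E q _)] at h
  rw [S.v_eq i q hq, S.u_dual i q hq, S.g.symm]
  linarith

theorem u_V (hq : q ∈ S.dom i) : S.u i q (S.V i q) = 0 := by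
  rw [S.u_dual i q hq, S.g.symm, ← S.v_dual hq, S.v_U hq]

theorem v_V (hq : q ∈ S.dom i) : S.v i q (S.V i q) = 1 := by
  rw [S.v_eq i q hq, S.J_V hq, S.u_U i q hq]

theorem G_V (hq : q ∈ S.dom i) : S.G i q (S.V i q) = 0 := by
  rw [S.V_eq i q hq, map_neg, S.G_J i q hq, S.G_U i q hq, map_zero, neg_zero, neg_zero]

theorem H_U (hq : q ∈ S.dom i) : S.H i q (S.U i q) = 0 := by
  rw [S.H_eq i q hq, S.J_U hq, map_neg, S.G_V hq, neg_zero]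

theorem H_V (hq : q ∈ S.dom i) : S.H i q (S.V i q) = 0 := by
  rw [S.H_eq i q hq, S.J_V hq, S.G_U i q hq]

theorem u_G (hq : q ∈ S.dom i) (k : Tan E q) : S.u i q (S.G i q k) = 0 := by
  have h := S.G_skew i q hq k (S.U i q)
  rw [S.G_U i q hq, map_zero] at h
  rw [S.u_dual i q hq]
  linarith

theorem v_G (hq : q ∈ S.dom i) (k : Tan E q) : S.v i q (S.G i q k) = 0 := by
  have h := S.G_skew i q hq k (S.V i q)
  rw [S.G_V hq, map_zero] at h
  rw [S.v_dual hq]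
  linarith

theorem H_eq_neg_J_G (hq : q ∈ S.dom i) (k : Tan E q) :
    S.H i q k = -cplxJ E q (S.G i q k) := by
  rw [S.H_eq i q hq, S.G_J i q hq]

theorem H_skew (hq : q ∈ S.dom i) (k l : Tan E q) :
    S.g.inner q k (S.H i q l) = -S.g.inner q (S.H i q k) l := by
  rw [S.H_eq i q hq l, S.G_skew i q hq, inner_J, H_eq_neg_J_G S hq k, map_neg]
  rfl

theorem H_J (hq : q ∈ S.dom i) (k : Tan E q) : S.H i q (cplxJ E q k) = -cplxJ E q (S.H i q k) := by
  rw [S.H_eq_neg_J_G hq, S.H_eq i q hq k]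

theorem H_G (hq : q ∈ S.dom i) (k : Tan E q) : S.H i q (S.G i q k) = -S.G i q (S.H i q k) := by
  rw [S.H_eq i q hq, S.H_eq_neg_J_G hq, map_neg, neg_neg]

theorem u_H (hq : q ∈ S.dom i) (k : Tan E q) : S.u i q (S.H i q k) = 0 := by
  rw [S.H_eq i q hq, S.u_G hq]

/-- On overlaps the forms u, v of one index are linear combinations of those of the other, so one
index decides membership. -/
theorem mem_horizontal_iff (hq : q ∈ S.dom i) (k : Tan E q) :
    k ∈ S.horizontal q ↔ S.u i q k = 0 ∧ S.v i q k = 0 := by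
  simp only [horizontal, Submodule.mem_iInf]
  refine ⟨fun h => h i hq, fun h j hj => ?_⟩
  obtain ⟨c, d, -, hu, hv, -, -⟩ := S.overlap i j q ⟨hq, hj⟩
  constructor
  · change S.u j q k = 0
    rw [hu]
    change c * S.u i q k - d * S.v i q k = 0
    rw [h.1, h.2]; ring
  · change S.v j q k = 0
    rw [hv]
    change d * S.u i q k + c * S.v i q k = 0
    rw [h.1, h.2]; ring

/-- The structure with `(u, v, U, V, G, H)` replaced by `(v, -u, V, -U, H, -G)`. -/
def rot : ComplexAlmostContactMetric E N ι where
  g := S.g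
  hermitian := S.hermitian
  dom := S.dom
  isOpen_dom := S.isOpen_dom
  cover := S.cover
  u := S.v
  v := fun i q => -S.u i q
  U := S.V
  V := fun i q => -S.U i q
  G := S.H
  H := fun i q => -S.G i q
  smooth_u := S.smooth_v
  smooth_v := fun i => ContMDiffOn.neg_section (S.smooth_u i)
  smooth_U := S.smooth_V
  smooth_V := fun i => ContMDiffOn.neg_section (S.smooth_U i)
  smooth_G := S.smooth_H
  smooth_H := fun i => ContMDiffOn.neg_section (S.smooth_G i)
  v_eq := fun i q hq k => by
    rw [S.v_eq i q hq, cplxJ_cplxJ, map_neg]; rfl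
  V_eq := fun i q hq => by rw [S.J_V hq]
  H_eq := fun i q hq k => by
    rw [S.H_eq i q hq, cplxJ_cplxJ, map_neg]; rfl
  u_dual := fun i q hq k => S.v_dual hq k
  u_U := fun i q hq => S.v_V hq
  G_sq := fun i q hq k => by
    rw [S.H_sq i q hq k]
    change _ = -k + S.v i q k • S.V i q + (-(S.u i q k)) • (-S.U i q)
    module
  H_sq := fun i q hq k => by
    change -(S.G i q (-(S.G i q k))) = -k + S.v i q k • S.V i q + (-(S.u i q k)) • (-S.U i q)
    rw [map_neg, S.G_sq i q hq k]
    module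
  G_J := fun i q hq k => S.H_J hq k
  G_U := fun i q hq => S.H_V hq
  G_skew := fun i q hq k l => S.H_skew hq k l
  -- The quarter turn commutes with the rotations relating two indices, so the same c and d work.
  overlap := fun i j q hq => by
    obtain ⟨c, d, h, hu, hv, hG, hH⟩ := S.overlap i j q hq
    refine ⟨c, d, h, ?_, ?_, ?_, ?_⟩
    · rw [hv]; module
    · rw [hu]; module
    · rw [hH]; module
    · rw [hG]; module

theorem rot_horizontal (q : N) : S.rot.horizontal q = S.horizontal q := by
  obtain ⟨i, hi⟩ := S.cover q
  ext k
  rw [S.mem_horizontal_iff hi, S.rot.mem_horizontal_iff (show q ∈ S.rot.dom i from hi)]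
  change S.v i q k = 0 ∧ -(S.u i q k) = 0 ↔ _
  rw [neg_eq_zero, and_comm]

end ComplexAlmostContactMetric

end ContactAlgebra

/-! ### First derivatives of U, V, G and the effect of the rotation -/

section ContactCalculus

variable {E : Type*} [NormedAddCommGroup E] [NormedSpace ℂ E] [FiniteDimensional ℂ E]
  {N : Type*} [TopologicalSpace N] [ChartedSpace E N] [IsManifold 𝓘(ℂ, E) ω N] {ι : Type*}

namespace ComplexAlmostContactMetric

variable (S : ComplexAlmostContactMetric E N ι) {i : ι} {q : N}

theorem mem_nhds_dom (hq : q ∈ S.dom i) : S.dom i ∈ 𝓝 q := (S.isOpen_dom i).mem_nhds hq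

theorem diffField_U (hq : q ∈ S.dom i) : DiffField (S.U i) q :=
  (S.smooth_U i).diffAlong (S.isOpen_dom i) hq

theorem diffField_V (hq : q ∈ S.dom i) : DiffField (S.V i) q :=
  (S.smooth_V i).diffAlong (S.isOpen_dom i) hq

theorem diffEndo_G (hq : q ∈ S.dom i) : DiffEndo (S.G i) q :=
  (S.smooth_G i).diffEndo (S.isOpen_dom i) hq

/-- `∇_k U` -/
abbrev nablaU (i : ι) (q : N) (k : Tan E q) : Tan E q := covDeriv S.g (S.U i) q k

/-- `(∇_x G) y` -/
abbrev nablaG (i : ι) (q : N) : Tan E q →ₗ[ℝ] Tan E q →ₗ[ℝ] Tan E q := covEndo S.g (S.G i) q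

theorem inner_nablaU_U (hq : q ∈ S.dom i) (k : Tan E q) :
    S.g.inner q (S.nablaU i q k) (S.U i q) = 0 := by
  have h := mvfderiv_metric_field S.g (S.diffField_U hq) (S.diffField_U hq) k
  have h1 : (fun x => S.g.inner x (S.U i x) (S.U i x)) =ᶠ[𝓝 q] fun _ => (1 : ℝ) := by
    filter_upwards [S.mem_nhds_dom hq] with x hx
    rw [← S.u_dual i x hx, S.u_U i x hx]
  rw [mvfderiv_congr h1, mvfderiv_const, S.g.symm q (S.U i q)] at h
  change (0 : ℝ) = _ at h
  linarith

/-- Obtained by differentiating g(U, V) = 0; it is the reason why σ is unchanged by the rotation. -/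
theorem inner_nablaU_V_eq (hq : q ∈ S.dom i) (k : Tan E q) :
    S.g.inner q (covDeriv S.g (S.V i) q k) (S.U i q) = -S.sigma i q k := by
  have h := mvfderiv_metric_field S.g (S.diffField_U hq) (S.diffField_V hq) k
  have h1 : (fun x => S.g.inner x (S.U i x) (S.V i x)) =ᶠ[𝓝 q] fun _ => (0 : ℝ) := by
    filter_upwards [S.mem_nhds_dom hq] with x hx
    rw [← S.v_dual hx, S.v_U hx]
  rw [mvfderiv_congr h1, mvfderiv_const, S.g.symm q (S.U i q)] at h
  change (0 : ℝ) = S.sigma i q k + _ at h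
  linarith

/-- Obtained by differentiating GU = 0. -/
theorem nablaG_U (hq : q ∈ S.dom i) (k : Tan E q) :
    S.nablaG i q k (S.U i q) = -S.G i q (S.nablaU i q k) := by
  have h := covDeriv_endo S.g (S.diffEndo_G hq) (S.diffField_U hq) k
  have h1 : ∀ᶠ x in 𝓝 q, S.G i x (S.U i x) = 0 := by
    filter_upwards [S.mem_nhds_dom hq] with x hx
    exact S.G_U i x hx
  rw [covDeriv_congr S.g h1, covDeriv_zero] at h
  exact eq_neg_of_add_eq_zero_left h.symm

theorem nablaG_V (hq : q ∈ S.dom i) (k : Tan E q) :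
    S.nablaG i q k (S.V i q) = -S.G i q (covDeriv S.g (S.V i) q k) := by
  have h := covDeriv_endo S.g (S.diffEndo_G hq) (S.diffField_V hq) k
  have h1 : ∀ᶠ x in 𝓝 q, S.G i x (S.V i x) = 0 := by
    filter_upwards [S.mem_nhds_dom hq] with x hx
    exact S.G_V hx
  rw [covDeriv_congr S.g h1, covDeriv_zero] at h
  exact eq_neg_of_add_eq_zero_left h.symm

theorem exists_diffField (q : N) (x : Tan E q) : ∃ K : ∀ q : N, Tan E q, DiffField K q ∧ K q = x := by
  obtain ⟨W, K, hW, hq, hK, hx⟩ := exists_smoothField_extension q x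
  exact ⟨K, hK.diffAlong hW hq, hx⟩

/-- Obtained by differentiating g(Y, GZ) = -g(GY, Z); the terms with ∇Y and ∇Z cancel by skewness of
G itself. -/
theorem nablaG_skew (hq : q ∈ S.dom i) (x y z : Tan E q) :
    S.g.inner q (S.nablaG i q x y) z = -S.g.inner q (S.nablaG i q x z) y := by
  obtain ⟨Y, hY, rfl⟩ := exists_diffField q y
  obtain ⟨Z, hZ, rfl⟩ := exists_diffField q z
  have hGY : DiffField (fun x => S.G i x (Y x)) q := DiffAlong.endo (S.diffEndo_G hq) hY
  have hGZ : DiffField (fun x => S.G i x (Z x)) q := DiffAlong.endo (S.diffEndo_G hq) hZ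
  have h1 := mvfderiv_metric_field S.g hY hGZ x
  have h2 := mvfderiv_metric_field S.g hGY hZ x
  have h3 : (fun x => S.g.inner x (Y x) (S.G i x (Z x))) =ᶠ[𝓝 q]
      -(fun x => S.g.inner x (S.G i x (Y x)) (Z x)) := by
    filter_upwards [S.mem_nhds_dom hq] with x hx
    exact S.G_skew i x hx _ _
  rw [mvfderiv_congr h3, mvfderiv_neg] at h1
  change -(mvfderiv 𝓘(ℝ, E) (fun x => S.g.inner x (S.G i x (Y x)) (Z x)) q x) = _ at h1
  rw [h2, covDeriv_endo S.g (S.diffEndo_G hq) hZ, covDeriv_endo S.g (S.diffEndo_G hq) hY,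
    map_add, map_add] at h1
  have e1 := S.G_skew i q hq (covDeriv S.g Y q x) (Z q)
  have e2 := S.G_skew i q hq (Y q) (covDeriv S.g Z q x)
  have e3 := S.g.symm q (Y q) (S.nablaG i q x (Z q))
  have e4 : (S.g.inner q (S.nablaG i q x (Y q)) + S.g.inner q (S.G i q (covDeriv S.g Y q x))) (Z q)
    = S.g.inner q (S.nablaG i q x (Y q)) (Z q) + S.g.inner q (S.G i q (covDeriv S.g Y q x)) (Z q) :=
    rfl
  rw [e4] at h1
  linarith

/-- For a torsion-free metric connection 2du(x, y) = g(∇_x U, y) - g(∇_y U, x), so the contact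
equation prescribes the skew part of ∇U. -/
theorem contact_nablaU (hc : S.IsContactMetric) (hq : q ∈ S.dom i) (x y : Tan E q) :
    S.g.inner q (S.nablaU i q x) y - S.g.inner q (S.nablaU i q y) x
      = 2 * S.g.inner q x (S.G i q y) + S.sigma i q x * S.g.inner q y (S.V i q)
        - S.sigma i q y * S.g.inner q x (S.V i q) := by
  obtain ⟨W, K, hW, hqW, hK, rfl⟩ := exists_smoothField_extension q x
  obtain ⟨W', L, hW', hqW', hL, rfl⟩ := exists_smoothField_extension q y
  have h := (hc i (W ∩ W' ∩ S.dom i) K L ((hW.inter hW').inter (S.isOpen_dom i))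
    Set.inter_subset_right (hK.mono fun x hx => hx.1.1) (hL.mono fun x hx => hx.1.2) q
    ⟨⟨hqW, hqW'⟩, hq⟩).1
  have hK' := hK.diffAlong hW hqW
  have hL' := hL.diffAlong hW' hqW'
  have key : ∀ {K : ∀ q : N, Tan E q}, DiffField K q → ∀ k : Tan E q,
      mvfderiv 𝓘(ℝ, E) (fun x => S.u i x (K x)) q k
        = S.g.inner q (covDeriv S.g K q k) (S.U i q) + S.g.inner q (K q) (S.nablaU i q k) := by
    intro K hK k
    rw [← mvfderiv_metric_field S.g hK (S.diffField_U hq)]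
    refine congrArg (fun T : Tan E q →L[ℝ] ℝ => T k) (mvfderiv_congr ?_)
    filter_upwards [S.mem_nhds_dom hq] with x hx
    exact S.u_dual i x hx _
  unfold extDer wedge at h
  rw [key hK', key hL', ← covDeriv_sub_covDeriv S.g hK' hL', map_sub, S.u_dual i q hq,
    S.u_dual i q hq, S.v_dual hq, S.v_dual hq] at h
  have e1 := S.g.symm q (S.nablaU i q (K q)) (L q)
  have e2 := S.g.symm q (S.nablaU i q (L q)) (K q)
  linarith

/-- Half of Korkmaz' normality condition: the part that concerns the tensor `S`. -/
def IsSemiNormal : Prop :=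
  ∀ (i : ι) (W : Set N), IsOpen W → W ⊆ S.dom i →
    (∀ K L : ∀ q : N, Tan E q, IsSmoothField K W → IsSmoothField L W →
      (∀ q ∈ W, K q ∈ S.horizontal q) → (∀ q ∈ W, L q ∈ S.horizontal q) →
      ∀ q ∈ W, S.tensorS i K L q = 0) ∧
    (∀ K : ∀ q : N, Tan E q, IsSmoothField K W → ∀ q ∈ W, S.tensorS i K (S.U i) q = 0)

variable {S}

theorem IsNormal.isSemiNormal (h : S.IsNormal) : S.IsSemiNormal := fun i W hW hWd =>
  ⟨fun K L hK hL hK' hL' q hq => ((h i W hW hWd).1 K L hK hL hK' hL' q hq).1,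
    fun K hK q hq => ((h i W hW hWd).2 K hK q hq).1⟩

theorem rot_sigma (hq : q ∈ S.dom i) (k : Tan E q) : S.rot.sigma i q k = S.sigma i q k := by
  change S.g.inner q (covDeriv S.g (S.V i) q k) (-S.U i q) = _
  rw [map_neg, S.inner_nablaU_V_eq hq, neg_neg]

/-- The rotation exchanges the equations for du and dv up to sign, σ being unchanged. -/
theorem IsContactMetric.rot (h : S.IsContactMetric) : S.rot.IsContactMetric := by
  intro i W K L hW hWd hK hL q hq
  have hd : q ∈ S.dom i := hWd hq
  obtain ⟨h1, h2⟩ := h i W K L hW hWd hK hL q hq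
  constructor
  · refine Eq.trans h2 ?_
    unfold wedge
    rw [rot_sigma hd, rot_sigma hd]
    change _ = S.g.inner q (K q) (S.H i q (L q)) + (1 / 2) *
      (S.sigma i q (K q) * (-(S.u i q (L q))) - S.sigma i q (L q) * (-(S.u i q (K q))))
    ring
  · have h3 : extDer (S.rot.v i) K L q = -extDer (S.u i) K L q := by
      have e : ∀ (K : ∀ q : N, Tan E q) (k : Tan E q),
          mvfderiv 𝓘(ℝ, E) (fun x => S.rot.v i x (K x)) q k
            = -mvfderiv 𝓘(ℝ, E) (fun x => S.u i x (K x)) q k := fun K k =>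
        congrArg (fun T : Tan E q →L[ℝ] ℝ => T k)
          (mvfderiv_neg (g := fun x => S.u i x (K x)) (I := 𝓘(ℝ, E)))
      unfold extDer
      rw [e, e]
      change (1 / 2) * (_ - _ - -(S.u i q _)) = _
      ring
    rw [h3, h1]
    unfold wedge
    rw [rot_sigma hd, rot_sigma hd]
    change _ = S.g.inner q (K q) (-(S.G i q (L q))) - (1 / 2) *
      (S.sigma i q (K q) * (S.v i q (L q)) - S.sigma i q (L q) * (S.v i q (K q)))
    rw [map_neg]
    ring

/-- By HG = -GH the tensor S of the rotated structure is the tensor T of the original one. So each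
fact derived from S for U also holds, through T, for V. -/
theorem IsNormal.rot_isSemiNormal (h : S.IsNormal) : S.rot.IsSemiNormal := by
  have key : ∀ i q, q ∈ S.dom i → ∀ K L, S.rot.tensorS i K L q = S.tensorT i K L q := by
    intro i q hq K L
    unfold tensorS tensorT
    rw [rot_sigma hq, rot_sigma hq, rot_sigma hq, rot_sigma hq]
    change nijenhuis S.g (S.H i) K L q
      + (2 * S.g.inner q (K q) (S.H i q (L q))) • S.V i q
      - (2 * S.g.inner q (K q) (-(S.G i q (L q)))) • -S.U i q
      + (2 : ℝ) • (-(S.u i q (L q)) • -(S.G i q (K q)) - -(S.u i q (K q)) • -(S.G i q (L q)))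
      + S.sigma i q (S.H i q (L q)) • -(S.G i q (K q))
      - S.sigma i q (S.H i q (K q)) • -(S.G i q (L q))
      + S.sigma i q (K q) • S.H i q (-(S.G i q (L q)))
      - S.sigma i q (L q) • S.H i q (-(S.G i q (K q))) = _
    rw [map_neg, map_neg, map_neg, S.H_G hq, S.H_G hq]
    module
  intro i W hW hWd
  refine ⟨fun K L hK hL hK' hL' q hq => ?_, fun K hK q hq => ?_⟩
  · rw [key i q (hWd hq)]
    simp only [rot_horizontal] at hK' hL'
    exact ((h i W hW hWd).1 K L hK hL hK' hL' q hq).2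
  · rw [key i q (hWd hq)]
    exact ((h i W hW hWd).2 K hK q hq).2

end ComplexAlmostContactMetric

end ContactCalculus

/-! ### The identity d(du) = 0 as a cyclic formula for ∇G -/

section ContactCalculus

variable {E : Type*} [NormedAddCommGroup E] [NormedSpace ℂ E] [FiniteDimensional ℂ E]
  {N : Type*} [TopologicalSpace N] [ChartedSpace E N] [IsManifold 𝓘(ℂ, E) ω N] {ι : Type*}

/-- The Jacobi identity, rewritten in cyclic form from its Leibniz form. -/
theorem mlieBracket_cyclic {X Y Z : ∀ q : N, Tan E q} {W : Set N} (hW : IsOpen W)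
    (hX : IsSmoothField X W) (hY : IsSmoothField Y W) (hZ : IsSmoothField Z W) {q : N}
    (hq : q ∈ W) :
    VectorField.mlieBracket 𝓘(ℝ, E) (VectorField.mlieBracket 𝓘(ℝ, E) X Y) Z q
      + VectorField.mlieBracket 𝓘(ℝ, E) (VectorField.mlieBracket 𝓘(ℝ, E) Y Z) X q
      + VectorField.mlieBracket 𝓘(ℝ, E) (VectorField.mlieBracket 𝓘(ℝ, E) Z X) Y q = 0 := by
  have : CompleteSpace E := FiniteDimensional.complete ℂ E
  have h2 : ∀ {K : ∀ q : N, Tan E q}, IsSmoothField K W →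
      ContMDiffAt 𝓘(ℝ, E) 𝓘(ℝ, E).tangent (minSmoothness ℝ 2)
        (fun q => (⟨q, K q⟩ : TangentBundle 𝓘(ℝ, E) N)) q := fun hK =>
    (hK.contMDiffAt hW hq).of_le (by
      rw [minSmoothness_of_isRCLikeNormedField]; exact WithTop.coe_le_coe.2 le_top)
  have h := VectorField.leibniz_identity_mlieBracket_apply (h2 hX) (h2 hY) (h2 hZ)
  have hXZ := (hX.mlieBracket hW hZ).diffAlong hW hq
  have e1 : VectorField.mlieBracket 𝓘(ℝ, E) (VectorField.mlieBracket 𝓘(ℝ, E) Z X) Y q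
      = VectorField.mlieBracket 𝓘(ℝ, E) Y (VectorField.mlieBracket 𝓘(ℝ, E) X Z) q := by
    rw [VectorField.mlieBracket_swap_apply, VectorField.mlieBracket_swap (V := Z) (W := X)]
    have := VectorField.mlieBracket_const_smul_right (V := Y) (c := (-1 : ℝ)) hXZ
    simp only [neg_smul, one_smul] at this
    rw [this, neg_neg]
  rw [e1, VectorField.mlieBracket_swap_apply (V := VectorField.mlieBracket 𝓘(ℝ, E) Y Z), h]
  abel

namespace ComplexAlmostContactMetric

variable (S : ComplexAlmostContactMetric E N ι) {i : ι} {q : N}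

/-- With u constant and v zero on both fields, only the bracket term of each exterior derivative
survives, and σ ∧ v vanishes. In this way σ never has to be differentiated. -/
theorem inner_G_eq_bracket (hc : S.IsContactMetric) {W : Set N} (hW : IsOpen W)
    (hWd : W ⊆ S.dom i) {Y Z : ∀ q : N, Tan E q} (hY : IsSmoothField Y W) (hZ : IsSmoothField Z W)
    {b c : ℝ} (hYu : ∀ x ∈ W, S.u i x (Y x) = b) (hZu : ∀ x ∈ W, S.u i x (Z x) = c)
    (hYv : ∀ x ∈ W, S.v i x (Y x) = 0) (hZv : ∀ x ∈ W, S.v i x (Z x) = 0) (hq : q ∈ W) :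
    S.g.inner q (Y q) (S.G i q (Z q))
        = -(1 / 2) * S.u i q (VectorField.mlieBracket 𝓘(ℝ, E) Y Z q) ∧
      S.v i q (VectorField.mlieBracket 𝓘(ℝ, E) Y Z q) = -2 * S.g.inner q (Y q) (S.H i q (Z q))
        + S.sigma i q (Y q) * c - S.sigma i q (Z q) * b := by
  have key : ∀ (α : ∀ q : N, Tan E q →L[ℝ] ℝ) (K : ∀ q : N, Tan E q) (a : ℝ) (k : Tan E q),
      (∀ x ∈ W, α x (K x) = a) → mvfderiv 𝓘(ℝ, E) (fun x => α x (K x)) q k = 0 := by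
    intro α K a k h
    have : (fun x => α x (K x)) =ᶠ[𝓝 q] fun _ => a := by
      filter_upwards [hW.mem_nhds hq] with x hx
      exact h x hx
    rw [mvfderiv_congr this, mvfderiv_const]
    rfl
  obtain ⟨h1, h2⟩ := hc i W Y Z hW hWd hY hZ q hq
  unfold extDer wedge at h1 h2
  rw [key _ Z c _ hZu, key _ Y b _ hYu, hYv q hq, hZv q hq] at h1
  rw [key _ Z 0 _ hZv, key _ Y 0 _ hYv, hYu q hq, hZu q hq] at h2
  constructor <;> linarith

/-- The form `g(·, G ·)` is closed on `ker v` up to `σ ∧ g(·, H ·)`. -/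
theorem nablaG_cyclic_field (hc : S.IsContactMetric) {W : Set N} (hW : IsOpen W)
    (hWd : W ⊆ S.dom i) {X Y Z : ∀ q : N, Tan E q} (hX : IsSmoothField X W)
    (hY : IsSmoothField Y W) (hZ : IsSmoothField Z W)
    {a b c : ℝ} (hXu : ∀ x ∈ W, S.u i x (X x) = a) (hYu : ∀ x ∈ W, S.u i x (Y x) = b)
    (hZu : ∀ x ∈ W, S.u i x (Z x) = c) (hXv : ∀ x ∈ W, S.v i x (X x) = 0)
    (hYv : ∀ x ∈ W, S.v i x (Y x) = 0) (hZv : ∀ x ∈ W, S.v i x (Z x) = 0) (hq : q ∈ W) :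
    S.g.inner q (Y q) (S.nablaG i q (X q) (Z q)) + S.g.inner q (Z q) (S.nablaG i q (Y q) (X q))
        + S.g.inner q (X q) (S.nablaG i q (Z q) (Y q))
      = S.sigma i q (X q) * S.g.inner q (Y q) (S.H i q (Z q))
        + S.sigma i q (Y q) * S.g.inner q (Z q) (S.H i q (X q))
        + S.sigma i q (Z q) * S.g.inner q (X q) (S.H i q (Y q)) := by
  have hd := hWd hq
  -- The derivative of g(Y, GZ) is computed in two ways: by the Leibniz rule here, and through u([Y,
  -- Z]) in `step2`.
  have step1 : ∀ {X Y Z : ∀ q : N, Tan E q}, DiffField Y q → DiffField Z q →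
      mvfderiv 𝓘(ℝ, E) (fun x => S.g.inner x (Y x) (S.G i x (Z x))) q (X q)
        = S.g.inner q (Y q) (S.nablaG i q (X q) (Z q))
          + S.g.inner q (covDeriv S.g Y q (X q)) (S.G i q (Z q))
          - S.g.inner q (covDeriv S.g Z q (X q)) (S.G i q (Y q)) := by
    intro X Y Z hY hZ
    rw [mvfderiv_metric_field S.g hY (DiffAlong.endo (S.diffEndo_G hd) hZ),
      covDeriv_endo S.g (S.diffEndo_G hd) hZ, map_add, S.G_skew i q hd (Y q),
      S.g.symm q (S.G i q (Y q))]
    ring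
  have step2 : ∀ {X Y Z : ∀ q : N, Tan E q} {b c : ℝ}, IsSmoothField Y W → IsSmoothField Z W →
      (∀ x ∈ W, S.u i x (Y x) = b) → (∀ x ∈ W, S.u i x (Z x) = c) →
      (∀ x ∈ W, S.v i x (Y x) = 0) → (∀ x ∈ W, S.v i x (Z x) = 0) →
      mvfderiv 𝓘(ℝ, E) (fun x => S.g.inner x (Y x) (S.G i x (Z x))) q (X q)
        = -(1 / 2) * mvfderiv 𝓘(ℝ, E)
          (fun x => S.u i x (VectorField.mlieBracket 𝓘(ℝ, E) Y Z x)) q (X q) := by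
    intro X Y Z b c hY hZ hYu hZu hYv hZv
    have h1 : (fun x => S.g.inner x (Y x) (S.G i x (Z x))) =ᶠ[𝓝 q]
        (-(1 / 2) : ℝ) • fun x => S.u i x (VectorField.mlieBracket 𝓘(ℝ, E) Y Z x) := by
      filter_upwards [hW.mem_nhds hq] with x hx
      exact (S.inner_G_eq_bracket hc hW hWd hY hZ hYu hZu hYv hZv hx).1
    have hdiff : MDifferentiableAt 𝓘(ℝ, E) 𝓘(ℝ, ℝ)
        (fun x => S.u i x (VectorField.mlieBracket 𝓘(ℝ, E) Y Z x)) q :=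
      ((IsSmoothForm.contMDiffOn_apply (ContMDiffOn.mono (S.smooth_u i) hWd)
        (hY.mlieBracket hW hZ)).contMDiffAt (hW.mem_nhds hq)).mdifferentiableAt (by simp)
    rw [mvfderiv_congr h1]
    have h2 := mvfderiv_smul (a := fun _ : N => (-(1 / 2) : ℝ)) (I := 𝓘(ℝ, E)) (x := q)
      mdifferentiableAt_const hdiff
    refine (congrArg (fun T : Tan E q →L[ℝ] ℝ => T (X q)) h2).trans ?_
    rw [mvfderiv_const]
    simp
  -- This is the contact equation for ([X, Y], Z). Since v([X, Y]) need not vanish, σ ∧ v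
  -- contributes, and the dv equation evaluates it; this produces the σ, H terms.
  have step3 : ∀ {X Y Z : ∀ q : N, Tan E q} {a b c : ℝ}, IsSmoothField X W → IsSmoothField Y W →
      IsSmoothField Z W → (∀ x ∈ W, S.u i x (X x) = a) →
      (∀ x ∈ W, S.u i x (Y x) = b) → (∀ x ∈ W, S.u i x (Z x) = c) →
      (∀ x ∈ W, S.v i x (X x) = 0) →
      (∀ x ∈ W, S.v i x (Y x) = 0) → (∀ x ∈ W, S.v i x (Z x) = 0) →
      S.g.inner q (covDeriv S.g Y q (X q)) (S.G i q (Z q))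
        - S.g.inner q (covDeriv S.g X q (Y q)) (S.G i q (Z q))
      = -(1 / 2) * mvfderiv 𝓘(ℝ, E)
          (fun x => S.u i x (VectorField.mlieBracket 𝓘(ℝ, E) X Y x)) q (Z q)
        - (1 / 2) * S.u i q (VectorField.mlieBracket 𝓘(ℝ, E)
          (VectorField.mlieBracket 𝓘(ℝ, E) X Y) Z q)
        + (1 / 2) * S.sigma i q (Z q) * (-2 * S.g.inner q (X q) (S.H i q (Y q))
          + S.sigma i q (X q) * b - S.sigma i q (Y q) * a) := by
    intro X Y Z a b c hX hY hZ hXu hYu hZu hXv hYv hZv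
    have h1 := (hc i W _ Z hW hWd (hX.mlieBracket hW hY) hZ q hq).1
    have h2 := (S.inner_G_eq_bracket hc hW hWd hX hY hXu hYu hXv hYv hq).2
    have h3 : (fun x => S.u i x (Z x)) =ᶠ[𝓝 q] fun _ => c := by
      filter_upwards [hW.mem_nhds hq] with x hx
      exact hZu x hx
    unfold extDer wedge at h1
    rw [mvfderiv_congr h3, mvfderiv_const, hZv q hq, h2] at h1
    have h4 : S.g.inner q (VectorField.mlieBracket 𝓘(ℝ, E) X Y q) (S.G i q (Z q))
        = S.g.inner q (covDeriv S.g Y q (X q)) (S.G i q (Z q))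
          - S.g.inner q (covDeriv S.g X q (Y q)) (S.G i q (Z q)) := by
      rw [← covDeriv_sub_covDeriv S.g (hX.diffAlong hW hq) (hY.diffAlong hW hq), map_sub]
      rfl
    rw [h4] at h1
    change (1 / 2) * ((0 : ℝ) - _ - _) = _ at h1
    linarith
  have hX' := hX.diffAlong hW hq
  have hY' := hY.diffAlong hW hq
  have hZ' := hZ.diffAlong hW hq
  have a1 := step1 (X := X) hY' hZ'
  have a2 := step1 (X := Y) hZ' hX'
  have a3 := step1 (X := Z) hX' hY'
  rw [step2 hY hZ hYu hZu hYv hZv] at a1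
  rw [step2 hZ hX hZu hXu hZv hXv] at a2
  rw [step2 hX hY hXu hYu hXv hYv] at a3
  have b1 := step3 hX hY hZ hXu hYu hZu hXv hYv hZv
  have b2 := step3 hY hZ hX hYu hZu hXu hYv hZv hXv
  have b3 := step3 hZ hX hY hZu hXu hYu hZv hXv hYv
  have j := congrArg (S.u i q) (mlieBracket_cyclic hW hX hY hZ hq)
  rw [map_add, map_add, map_zero] at j
  -- In the cyclic sum the derivatives of u of a bracket cancel, the double brackets vanish by
  -- Jacobi, and the products of two values of σ cancel in pairs.
  linear_combination -a1 - a2 - a3 - b1 - b2 - b3 + (1 / 2) * j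

end ComplexAlmostContactMetric

end ContactCalculus

/-! ### Formulas for ∇U and ∇G under normality -/

section ContactCurvature

variable {E : Type*} [NormedAddCommGroup E] [NormedSpace ℂ E] [FiniteDimensional ℂ E]
  {N : Type*} [TopologicalSpace N] [ChartedSpace E N] [IsManifold 𝓘(ℂ, E) ω N] {ι : Type*}

namespace ComplexAlmostContactMetric

variable (S : ComplexAlmostContactMetric E N ι) {i : ι} {q : N}

/-- Any extension is corrected by multiples of U and V that vanish at q. Keeping u constant, rather
than zero, allows x = U as well as horizontal x. -/
theorem exists_smoothField_ker_v (hq : q ∈ S.dom i) (x : Tan E q) (hx : S.v i q x = 0) :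
    ∃ (W : Set N) (K : ∀ q : N, Tan E q), IsOpen W ∧ q ∈ W ∧ W ⊆ S.dom i ∧ IsSmoothField K W ∧
      (∀ y ∈ W, S.u i y (K y) = S.u i q x) ∧ (∀ y ∈ W, S.v i y (K y) = 0) ∧ K q = x := by
  obtain ⟨W, K, hW, hqW, hK, rfl⟩ := exists_smoothField_extension q x
  have hK' : IsSmoothField K (W ∩ S.dom i) := hK.mono Set.inter_subset_left
  have hU : IsSmoothField (S.U i) (W ∩ S.dom i) := (S.smooth_U i).mono Set.inter_subset_right
  have hV : IsSmoothField (S.V i) (W ∩ S.dom i) := (S.smooth_V i).mono Set.inter_subset_right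
  have hu : IsSmoothForm (S.u i) (W ∩ S.dom i) :=
    ContMDiffOn.mono (S.smooth_u i) Set.inter_subset_right
  have hv : IsSmoothForm (S.v i) (W ∩ S.dom i) :=
    ContMDiffOn.mono (S.smooth_v i) Set.inter_subset_right
  refine ⟨W ∩ S.dom i, fun y => K y - (S.u i y (K y) - S.u i q (K q)) • S.U i y
    - S.v i y (K y) • S.V i y, hW.inter (S.isOpen_dom i), ⟨hqW, hq⟩, Set.inter_subset_right,
    (hK'.sub (IsSmoothField.smul ((hu.contMDiffOn_apply hK').sub contMDiffOn_const) hU)).sub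
      (IsSmoothField.smul (hv.contMDiffOn_apply hK') hV), fun y hy => ?_, fun y hy => ?_, ?_⟩
  · simp only [map_sub, map_smul, S.u_U i y hy.2, S.u_V hy.2, smul_eq_mul]; ring
  · simp only [map_sub, map_smul, S.v_U hy.2, S.v_V hy.2, smul_eq_mul]; ring
  · change K q - (S.u i q (K q) - S.u i q (K q)) • S.U i q - S.v i q (K q) • S.V i q = K q
    rw [hx]; module

/-- The form `g(·, G ·)` is closed on `ker v` up to `σ ∧ g(·, H ·)`. -/
theorem nablaG_cyclic (hc : S.IsContactMetric) (hq : q ∈ S.dom i) {x y z : Tan E q}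
    (hx : S.v i q x = 0) (hy : S.v i q y = 0) (hz : S.v i q z = 0) :
    S.g.inner q y (S.nablaG i q x z) + S.g.inner q z (S.nablaG i q y x)
        + S.g.inner q x (S.nablaG i q z y)
      = S.sigma i q x * S.g.inner q y (S.H i q z) + S.sigma i q y * S.g.inner q z (S.H i q x)
        + S.sigma i q z * S.g.inner q x (S.H i q y) := by
  obtain ⟨W, X, hW, hqW, hWd, hX, hXu, hXv, rfl⟩ := S.exists_smoothField_ker_v hq x hx
  obtain ⟨W', Y, hW', hqW', -, hY, hYu, hYv, rfl⟩ := S.exists_smoothField_ker_v hq y hy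
  obtain ⟨W'', Z, hW'', hqW'', -, hZ, hZu, hZv, rfl⟩ := S.exists_smoothField_ker_v hq z hz
  have h1 : W ∩ (W' ∩ W'') ⊆ W := fun x hx => hx.1
  have h2 : W ∩ (W' ∩ W'') ⊆ W' := fun x hx => hx.2.1
  have h3 : W ∩ (W' ∩ W'') ⊆ W'' := fun x hx => hx.2.2
  exact S.nablaG_cyclic_field hc (hW.inter (hW'.inter hW'')) (h1.trans hWd) (hX.mono h1)
    (hY.mono h2) (hZ.mono h3) (fun x hx => hXu x (h1 hx)) (fun x hx => hYu x (h2 hx))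
    (fun x hx => hZu x (h3 hx)) (fun x hx => hXv x (h1 hx)) (fun x hx => hYv x (h2 hx))
    (fun x hx => hZv x (h3 hx)) ⟨hqW, hqW', hqW''⟩

theorem sigma_zero (i : ι) (q : N) : S.sigma i q 0 = 0 := by
  have h : covDeriv S.g (S.U i) q 0 = 0 := by
    rw [covDeriv_eq_covDerivAlong, covDerivAlong_eq, mfderiv_id_apply, map_zero, map_zero]
    exact add_zero (0 : E)
  unfold sigma
  rw [h, map_zero]
  rfl

theorem nijenhuis_G (hq : q ∈ S.dom i) {X Y : ∀ q : N, Tan E q} (hX : DiffField X q)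
    (hY : DiffField Y q) :
    nijenhuis S.g (S.G i) X Y q = S.nablaG i q (S.G i q (X q)) (Y q)
      - S.nablaG i q (S.G i q (Y q)) (X q) - S.G i q (S.nablaG i q (X q) (Y q))
      + S.G i q (S.nablaG i q (Y q) (X q)) := by
  unfold nijenhuis
  rw [covDerivEndo_eq_covEndo S.g (S.diffEndo_G hq) hY,
    covDerivEndo_eq_covEndo S.g (S.diffEndo_G hq) hX,
    covDerivEndo_eq_covEndo S.g (S.diffEndo_G hq) hY,
    covDerivEndo_eq_covEndo S.g (S.diffEndo_G hq) hX]

variable {S}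

/-- The equation S(x, y) = 0 at a point, with the torsion expanded through ∇G. Horizontality removes
the terms containing v. -/
theorem IsSemiNormal.nablaG_horizontal (hn : S.IsSemiNormal) (hq : q ∈ S.dom i) {x y : Tan E q}
    (hx : S.u i q x = 0 ∧ S.v i q x = 0) (hy : S.u i q y = 0 ∧ S.v i q y = 0) :
    S.nablaG i q (S.G i q x) y - S.nablaG i q (S.G i q y) x - S.G i q (S.nablaG i q x y)
      + S.G i q (S.nablaG i q y x) + (2 * S.g.inner q x (S.G i q y)) • S.U i q
      - (2 * S.g.inner q x (S.H i q y)) • S.V i q + S.sigma i q (S.G i q y) • S.H i q x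
      - S.sigma i q (S.G i q x) • S.H i q y + S.sigma i q x • S.G i q (S.H i q y)
      - S.sigma i q y • S.G i q (S.H i q x) = 0 := by
  obtain ⟨W, X, hW, hqW, hWd, hX, hXu, hXv, rfl⟩ := S.exists_smoothField_ker_v hq x hx.2
  obtain ⟨W', Y, hW', hqW', -, hY, hYu, hYv, rfl⟩ := S.exists_smoothField_ker_v hq y hy.2
  have h := (hn i (W ∩ W') (hW.inter hW') fun x hx => hWd hx.1).1 X Y
    (hX.mono Set.inter_subset_left) (hY.mono Set.inter_subset_right)
    (fun x hx' => (S.mem_horizontal_iff (hWd hx'.1) _).2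
      ⟨(hXu x hx'.1).trans hx.1, hXv x hx'.1⟩)
    (fun x hx' => (S.mem_horizontal_iff (hWd hx'.1) _).2
      ⟨(hYu x hx'.2).trans hy.1, hYv x hx'.2⟩) q ⟨hqW, hqW'⟩
  unfold tensorS at h
  rw [S.nijenhuis_G hq (hX.diffAlong hW hqW) (hY.diffAlong hW' hqW'), hx.2, hy.2] at h
  rw [← h]
  module

/-- This is S(x, U) = 0 after GU = HU = 0 and (∇_x G)U = -G∇_x U. -/
theorem IsSemiNormal.nablaG_U_eq (hn : S.IsSemiNormal) (hq : q ∈ S.dom i) (x : Tan E q) :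
    -S.G i q (S.nablaU i q (S.G i q x)) + S.G i q (S.G i q (S.nablaU i q x))
      + S.G i q (S.nablaG i q (S.U i q) x) = S.sigma i q (S.U i q) • S.G i q (S.H i q x) := by
  obtain ⟨W, X, hW, hqW, hX, rfl⟩ := exists_smoothField_extension q x
  have h := (hn i (W ∩ S.dom i) (hW.inter (S.isOpen_dom i)) Set.inter_subset_right).2 X
    (hX.mono Set.inter_subset_left) q ⟨hqW, hq⟩
  unfold tensorS at h
  rw [S.nijenhuis_G hq (hX.diffAlong hW hqW) (S.diffField_U hq), S.nablaG_U hq, S.nablaG_U hq,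
    S.G_U i q hq, S.H_U hq, S.v_U hq] at h
  simp only [map_zero, map_neg, LinearMap.zero_apply, smul_zero, mul_zero, zero_smul,
    S.sigma_zero] at h
  rw [← sub_eq_zero, ← h]
  module

/-- The contact equation fixes the skew part of ∇U; S(·, U) = 0 and the cyclic formula with one
argument U exclude any further symmetric part. -/
theorem IsSemiNormal.nablaU_eq (hc : S.IsContactMetric) (hn : S.IsSemiNormal) (hq : q ∈ S.dom i)
    (x : Tan E q) : S.nablaU i q x = -S.G i q x + S.sigma i q x • S.V i q := by
  refine nabla_characteristic_aux (metricForm S.g q) (S.g.symm q) (S.g.pos q) (S.U i q) (S.V i q)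
    (S.G i q : Tan E q →ₗ[ℝ] Tan E q) (S.H i q : Tan E q →ₗ[ℝ] Tan E q) (S.nablaU i q)
    (S.nablaG i q (S.U i q)) (S.sigma i q) (S.G_skew i q hq) (fun x => ?_) (S.G_U i q hq)
    (S.G_V hq) ?_ ?_ ?_ (S.inner_nablaU_U hq) (fun x => rfl) (S.contact_nablaU hc hq)
    (hn.nablaG_U_eq hq) (fun y z hyU hyV hzU hzV => ?_) x
  · exact (S.G_sq i q hq x).trans (by rw [S.u_dual i q hq, S.v_dual hq]; rfl)
  · exact (S.u_dual i q hq _).symm.trans (S.u_U i q hq)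
  · exact (S.v_dual hq _).symm.trans (S.v_V hq)
  · exact (S.v_dual hq _).symm.trans (S.v_U hq)
  · have hyU' := (S.u_dual i q hq y).trans hyU
    have hyV' := (S.v_dual hq y).trans hyV
    have hzU' := (S.u_dual i q hq z).trans hzU
    have hzV' := (S.v_dual hq z).trans hzV
    have h := S.nablaG_cyclic hc hq (S.v_U hq) hyV' hzV'
    rw [S.nablaG_U hq, S.H_U hq, S.g.symm q (S.U i q) (S.nablaG i q z y),
      S.nablaG_skew hq z y, S.nablaG_U hq, S.g.symm q (S.U i q) (S.H i q y),
      ← S.u_dual i q hq, S.u_H hq, S.g.symm q _ y] at h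
    simp only [map_neg, map_zero] at h
    change S.g.inner q y (S.nablaG i q (S.U i q) z) - S.g.inner q z (S.G i q (S.nablaU i q y))
      + S.g.inner q y (S.G i q (S.nablaU i q z))
        = S.sigma i q (S.U i q) * S.g.inner q y (S.H i q z)
    linarith

/-- `(∇_x G) y = σ(x) H y` modulo `U, V`. -/
theorem IsSemiNormal.inner_nablaG (hc : S.IsContactMetric) (hn : S.IsSemiNormal) (hq : q ∈ S.dom i)
    {x y z : Tan E q} (hx : S.u i q x = 0 ∧ S.v i q x = 0) (hy : S.u i q y = 0 ∧ S.v i q y = 0)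
    (hz : S.u i q z = 0 ∧ S.v i q z = 0) :
    S.g.inner q (S.nablaG i q x y) z = S.sigma i q x * S.g.inner q (S.H i q y) z := by
  refine nabla_structure_aux (fun x : Tan E q => S.u i q x = 0 ∧ S.v i q x = 0) (S.G i q)
    (fun x _ => ⟨S.u_G hq x, S.v_G hq x⟩)
    (fun x hx => ⟨-S.G i q x, ⟨by rw [map_neg, S.u_G hq, neg_zero],
      by rw [map_neg, S.v_G hq, neg_zero]⟩, by
        rw [map_neg, S.G_sq i q hq, hx.1, hx.2]; module⟩)
    (fun x y z => S.g.inner q (S.nablaG i q x y) z) (fun y z => S.g.inner q (S.H i q y) z)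
    (S.sigma i q) (fun x y z _ _ _ => S.nablaG_skew hq x y z) (fun y z _ _ => ?_)
    (fun x y z hx hy hz => ?_) (fun x y z hx hy hz => ?_) x y z hx hy hz
  · have := S.H_skew hq z y
    rw [S.g.symm q z] at this
    exact this
  · have h := S.nablaG_cyclic hc hq hx.2 hy.2 hz.2
    rw [S.g.symm q y, S.g.symm q z, S.g.symm q x, S.g.symm q y, S.g.symm q z, S.g.symm q x] at h
    exact h
  -- Pairing with a horizontal z kills the U and V components, and skewness moves the outer G onto
  -- z.
  · have h := congrArg (fun w => S.g.inner q z w) (hn.nablaG_horizontal hq hx hy)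
    have e1 : S.g.inner q z (S.U i q) = 0 := by rw [← S.u_dual i q hq, hz.1]
    have e2 : S.g.inner q z (S.V i q) = 0 := by rw [← S.v_dual hq, hz.2]
    simp only [map_add, map_sub, map_smul, map_zero, smul_eq_mul, e1, e2] at h
    have e3 : ∀ w, S.g.inner q z (S.G i q w) = -S.g.inner q w (S.G i q z) := fun w => by
      rw [S.G_skew i q hq, S.g.symm]
    rw [e3, e3, e3, e3] at h
    simp only [S.g.symm q z] at h
    linarith

/-- `(∇_U G) y = σ(U) H y` modulo `U, V`. -/
theorem IsSemiNormal.inner_nablaG_U_left (hc : S.IsContactMetric) (hn : S.IsSemiNormal)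
    (hq : q ∈ S.dom i) {y z : Tan E q} (hy : S.u i q y = 0 ∧ S.v i q y = 0)
    (hz : S.u i q z = 0 ∧ S.v i q z = 0) :
    S.g.inner q (S.nablaG i q (S.U i q) y) z
      = S.sigma i q (S.U i q) * S.g.inner q (S.H i q y) z := by
  -- In the cyclic formula at (U, z, y) the two terms other than (∇_U G)y reduce, by G∇U = -G², to
  -- -g(y, z) and g(y, z), which cancel.
  have h := S.nablaG_cyclic hc hq (S.v_U hq) hz.2 hy.2
  have e : ∀ w, S.G i q (S.nablaU i q w) = -S.G i q (S.G i q w) := fun w => by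
    rw [hn.nablaU_eq hc hq, map_add, map_neg, map_smul, S.G_V hq, smul_zero, add_zero]
  rw [S.nablaG_U hq, S.H_U hq, S.g.symm q (S.U i q) (S.nablaG i q y z),
    S.nablaG_skew hq y z, S.nablaG_U hq, S.g.symm q (S.U i q) (S.H i q z),
    ← S.u_dual i q hq, S.u_H hq, e, e, S.G_sq i q hq, S.G_sq i q hq, hy.1, hy.2, hz.1, hz.2,
    S.g.symm q z, S.g.symm q z] at h
  simp only [neg_neg, zero_smul, add_zero, map_neg, map_zero] at h
  change S.g.inner q (S.nablaG i q (S.U i q) y) z + -(S.g.inner q y z) + -(-(S.g.inner q y z)) = _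
    at h
  linarith

end ComplexAlmostContactMetric

end ContactCurvature

/-! ### Normal projection and the second fundamental form as a tensor -/

section SubmanifoldCalculus

variable {F : Type*} [NormedAddCommGroup F] [NormedSpace ℂ F] [FiniteDimensional ℂ F]
  {M : Type*} [TopologicalSpace M] [ChartedSpace F M]
  {E : Type*} [NormedAddCommGroup E] [NormedSpace ℂ E] [FiniteDimensional ℂ E]
  {N : Type*} [TopologicalSpace N] [ChartedSpace E N] [IsManifold 𝓘(ℂ, E) ω N] {ι : Type*}

namespace ComplexSubmanifold

variable (f : ComplexSubmanifold F M E N) (g : RiemMetric E N)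

/-- `normalPart` as a linear map. -/
def normalProj (p : M) : Tan E (f.toFun p) →ₗ[ℝ] Tan E (f.toFun p) where
  toFun := f.normalPart g p
  map_add' v w := by
    unfold normalPart
    rw [tangentPart_add, map_add]
    abel
  map_smul' a v := by
    unfold normalPart
    rw [tangentPart_smul, map_smul, RingHom.id_apply, smul_sub]

theorem tangentPart_d (p : M) (k : Tan F p) : f.tangentPart g p (f.d p k) = k :=
  (LinearMap.linearEquivOfInjective (f.inducedForm g p) _
    Subspace.dual_finrank_eq.symm).symm_apply_apply k

theorem normalProj_d (p : M) (k : Tan F p) : f.normalProj g p (f.d p k) = 0 := by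
  change f.d p k - f.d p (f.tangentPart g p (f.d p k)) = 0
  rw [tangentPart_d, sub_self]

theorem d_tangentPart {p : M} {w : Tan E (f.toFun p)} (h : f.normalProj g p w = 0) :
    f.d p (f.tangentPart g p w) = w :=
  (sub_eq_zero.1 h).symm

theorem d_tangentPart_add (p : M) (w : Tan E (f.toFun p)) :
    f.d p (f.tangentPart g p w) + f.normalProj g p w = w :=
  add_sub_cancel _ _

theorem normalProj_of_orthogonal {p : M} {w : Tan E (f.toFun p)}
    (h : ∀ z, g.inner _ w (f.d p z) = 0) : f.normalProj g p w = w := by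
  have h1 : (metricForm g (f.toFun p) w).comp (f.d p : Tan F p →ₗ[ℝ] _) = 0 :=
    LinearMap.ext h
  change w - f.d p (sharp _ _ _) = w
  rw [h1, map_zero, map_zero, sub_zero]

variable [IsManifold 𝓘(ℂ, F) ω M]

theorem contMDiff_real : ContMDiff 𝓘(ℝ, F) 𝓘(ℝ, E) ω f.toFun :=
  ContMDiff.real_of_complex f.holomorphic

theorem continuous : Continuous f.toFun := f.contMDiff_real.continuous

theorem d_J (p : M) (k : Tan F p) : f.d p (cplxJ F p k) = cplxJ E (f.toFun p) (f.d p k) :=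
  mfderiv_cplxJ f.holomorphic p k

theorem diffField_of_d {L : ∀ x : M, Tan F x} {p : M}
    (h : DiffAlong F f.toFun (fun x => f.d x (L x)) p) : DiffField L p :=
  DiffAlong.of_map_mfderiv f.contMDiff_real (f.injective_mfderiv p) h

theorem diffAlong_d {L : ∀ x : M, Tan F x} {p : M} (h : DiffField L p) :
    DiffAlong F f.toFun (fun x => f.d x (L x)) p :=
  DiffAlong.map_mfderiv f.contMDiff_real h

theorem covDerivAlong_d_sub {K L : ∀ x : M, Tan F x} {p : M} (hK : DiffField K p)
    (hL : DiffField L p) :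
    covDerivAlong g f.toFun (fun x => f.d x (L x)) p (K p)
      - covDerivAlong g f.toFun (fun x => f.d x (K x)) p (L p)
      = f.d p (VectorField.mlieBracket 𝓘(ℝ, F) K L p) :=
  covDerivAlong_mfderiv_sub g f.contMDiff_real hK hL

theorem diffField_extend {p : M} (k : Tan F p) :
    DiffField (fun x : M => FiberBundle.extend F k x) p := by
  obtain ⟨s, hs, hK⟩ := FiberBundle.exists_contMDiffOn_extend (k := ∞) 𝓘(ℝ, F) F (x₀ := p) k
  exact (hK.contMDiffAt hs).mdifferentiableAt (by simp)

/-- The difference is the normal part of df[K, L], which is tangent. -/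
theorem secondFundamentalForm_symm {K L : ∀ x : M, Tan F x} {p : M} (hK : DiffField K p)
    (hL : DiffField L p) :
    f.secondFundamentalForm g K L p = f.secondFundamentalForm g L K p := by
  have h := congrArg (f.normalProj g p) (f.covDerivAlong_d_sub g hK hL)
  rw [map_sub, normalProj_d] at h
  exact sub_eq_zero.1 h

/-- Only the value of the first field enters by definition; symmetry gives the same for the second.
-/
theorem secondFundamentalForm_congr {K L K' L' : ∀ x : M, Tan F x} {p : M} (hL : DiffField L p)
    (hL' : DiffField L' p) (hKK : K p = K' p) (hLL : L p = L' p) :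
    f.secondFundamentalForm g K L p = f.secondFundamentalForm g K' L' p := by
  have e : ∀ {K K' : ∀ x : M, Tan F x} (L : ∀ x : M, Tan F x), K p = K' p →
      f.secondFundamentalForm g K L p = f.secondFundamentalForm g K' L p := fun L h => by
    unfold secondFundamentalForm
    rw [h]
  have hX := diffField_extend (K' p)
  have hXp : FiberBundle.extend F (K' p) p = K' p := FiberBundle.extend_apply_self F _
  rw [e L (hKK.trans hXp.symm), f.secondFundamentalForm_symm g hX hL, e _ hLL,
    f.secondFundamentalForm_symm g hL' hX, e L' hXp]

theorem covDerivAlong_add_right (W : ∀ x : M, Tan E (f.toFun x)) (p : M) (k l : Tan F p) :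
    covDerivAlong g f.toFun W p (k + l)
      = covDerivAlong g f.toFun W p k + covDerivAlong g f.toFun W p l := by
  rw [covDerivAlong_eq, covDerivAlong_eq, covDerivAlong_eq, map_add, map_add, map_add]
  exact add_add_add_comm (G := E) _ _ _ _

theorem covDerivAlong_smul_right (W : ∀ x : M, Tan E (f.toFun x)) (p : M) (a : ℝ) (k : Tan F p) :
    covDerivAlong g f.toFun W p (a • k) = a • covDerivAlong g f.toFun W p k := by
  rw [covDerivAlong_eq, covDerivAlong_eq, map_smul, map_smul, map_smul]
  exact (smul_add (A := E) a _ _).symm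

/-- The second fundamental form as a bilinear form on `T_p M`. -/
def sffForm (p : M) : Tan F p →ₗ[ℝ] Tan F p →ₗ[ℝ] Tan E (f.toFun p) :=
  let h : Tan F p → Tan F p → Tan E (f.toFun p) := fun k l =>
    f.secondFundamentalForm g (FiberBundle.extend F k) (FiberBundle.extend F l) p
  have e : ∀ k l, h k l = f.normalProj g p (covDerivAlong g f.toFun
      (fun x => f.d x (FiberBundle.extend F l x)) p k) := fun k l =>
    congrArg (fun k => f.normalProj g p (covDerivAlong g f.toFun
      (fun x => f.d x (FiberBundle.extend F l x)) p k)) (FiberBundle.extend_apply_self F k)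
  have add : ∀ k k' l, h (k + k') l = h k l + h k' l := fun k k' l => by
    rw [e, e, e, covDerivAlong_add_right, map_add]
  have smul : ∀ (a : ℝ) k l, h (a • k) l = a • h k l := fun a k l => by
    rw [e, e, covDerivAlong_smul_right, map_smul]
  have symm : ∀ k l, h k l = h l k := fun k l =>
    f.secondFundamentalForm_symm g (diffField_extend k) (diffField_extend l)
  LinearMap.mk₂ ℝ h add smul (fun k l l' => by rw [symm, add, symm l, symm l'])
    (fun a k l => by rw [symm, smul, symm l])

theorem sffForm_symm (p : M) (k l : Tan F p) : f.sffForm g p k l = f.sffForm g p l k :=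
  f.secondFundamentalForm_symm g (diffField_extend k) (diffField_extend l)

theorem secondFundamentalForm_eq (K : ∀ x : M, Tan F x) {L : ∀ x : M, Tan F x} {p : M}
    (hL : DiffField L p) : f.secondFundamentalForm g K L p = f.sffForm g p (K p) (L p) :=
  f.secondFundamentalForm_congr g hL (diffField_extend _)
    (FiberBundle.extend_apply_self F (K p)).symm (FiberBundle.extend_apply_self F (L p)).symm

theorem normalProj_covDerivAlong {L : ∀ x : M, Tan F x} {p : M} (hL : DiffField L p)
    (k : Tan F p) :
    f.normalProj g p (covDerivAlong g f.toFun (fun x => f.d x (L x)) p k)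
      = f.sffForm g p k (L p) := by
  have h := f.secondFundamentalForm_eq g (FiberBundle.extend F k) hL
  rw [FiberBundle.extend_apply_self F k] at h
  refine Eq.trans ?_ h
  exact congrArg (fun k => f.normalProj g p (covDerivAlong g f.toFun
      (fun x => f.d x (L x)) p k)) (FiberBundle.extend_apply_self F k).symm

end ComplexSubmanifold

end SubmanifoldCalculus

/-! ### The normal part of G∇ and its values on D, U and V -/

section SemiInvariant

variable {F : Type*} [NormedAddCommGroup F] [NormedSpace ℂ F] [FiniteDimensional ℂ F]
  {M : Type*} [TopologicalSpace M] [ChartedSpace F M] [IsManifold 𝓘(ℂ, F) ω M]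
  {E : Type*} [NormedAddCommGroup E] [NormedSpace ℂ E] [FiniteDimensional ℂ E]
  {N : Type*} [TopologicalSpace N] [ChartedSpace E N] [IsManifold 𝓘(ℂ, E) ω N] {ι : Type*}

namespace ComplexSubmanifold

variable (f : ComplexSubmanifold F M E N) (S : ComplexAlmostContactMetric E N ι) {i : ι} {p : M}

/-- TM is J-invariant because the immersion is holomorphic, and the normal space is then J-invariant
because J is skew. -/
theorem normalProj_J (w : Tan E (f.toFun p)) :
    f.normalProj S.g p (cplxJ E (f.toFun p) w) = cplxJ E (f.toFun p) (f.normalProj S.g p w) := by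
  nth_rewrite 1 [← f.d_tangentPart_add S.g p w]
  rw [map_add, ← f.d_J, map_add, normalProj_d, zero_add]
  refine f.normalProj_of_orthogonal S.g fun z => ?_
  have h := S.inner_J (f.normalProj S.g p w) (f.d p z)
  rw [← f.d_J] at h
  have h' : S.g.inner _ (f.normalProj S.g p w) (f.d p (cplxJ F p z)) = 0 :=
    f.normalPart_orthogonal S.g p w _
  rw [h'] at h
  linarith

/-- H = -JG, and J is invertible on normal vectors. So tangency of Gw does not depend on the local
tensor G, nor on passing to the rotated structure. -/
theorem normalProj_H_eq_zero_iff (hi : f.toFun p ∈ S.dom i) (w : Tan E (f.toFun p)) :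
    f.normalProj S.g p (S.H i _ w) = 0 ↔ f.normalProj S.g p (S.G i _ w) = 0 := by
  rw [S.H_eq_neg_J_G hi, map_neg, normalProj_J, neg_eq_zero]
  refine ⟨fun h => ?_, fun h => by rw [h, map_zero]⟩
  have h2 := cplxJ_cplxJ _ (f.normalProj S.g p (S.G i _ w))
  rw [h, map_zero] at h2
  exact neg_eq_zero.1 h2.symm

/-- `P` as a linear map. -/
def linearP (i : ι) (p : M) : Tan F p →ₗ[ℝ] Tan F p where
  toFun := f.P S i p
  map_add' k l := by unfold P; rw [map_add, map_add, tangentPart_add]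
  map_smul' a k := by unfold P; rw [map_smul, map_smul, tangentPart_smul, RingHom.id_apply]

/-- `∇_k (G L)` has normal part `h(k, P L)`, so this is the normal part of `G ∇_k L` if `G L` is
tangent. -/
def structForm (i : ι) (p : M) : Tan F p →ₗ[ℝ] Tan F p →ₗ[ℝ] Tan E (f.toFun p) :=
  (f.sffForm S.g p).compl₂ (f.linearP S i p)
    - ((S.nablaG i (f.toFun p)).compl₁₂ (f.d p : Tan F p →ₗ[ℝ] Tan E (f.toFun p))
      (f.d p : Tan F p →ₗ[ℝ] Tan E (f.toFun p))).compr₂ (f.normalProj S.g p)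

theorem structForm_apply (k l : Tan F p) : f.structForm S i p k l
    = f.sffForm S.g p k (f.P S i p l)
      - f.normalProj S.g p (S.nablaG i (f.toFun p) (f.d p k) (f.d p l)) := rfl

theorem d_P {k : Tan F p} (h : f.normalProj S.g p (S.G i _ (f.d p k)) = 0) :
    f.d p (f.P S i p k) = S.G i (f.toFun p) (f.d p k) :=
  f.d_tangentPart S.g h

theorem eventually_mem_dom (hi : f.toFun p ∈ S.dom i) : ∀ᶠ x in 𝓝 p, f.toFun x ∈ S.dom i :=
  f.continuous.continuousAt.preimage_mem_nhds (S.mem_nhds_dom hi)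

theorem diffField_P (hi : f.toFun p ∈ S.dom i) {L : ∀ x : M, Tan F x} (hL : DiffField L p)
    (hGL : ∀ᶠ x in 𝓝 p, f.normalProj S.g x (S.G i _ (f.d x (L x))) = 0) :
    DiffField (fun x => f.P S i x (L x)) p := by
  refine f.diffField_of_d (DiffAlong.congr (DiffAlong.endo (S.diffEndo_G hi) (f.diffAlong_d hL)) ?_)
  filter_upwards [hGL] with x hx
  exact (f.d_P S hx).symm

/-- GL is the tangent field PL near p, so ∇_k(GL) has normal part h(k, PL); the Leibniz rule
isolates G∇_k L. -/
theorem normalProj_G_covDerivAlong (hi : f.toFun p ∈ S.dom i) {L : ∀ x : M, Tan F x}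
    (hL : DiffField L p)
    (hGL : ∀ᶠ x in 𝓝 p, f.normalProj S.g x (S.G i _ (f.d x (L x))) = 0) (k : Tan F p) :
    f.normalProj S.g p (S.G i _ (covDerivAlong S.g f.toFun (fun x => f.d x (L x)) p k))
      = f.structForm S i p k (L p) := by
  have h1 := covDerivAlong_endo S.g (S.diffEndo_G hi) (f.diffAlong_d hL) k
  have h2 : ∀ᶠ x in 𝓝 p, S.G i (f.toFun x) (f.d x (L x)) = f.d x (f.P S i x (L x)) := by
    filter_upwards [hGL] with x hx
    exact (f.d_P S hx).symm
  rw [covDerivAlong_congr S.g h2] at h1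
  have h3 := congrArg (f.normalProj S.g p) h1
  rw [f.normalProj_covDerivAlong S.g (f.diffField_P S hi hL hGL), map_add] at h3
  rw [structForm_apply, h3]
  exact (add_sub_cancel_left _ _).symm

/-- The normal part of `G [K, L]`. -/
theorem normalProj_G_mlieBracket (hi : f.toFun p ∈ S.dom i) {K L : ∀ x : M, Tan F x}
    (hK : DiffField K p) (hL : DiffField L p)
    (hGK : ∀ᶠ x in 𝓝 p, f.normalProj S.g x (S.G i _ (f.d x (K x))) = 0)
    (hGL : ∀ᶠ x in 𝓝 p, f.normalProj S.g x (S.G i _ (f.d x (L x))) = 0) :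
    f.normalProj S.g p (S.G i _ (f.d p (VectorField.mlieBracket 𝓘(ℝ, F) K L p)))
      = f.structForm S i p (K p) (L p) - f.structForm S i p (L p) (K p) := by
  rw [← f.covDerivAlong_d_sub S.g hK hL, map_sub, map_sub, f.normalProj_G_covDerivAlong S hi hL hGL,
    f.normalProj_G_covDerivAlong S hi hK hGK]

variable {f S}

theorem TangentUV.normalProj_U (hUV : f.TangentUV S) (hi : f.toFun p ∈ S.dom i) :
    f.normalProj S.g p (S.U i _) = 0 := by
  obtain ⟨k, hk⟩ := (hUV p i hi).1
  rw [← hk, normalProj_d]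

theorem TangentUV.normalProj_V (hUV : f.TangentUV S) (hi : f.toFun p ∈ S.dom i) :
    f.normalProj S.g p (S.V i _) = 0 := by
  obtain ⟨k, hk⟩ := (hUV p i hi).2
  rw [← hk, normalProj_d]

theorem TangentUV.rot (hUV : f.TangentUV S) : f.TangentUV S.rot := by
  intro p i hi
  obtain ⟨h1, k, hk⟩ := hUV p i hi
  obtain ⟨l, hl⟩ := h1
  exact ⟨⟨k, hk⟩, -l, by rw [map_neg, hl]; rfl⟩

/-- Vectors with the same products against horizontal vectors differ by a combination of U and V,
which is tangent. Formulas for ∇G modulo U, V are therefore exact after normal projection. -/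
theorem TangentUV.normalProj_eq (hUV : f.TangentUV S) (hi : f.toFun p ∈ S.dom i)
    {w w' : Tan E (f.toFun p)}
    (h : ∀ z, S.u i _ z = 0 ∧ S.v i _ z = 0 → S.g.inner _ w z = S.g.inner _ w' z) :
    f.normalProj S.g p w = f.normalProj S.g p w' := by
  obtain ⟨x, rfl⟩ : ∃ x, w = w' + x := ⟨w - w', (add_sub_cancel _ _).symm⟩
  have hx : ∀ z, S.u i _ z = 0 ∧ S.v i _ z = 0 → S.g.inner _ z x = 0 := fun z hz => by
    have := h z hz
    rw [S.g.symm _ _ z, map_add, S.g.symm _ w' z] at this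
    linarith
  have e : x = S.u i _ x • S.U i _ + S.v i _ x • S.V i _ := by
    refine metric_ext S.g fun z => ?_
    have h1 := hx (z - S.u i _ z • S.U i _ - S.v i _ z • S.V i _)
      ⟨by simp only [map_sub, map_smul, S.u_U i _ hi, S.u_V hi, smul_eq_mul]; ring,
        by simp only [map_sub, map_smul, S.v_U hi, S.v_V hi, smul_eq_mul]; ring⟩
    rw [S.g.symm _ _ x] at h1
    simp only [map_sub, map_smul, smul_eq_mul, ← S.u_dual i _ hi, ← S.v_dual hi] at h1
    rw [S.g.symm _ _ z, S.g.symm _ _ z]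
    simp only [map_add, map_smul, smul_eq_mul, ← S.u_dual i _ hi, ← S.v_dual hi]
    rw [S.g.symm _ z x]
    linarith
  rw [map_add, e, map_add, map_smul, map_smul, hUV.normalProj_U hi, hUV.normalProj_V hi,
    smul_zero, smul_zero, add_zero, add_zero]

variable (f S) in
/-- `U` as a vector field on `M`. -/
def tangentU (i : ι) (x : M) : Tan F x := f.tangentPart S.g x (S.U i (f.toFun x))

theorem TangentUV.d_tangentU (hUV : f.TangentUV S) (hi : f.toFun p ∈ S.dom i) :
    f.d p (f.tangentU S i p) = S.U i _ :=
  f.d_tangentPart S.g (hUV.normalProj_U hi)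

theorem TangentUV.diffField_tangentU (hUV : f.TangentUV S) (hi : f.toFun p ∈ S.dom i) :
    DiffField (f.tangentU S i) p := by
  refine f.diffField_of_d (DiffAlong.congr (DiffAlong.comp
    ((f.contMDiff_real p).mdifferentiableAt (by simp)) (S.diffField_U hi)) ?_)
  filter_upwards [f.eventually_mem_dom S hi] with x hx
  exact (hUV.d_tangentU hx).symm

/-- The normal part of ∇_k U = -Gk + σ(k)V, as V is tangent. -/
theorem TangentUV.sffForm_tangentU (hUV : f.TangentUV S) (hi : f.toFun p ∈ S.dom i)
    (hc : S.IsContactMetric) (hn : S.IsSemiNormal) (k : Tan F p) :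
    f.sffForm S.g p k (f.tangentU S i p) = -f.normalProj S.g p (S.G i _ (f.d p k)) := by
  rw [← f.normalProj_covDerivAlong S.g (hUV.diffField_tangentU hi)]
  have h : ∀ᶠ x in 𝓝 p, f.d x (f.tangentU S i x) = S.U i (f.toFun x) := by
    filter_upwards [f.eventually_mem_dom S hi] with x hx
    exact hUV.d_tangentU hx
  rw [covDerivAlong_congr S.g h, covDerivAlong_comp S.g
    ((f.contMDiff_real p).mdifferentiableAt (by simp)) (S.diffField_U hi)]
  refine (congrArg (f.normalProj S.g p) (hn.nablaU_eq hc hi (f.d p k))).trans ?_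
  rw [map_add, map_neg, map_smul, hUV.normalProj_V hi, smul_zero, add_zero]

theorem P_eq_zero {k : Tan F p} (h : S.G i _ (f.d p k) = 0) : f.P S i p k = 0 := by
  unfold P
  rw [h]
  have := f.tangentPart_smul S.g p 0 0
  rwa [zero_smul, zero_smul] at this

/-- The correction (∇_k G)l is σ(k)Hl modulo U, V, and Hl is tangent because Gl is. -/
theorem TangentUV.structForm_horizontal (hUV : f.TangentUV S) (hi : f.toFun p ∈ S.dom i)
    (hc : S.IsContactMetric) (hn : S.IsSemiNormal) {k l : Tan F p}
    (hk : S.u i _ (f.d p k) = 0 ∧ S.v i _ (f.d p k) = 0)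
    (hl : S.u i _ (f.d p l) = 0 ∧ S.v i _ (f.d p l) = 0)
    (hGl : f.normalProj S.g p (S.G i _ (f.d p l)) = 0) :
    f.structForm S i p k l = f.sffForm S.g p k (f.P S i p l) := by
  have h : f.normalProj S.g p (S.nablaG i _ (f.d p k) (f.d p l))
      = f.normalProj S.g p (S.sigma i _ (f.d p k) • S.H i _ (f.d p l)) :=
    hUV.normalProj_eq hi fun z hz => by
      rw [hn.inner_nablaG hc hi hk hl hz, map_smul]
      rfl
  rw [structForm_apply, h, map_smul, (f.normalProj_H_eq_zero_iff S hi _).2 hGl, smul_zero, sub_zero]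

/-- PU = 0, and (∇_k G)U = -G∇_k U = G²k, which is tangent. -/
theorem TangentUV.structForm_U_right (hUV : f.TangentUV S) (hi : f.toFun p ∈ S.dom i)
    (hc : S.IsContactMetric) (hn : S.IsSemiNormal) (k : Tan F p) :
    f.structForm S i p k (f.tangentU S i p) = 0 := by
  rw [structForm_apply, P_eq_zero (by rw [hUV.d_tangentU hi, S.G_U i _ hi]), map_zero,
    hUV.d_tangentU hi, S.nablaG_U hi, hn.nablaU_eq hc hi, map_add, map_neg, map_smul, S.G_V hi,
    map_neg, S.G_sq i _ hi]
  simp only [map_add, map_neg, map_smul, smul_zero, hUV.normalProj_U hi, hUV.normalProj_V hi,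
    normalProj_d, map_zero]
  simp

/-- h(U, Gk) is minus the normal part of G²k, a tangent vector, and (∇_U G)k is σ(U)Hk modulo U, V.
-/
theorem TangentUV.structForm_U_left (hUV : f.TangentUV S) (hi : f.toFun p ∈ S.dom i)
    (hc : S.IsContactMetric) (hn : S.IsSemiNormal) {k : Tan F p}
    (hk : S.u i _ (f.d p k) = 0 ∧ S.v i _ (f.d p k) = 0)
    (hGk : f.normalProj S.g p (S.G i _ (f.d p k)) = 0) :
    f.structForm S i p (f.tangentU S i p) k = 0 := by
  have h : f.normalProj S.g p (S.nablaG i _ (S.U i _) (f.d p k))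
      = f.normalProj S.g p (S.sigma i _ (S.U i _) • S.H i _ (f.d p k)) :=
    hUV.normalProj_eq hi fun z hz => by
      rw [hn.inner_nablaG_U_left hc hi hk hz, map_smul]
      rfl
  rw [structForm_apply, hUV.d_tangentU hi, h, map_smul, (f.normalProj_H_eq_zero_iff S hi _).2 hGk,
    sffForm_symm, hUV.sffForm_tangentU hi hc hn, f.d_P S hGk, S.G_sq i _ hi]
  simp only [map_add, map_neg, map_smul, smul_zero, hUV.normalProj_U hi, hUV.normalProj_V hi,
    normalProj_d]
  simp

/-- The bracket of `U` with a horizontal field `K` for which `G K` is tangent. -/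
theorem TangentUV.normalProj_G_bracket_U (hUV : f.TangentUV S) (hi : f.toFun p ∈ S.dom i)
    (hc : S.IsContactMetric) (hn : S.IsSemiNormal) {K : ∀ x : M, Tan F x} (hK : DiffField K p)
    (hk : S.u i _ (f.d p (K p)) = 0 ∧ S.v i _ (f.d p (K p)) = 0)
    (hGK : ∀ᶠ x in 𝓝 p, f.normalProj S.g x (S.G i _ (f.d x (K x))) = 0) :
    f.normalProj S.g p
      (S.G i _ (f.d p (VectorField.mlieBracket 𝓘(ℝ, F) K (f.tangentU S i) p))) = 0 := by
  rw [f.normalProj_G_mlieBracket S hi hK (hUV.diffField_tangentU hi) hGK,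
    hUV.structForm_U_right hi hc hn, hUV.structForm_U_left hi hc hn hk hGK.self_of_nhds, sub_zero]
  filter_upwards [f.eventually_mem_dom S hi] with x hx
  rw [hUV.d_tangentU hx, S.G_U i _ hx, map_zero]

variable (f S) in
/-- `V` as a vector field on `M`. -/
def tangentV (i : ι) (x : M) : Tan F x := f.tangentPart S.g x (S.V i (f.toFun x))

theorem TangentUV.d_tangentV (hUV : f.TangentUV S) (hi : f.toFun p ∈ S.dom i) :
    f.d p (f.tangentV S i p) = S.V i _ :=
  f.d_tangentPart S.g (hUV.normalProj_V hi)

theorem TangentUV.normalProj_G_tangentV (hUV : f.TangentUV S) (hi : f.toFun p ∈ S.dom i) :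
    ∀ᶠ x in 𝓝 p, f.normalProj S.g x (S.G i _ (f.d x (f.tangentV S i x))) = 0 := by
  filter_upwards [f.eventually_mem_dom S hi] with x hx
  rw [hUV.d_tangentV hx, S.G_V hx, map_zero]

theorem TangentUV.diffField_tangentV (hUV : f.TangentUV S) (hi : f.toFun p ∈ S.dom i) :
    DiffField (f.tangentV S i) p :=
  hUV.rot.diffField_tangentU hi

/-- The difference is the normal part of G[K, V]. It vanishes together with that of H[K, V], which
is the bracket with U for the rotated structure; no formula for ∇_V G is needed. -/
theorem TangentUV.structForm_V (hUV : f.TangentUV S) (hi : f.toFun p ∈ S.dom i)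
    (hc : S.IsContactMetric) (hn : S.IsNormal) {K : ∀ x : M, Tan F x} (hK : DiffField K p)
    (hk : S.u i _ (f.d p (K p)) = 0 ∧ S.v i _ (f.d p (K p)) = 0)
    (hGK : ∀ᶠ x in 𝓝 p, f.normalProj S.g x (S.G i _ (f.d x (K x))) = 0) :
    f.structForm S i p (K p) (f.tangentV S i p) - f.structForm S i p (f.tangentV S i p) (K p)
      = 0 := by
  rw [← f.normalProj_G_mlieBracket S hi hK (hUV.diffField_tangentV hi) hGK
    (hUV.normalProj_G_tangentV hi)]
  refine (f.normalProj_H_eq_zero_iff S hi _).1 ?_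
  refine hUV.rot.normalProj_G_bracket_U hi hc.rot hn.rot_isSemiNormal hK ⟨hk.2, ?_⟩ ?_
  · change -(S.u i _ (f.d p (K p))) = 0
    rw [hk.1, neg_zero]
  · filter_upwards [f.eventually_mem_dom S hi, hGK] with x hx hx'
    exact (f.normalProj_H_eq_zero_iff S hx _).2 hx'

/-- The rotated formula gives ∇_U V = -σ(U)U, which G kills, and PV = 0. -/
theorem TangentUV.structForm_U_V (hUV : f.TangentUV S) (hi : f.toFun p ∈ S.dom i)
    (hc : S.IsContactMetric) (hn : S.IsNormal) :
    f.structForm S i p (f.tangentU S i p) (f.tangentV S i p) = 0 := by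
  have h : covDeriv S.g (S.V i) _ (S.U i (f.toFun p)) = -S.H i _ (S.U i _)
      + S.rot.sigma i _ (S.U i _) • -S.U i _ :=
    hn.rot_isSemiNormal.nablaU_eq hc.rot hi (S.U i _)
  rw [structForm_apply, P_eq_zero (by rw [hUV.d_tangentV hi, S.G_V hi]), map_zero,
    hUV.d_tangentV hi, hUV.d_tangentU hi, S.nablaG_V hi, h, map_add, map_neg, map_smul, map_neg,
    map_neg, S.G_U i _ hi, S.H_U hi]
  simp

end ComplexSubmanifold

end SemiInvariant

/-! ### The distribution D ⊕ sp{U,V} and the antisymmetrized form on it -/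

section Involutivity

variable {F : Type*} [NormedAddCommGroup F] [NormedSpace ℂ F] [FiniteDimensional ℂ F]
  {M : Type*} [TopologicalSpace M] [ChartedSpace F M] [IsManifold 𝓘(ℂ, F) ω M]
  {E : Type*} [NormedAddCommGroup E] [NormedSpace ℂ E] [FiniteDimensional ℂ E]
  {N : Type*} [TopologicalSpace N] [ChartedSpace E N] [IsManifold 𝓘(ℂ, E) ω N] {ι : Type*}

/-- Metric duality carries the overlap relations from the forms u, v to the vectors U, V. -/
theorem ComplexAlmostContactMetric.U_V_mem_vertical (S : ComplexAlmostContactMetric E N ι) {i : ι}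
    {q : N} (hi : q ∈ S.dom i) : S.U i q ∈ S.vertical q ∧ S.V i q ∈ S.vertical q := by
  have key : ∀ j, q ∈ S.dom j → S.U i q ∈ Submodule.span ℝ {S.U j q, S.V j q} ∧
      S.V i q ∈ Submodule.span ℝ {S.U j q, S.V j q} := by
    intro j hj
    obtain ⟨c, d, -, hu, hv, -, -⟩ := S.overlap j i q ⟨hj, hi⟩
    have hU : S.U i q = c • S.U j q + (-d) • S.V j q := by
      refine metric_ext S.g fun z => ?_
      rw [S.g.symm, ← S.u_dual i q hi, S.g.symm q _ z, map_add, map_smul, map_smul,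
        ← S.u_dual j q hj, ← S.v_dual hj, hu]
      change c * S.u j q z - d * S.v j q z = c * S.u j q z + (-d) * S.v j q z
      ring
    have hV : S.V i q = d • S.U j q + c • S.V j q := by
      refine metric_ext S.g fun z => ?_
      rw [S.g.symm, ← S.v_dual hi, S.g.symm q _ z, map_add, map_smul, map_smul,
        ← S.u_dual j q hj, ← S.v_dual hj, hv]
      rfl
    exact ⟨Submodule.mem_span_pair.2 ⟨c, -d, hU.symm⟩, Submodule.mem_span_pair.2 ⟨d, c, hV.symm⟩⟩
  simp only [vertical, Submodule.mem_iInf]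
  exact ⟨fun j hj => (key j hj).1, fun j hj => (key j hj).2⟩

namespace ComplexSubmanifold

variable {f : ComplexSubmanifold F M E N} {S : ComplexAlmostContactMetric E N ι} {i : ι} {p : M}

theorem horizontal_of_mem_D (hi : f.toFun p ∈ S.dom i) {k : Tan F p} (hk : k ∈ f.D S p) :
    S.u i _ (f.d p k) = 0 ∧ S.v i _ (f.d p k) = 0 :=
  (S.mem_horizontal_iff hi _).1 hk.1

theorem normalProj_G_of_mem_D (hi : f.toFun p ∈ S.dom i) {k : Tan F p} (hk : k ∈ f.D S p) :
    f.normalProj S.g p (S.G i _ (f.d p k)) = 0 :=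
  hk.2 i hi

theorem TangentUV.exists_of_mem_sup (hUV : f.TangentUV S) (hi : f.toFun p ∈ S.dom i)
    {w : Tan F p} (hw : w ∈ f.D S p ⊔ f.spUV S p) :
    ∃ k ∈ f.D S p, ∃ a b : ℝ, w = k + (a • f.tangentU S i p + b • f.tangentV S i p) := by
  obtain ⟨k, hk, l, hl, rfl⟩ := Submodule.mem_sup.1 hw
  have hl' : f.d p l ∈ S.vertical (f.toFun p) := hl
  simp only [ComplexAlmostContactMetric.vertical, Submodule.mem_iInf] at hl'
  obtain ⟨a, b, hab⟩ := Submodule.mem_span_pair.1 (hl' i hi)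
  refine ⟨k, hk, a, b, congrArg (k + ·) (f.injective_mfderiv p ?_)⟩
  change f.d p l = f.d p _
  rw [map_add, map_smul, map_smul, hUV.d_tangentU hi, hUV.d_tangentV hi, hab]

/-- `D ⊕ sp{U, V}` consists of the tangent vectors `w` to `M` for which `G w` is tangent to `M`. -/
theorem TangentUV.mem_sup_iff (hUV : f.TangentUV S) (hi : f.toFun p ∈ S.dom i) (w : Tan F p) :
    w ∈ f.D S p ⊔ f.spUV S p ↔ f.normalProj S.g p (S.G i _ (f.d p w)) = 0 := by
  constructor
  · intro hw
    obtain ⟨k, hk, a, b, rfl⟩ := hUV.exists_of_mem_sup hi hw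
    simp only [map_add, map_smul, hUV.d_tangentU hi, hUV.d_tangentV hi, S.G_U i _ hi, S.G_V hi,
      smul_zero, add_zero, normalProj_G_of_mem_D hi hk]
  · intro h
    -- Here l is the vertical part of w. Removing it makes w horizontal without changing Gw.
    set l : Tan F p := S.u i _ (f.d p w) • f.tangentU S i p + S.v i _ (f.d p w) • f.tangentV S i p
      with hl
    have hdl : f.d p l = S.u i _ (f.d p w) • S.U i _ + S.v i _ (f.d p w) • S.V i _ := by
      rw [hl, map_add, map_smul, map_smul, hUV.d_tangentU hi, hUV.d_tangentV hi]
    have hGl : S.G i _ (f.d p l) = 0 := by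
      rw [hdl, map_add, map_smul, map_smul, S.G_U i _ hi, S.G_V hi, smul_zero, smul_zero, add_zero]
    have hG : f.normalProj S.g p (S.G i _ (f.d p (w - l))) = 0 := by
      rw [map_sub, map_sub, hGl, sub_zero, h]
    refine Submodule.mem_sup.2 ⟨w - l, ⟨?_, fun j hj => ?_⟩, l, ?_, sub_add_cancel _ _⟩
    · refine (S.mem_horizontal_iff hi (f.d p (w - l))).2 ⟨?_, ?_⟩
      · rw [map_sub, hdl]
        simp only [map_sub, map_add, map_smul, S.u_U i _ hi, S.u_V hi, smul_eq_mul]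
        ring
      · rw [map_sub, hdl]
        simp only [map_sub, map_add, map_smul, S.v_U hi, S.v_V hi, smul_eq_mul]
        ring
    -- For another index j, the tensor G_j is a combination of G_i and H_i, and both have tangent
    -- values on w - l.
    · obtain ⟨c, d, -, -, -, hGj, -⟩ := S.overlap i j _ ⟨hi, hj⟩
      change f.normalProj S.g p (S.G j _ (f.d p (w - l))) = 0
      rw [hGj]
      change f.normalProj S.g p (c • S.G i _ (f.d p (w - l)) - d • S.H i _ (f.d p (w - l))) = 0
      rw [map_sub, map_smul, map_smul, hG, (f.normalProj_H_eq_zero_iff S hi _).2 hG, smul_zero,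
        smul_zero, sub_zero]
    · change f.d p l ∈ S.vertical (f.toFun p)
      rw [hdl]
      exact add_mem (Submodule.smul_mem _ _ (S.U_V_mem_vertical hi).1)
        (Submodule.smul_mem _ _ (S.U_V_mem_vertical hi).2)

/-- By bilinearity only pairs from D, U and V matter, and `hh` is needed only for pairs from D. -/
theorem TangentUV.structForm_sub_eq_zero (hUV : f.TangentUV S) (hi : f.toFun p ∈ S.dom i)
    (hc : S.IsContactMetric) (hn : S.IsNormal) (hD : IsSmoothDistribution (f.D S))
    (hh : ∀ k ∈ f.D S p, ∀ l ∈ f.D S p,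
      f.sffForm S.g p k (f.P S i p l) = f.sffForm S.g p (f.P S i p k) l)
    {k l : Tan F p} (hk' : k ∈ f.D S p ⊔ f.spUV S p) (hl' : l ∈ f.D S p ⊔ f.spUV S p) :
    f.structForm S i p k l - f.structForm S i p l k = 0 := by
  obtain ⟨k, hk, a, b, rfl⟩ := hUV.exists_of_mem_sup hi hk'
  obtain ⟨l, hl, a', b', rfl⟩ := hUV.exists_of_mem_sup hi hl'
  have h1 : ∀ k ∈ f.D S p, f.structForm S i p k (f.tangentV S i p)
      = f.structForm S i p (f.tangentV S i p) k := by
    intro k hk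
    -- The statement for V comes from a bracket, so k must be extended to a local section of D.
    obtain ⟨W, K, hW, hpW, hK, hKD, rfl⟩ := hD p k hk
    refine sub_eq_zero.1 (hUV.structForm_V hi hc hn (hK.diffAlong hW hpW)
      (horizontal_of_mem_D hi hk) ?_)
    filter_upwards [hW.mem_nhds hpW, f.eventually_mem_dom S hi] with x hx hx'
    exact normalProj_G_of_mem_D hx' (hKD x hx)
  have h2 : ∀ k ∈ f.D S p, f.structForm S i p (f.tangentU S i p) k = 0 := fun k hk =>
    hUV.structForm_U_left hi hc hn.isSemiNormal (horizontal_of_mem_D hi hk)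
      (normalProj_G_of_mem_D hi hk)
  have h3 := hUV.structForm_U_right hi hc hn.isSemiNormal
  have h4 := hUV.structForm_U_V hi hc hn
  have h5 : f.structForm S i p k l = f.structForm S i p l k := by
    rw [hUV.structForm_horizontal hi hc hn.isSemiNormal (horizontal_of_mem_D hi hk)
      (horizontal_of_mem_D hi hl) (normalProj_G_of_mem_D hi hl),
      hUV.structForm_horizontal hi hc hn.isSemiNormal (horizontal_of_mem_D hi hl)
      (horizontal_of_mem_D hi hk) (normalProj_G_of_mem_D hi hk), hh k hk l hl, sffForm_symm]
  simp only [map_add, map_smul, LinearMap.add_apply, LinearMap.smul_apply, h1 k hk, h1 l hl,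
    h2 k hk, h2 l hl, h3, h4, h5]
  module

end ComplexSubmanifold

end Involutivity

end

/-! ### The equivalence -/

theorem mainTheorem5 {E N ι F M : Type*}
    [NormedAddCommGroup E] [NormedSpace ℂ E] [FiniteDimensional ℂ E]
    [TopologicalSpace N] [ChartedSpace E N] [IsManifold 𝓘(ℂ, E) ω N]
    [NormedAddCommGroup F] [NormedSpace ℂ F] [FiniteDimensional ℂ F]
    [TopologicalSpace M] [ChartedSpace F M] [IsManifold 𝓘(ℂ, F) ω M]
    (m : ℕ) (hdim : Module.finrank ℂ E = 2 * m + 1)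
    (S : ComplexAlmostContactMetric E N ι) (hcontact : S.IsContactMetric) (hnormal : S.IsNormal)
    (f : ComplexSubmanifold F M E N) (hsemi : f.IsSemiInvariant S) :
    IsInvolutive (fun p => f.D S p ⊔ f.spUV S p) ↔
      ∀ (i : ι) (W : Set M) (K L : ∀ x : M, Tan F x), IsOpen W →
        (∀ x ∈ W, f.toFun x ∈ S.dom i) → IsSmoothField K W → IsSmoothField L W →
        (∀ x ∈ W, K x ∈ f.D S x) → (∀ x ∈ W, L x ∈ f.D S x) →
        ∀ x ∈ W,
          f.secondFundamentalForm S.g K (fun y => f.P S i y (L y)) x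
            = f.secondFundamentalForm S.g (fun y => f.P S i y (K y)) L x := by
  have hUV := hsemi.tangentUV
  have hGD : ∀ {i : ι} {W : Set M} {K : ∀ x : M, Tan F x}, IsOpen W →
      (∀ x ∈ W, f.toFun x ∈ S.dom i) → (∀ x ∈ W, K x ∈ f.D S x) → ∀ x ∈ W,
      ∀ᶠ y in 𝓝 x, f.normalProj S.g y (S.G i _ (f.d y (K y))) = 0 := by
    intro i W K hW hWd hKD x hx
    filter_upwards [hW.mem_nhds hx] with y hy
    exact ComplexSubmanifold.normalProj_G_of_mem_D (hWd y hy) (hKD y hy)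
  constructor
  · intro h i W K L hW hWd hK hL hKD hLD x hx
    have hi := hWd x hx
    have hK' := hK.diffAlong hW hx
    have hL' := hL.diffAlong hW hx
    -- Involutivity makes G[K, L] tangent, which for sections of D reads h(K, PL) = h(L, PK);
    -- symmetry of h does the rest.
    have h1 := (hUV.mem_sup_iff hi _).1 (h W K L hW hK hL
      (fun y hy => Submodule.mem_sup_left (hKD y hy))
      (fun y hy => Submodule.mem_sup_left (hLD y hy)) x hx)
    rw [f.normalProj_G_mlieBracket S hi hK' hL' (hGD hW hWd hKD x hx) (hGD hW hWd hLD x hx),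
      hUV.structForm_horizontal hi hcontact hnormal.isSemiNormal
        (ComplexSubmanifold.horizontal_of_mem_D hi (hKD x hx))
        (ComplexSubmanifold.horizontal_of_mem_D hi (hLD x hx)) (hGD hW hWd hLD x hx).self_of_nhds,
      hUV.structForm_horizontal hi hcontact hnormal.isSemiNormal
        (ComplexSubmanifold.horizontal_of_mem_D hi (hLD x hx))
        (ComplexSubmanifold.horizontal_of_mem_D hi (hKD x hx)) (hGD hW hWd hKD x hx).self_of_nhds,
      sub_eq_zero] at h1
    rw [f.secondFundamentalForm_eq S.g K (f.diffField_P S hi hL' (hGD hW hWd hLD x hx)),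
      f.secondFundamentalForm_eq S.g _ hL', h1, f.sffForm_symm]
  · intro h W K L hW hK hL hKD hLD x hx
    obtain ⟨i, hi⟩ := S.cover (f.toFun x)
    have hG : ∀ {K : ∀ x : M, Tan F x}, (∀ x ∈ W, K x ∈ f.D S x ⊔ f.spUV S x) →
        ∀ᶠ y in 𝓝 x, f.normalProj S.g y (S.G i _ (f.d y (K y))) = 0 := by
      intro K hKD
      filter_upwards [hW.mem_nhds hx, f.eventually_mem_dom S hi] with y hy hy'
      exact (hUV.mem_sup_iff hy' _).1 (hKD y hy)
    refine (hUV.mem_sup_iff hi _).2 ?_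
    rw [f.normalProj_G_mlieBracket S hi (hK.diffAlong hW hx) (hL.diffAlong hW hx) (hG hKD) (hG hLD)]
    refine hUV.structForm_sub_eq_zero hi hcontact hnormal hsemi.smooth_D ?_ (hKD x hx) (hLD x hx)
    intro k hk l hl
    -- The hypothesis concerns sections of D, so k and l are extended to sections, on a set small
    -- enough for M to lie over the domain of index i.
    obtain ⟨W₁, K', hW₁, hx₁, hK', hKD', rfl⟩ := hsemi.smooth_D x k hk
    obtain ⟨W₂, L', hW₂, hx₂, hL', hLD', rfl⟩ := hsemi.smooth_D x l hl
    have hW₃ : IsOpen (W₁ ∩ W₂ ∩ f.toFun ⁻¹' S.dom i) :=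
      (hW₁.inter hW₂).inter ((S.isOpen_dom i).preimage f.continuous)
    have h1 := h i (W₁ ∩ W₂ ∩ f.toFun ⁻¹' S.dom i) K' L' hW₃ (fun y hy => hy.2)
      (hK'.mono fun y hy => hy.1.1) (hL'.mono fun y hy => hy.1.2) (fun y hy => hKD' y hy.1.1)
      (fun y hy => hLD' y hy.1.2) x ⟨⟨hx₁, hx₂⟩, hi⟩
    have hL₂ := hL'.diffAlong hW₂ hx₂
    rwa [f.secondFundamentalForm_eq S.g K' (f.diffField_P S hi hL₂
      (hGD hW₃ (fun y hy => hy.2) (fun y hy => hLD' y hy.1.2) x ⟨⟨hx₁, hx₂⟩, hi⟩)),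
      f.secondFundamentalForm_eq S.g _ hL₂] at h1
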